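/- Let $X$ be a relatively compact (i.e. totally bounded) metric space and $m$ a finite Radon measure on $X$ with $\operatorname{supp} m=X$. Let $(\mathcal E_A,V_{1/2})$ be a Dirichlet form on $L^2(X)=L^2(X,m)$ (densely defined, bilinear, symmetric, non-negative, closed, Markovian) with associated self-adjoint operator $A$: $u\in D(A)$ and $Au=w$ iff $u\in V_{1/2}$ and $\mathcal E_A(u,v)=(w,v)$ for all $v\in V_{1/2}$. Assume that $V_{1/2}$ embeds compactly in $L^2(X)$ and continuously in $L^{2q_A}(X)$ for some $q_A>1$, and that all eigenvalues of $A$ are positive. Then $L^2(X)$ has an (at most countable) orthonormal basis $(\varphi_n)$ of eigenvectors of $A$, $A\varphi_n=\lambda_n\varphi_n$, with $\inf_n\lambda_n>0$. Fix any such basis, and for $s\ge 0$ put $$V_s=D(A^s)=\Big\{h\in L^2(X):\ \|h\|_{V_s}^2:=\sum_n\lambda_n^{2s}|(h,\varphi_n)|^2<\infty\Big\},\qquad V_{-s}=(V_s)^*,$$ with $L^2(X)\hookrightarrow V_{-s}$ by $h\mapsto (h,\cdot)$. Let $1<\alpha<2$, $\gamma=1/\alpha$, let $1\le p<\frac1{2-\alpha}$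 and $\frac1p+\frac1q=1$ ($q\in(1,\infty]$). Consider $$\mathbb D_t^\alpha u+Au=f\ \text{ in } X\times(0,T),\qquad u(0)=u_0,\quad \partial_tu(0)=u_1, \tag{P}$$ where $$\mathbb D_t^\alpha u(t)=\frac1{\Gamma(2-\alpha)}\,\partial_t^2\int_0^t(t-s)^{1-\alpha}\big(u(s)-u(0)-s\,\partial_tu(0)\big)\,ds ,$$ the second derivative being taken in $V_{-\gamma}$. A weak solution of (P) on $(0,T)$ is a function $u\in C([0,T];V_\gamma)\cap C^1([0,T];L^2(X))$ with $\mathbb D_t^\alpha u\in C([0,T];V_{-\gamma})$, $u(0)=u_0$, $\partial_tu(0)=u_1$, $\|u(t)-u_0\|_{V_\sigma}\to0$ and $\|\partial_tu(t)-u_1\|_{V_{-\beta}}\to0$ as $t\to0^+$ for some $0\le\sigma<\gamma$ and some $0<\beta\le1-\gamma$, and such that for every $\varphi\in V_\gamma$ and a.e. $t\in(0,T)$ $$\langle\mathbb D_t^\alpha u(t),\varphi\rangle_{V_{-\gamma},V_\gamma}+\mathcal E_A(u(t),\varphi)=(f(t),\varphi).$$ A strong solution is a weak solution with $\mathbb D_t^\alpha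 u\in L^1((0,T);L^2(X))$ and $u\in L^1((0,T);D(A))$, where $D(A)=V_1$. Write $E_{a,b}(z)=\sum_{k\ge0}z^k/\Gamma(ak+b)$. Below $T>0$ and $f\in W^{1,q}((0,T);L^2(X))$ are arbitrary, and $f$ is identified with its representative that is continuous on $[0,T]$. (a) There is $C>0$, independent of $T,f,u_0,u_1$, such that for all $u_0\in V_\gamma$ and $u_1\in L^2(X)$, problem (P) has a unique strong solution $u$ on $(0,T)$. For every $t\in[0,T]$ it is given by $$u(t)=\sum_n(u_0,\varphi_n)E_{\alpha,1}(-\lambda_nt^\alpha)\varphi_n+\sum_n(u_1,\varphi_n)\,tE_{\alpha,2}(-\lambda_nt^\alpha)\varphi_n+\sum_n\Big(\int_0^t(f(\tau),\varphi_n)(t-\tau)^{\alpha-1}E_{\alpha,\alpha}(-\lambda_n(t-\tau)^\alpha)\,d\tau\Big)\varphi_n,$$ and for every $t\in(0,T)$ one has $\mathbb D_t^\alpha u(t)\in L^2(X)$, $u(t)\in D(A)$, $\mathbb D_t^\alpha u(t)+Au(t)=f(t)$ and $$\|\mathbb D_t^\alpha u(t)\|_{L^2}+\|Au(t)\|_{L^2}\le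 Ct^{1-\alpha}\big(\|u_0\|_{V_\gamma}+\|u_1\|_{L^2}\big)+C\big(\|f(t)\|_{L^2}+\|f(0)\|_{L^2}+t^{1/p}\|\partial_tf\|_{L^q((0,T);L^2)}\big).$$ (b) Let $\sigma>\frac1\alpha$ and $\beta>\frac{\alpha-1}\alpha$. For each $T>0$ there is $C>0$, independent of $f,u_0,u_1$, and independent also of $T$ if $\sigma\le1$ and $\beta\le1$, such that if $u_0\in V_\sigma$ and $u_1\in V_\beta$, then the strong solution $u$ of (P) belongs to $W^{2,1}((0,T);L^2(X))$, $$\|\partial_t^2u\|_{L^1((0,T);L^2)}\le C\Big(T^{\alpha\sigma-1}\|u_0\|_{V_\sigma}+T^{1-\alpha(1-\beta)}\|u_1\|_{V_\beta}+T^{\frac1p+\alpha-1}\|\partial_tf\|_{L^q((0,T);L^2)}+T^{\alpha-1}\|f(0)\|_{L^2}\Big),$$ and $$\lim_{t\to0^+}\|u(t)-u_0\|_{V_\gamma}=0,\qquad \lim_{t\to0^+}\|\partial_tu(t)-u_1\|_{L^2}=0.$$ -/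

import Mathlib

open MeasureTheory Filter Topology Set
open scoped ENNReal ContDiff

noncomputable section

namespace FracWave

/-- The real Hilbert space `L²(X, m)`. -/
abbrev L2 {X : Type*} [MeasurableSpace X] (m : Measure X) := Lp ℝ 2 m

/-- A Dirichlet form on `L²(X, m)`: a densely defined, symmetric, non-negative, closed and
Markovian bilinear form. -/
structure DirichletForm {X : Type*} [MeasurableSpace X] (m : Measure X) where
  /-- the form domain, called `V_{1/2}` -/
  dom : Submodule ℝ (L2 m)
  form : dom →ₗ[ℝ] dom →ₗ[ℝ] ℝ
  dense_dom : Dense (dom : Set (L2 m))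
  symm : ∀ u v, form u v = form v u
  nonneg : ∀ u, 0 ≤ form u u
  closed : ∀ l : ℝ, 0 < l → ∀ u : ℕ → dom,
    Tendsto (fun k : ℕ × ℕ => form (u k.1 - u k.2) (u k.1 - u k.2)
      + l * ‖((u k.1 - u k.2 : dom) : L2 m)‖ ^ 2) atTop (𝓝 0) →
    ∃ v : dom, Tendsto (fun n => form (u n - v) (u n - v)
      + l * ‖((u n - v : dom) : L2 m)‖ ^ 2) atTop (𝓝 0)
  markov : ∀ ε : ℝ, 0 < ε → ∃ φ : ℝ → ℝ, ContDiff ℝ ∞ φ ∧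
    (∀ t ∈ Icc (0 : ℝ) 1, φ t = t) ∧ (∀ t, -ε ≤ φ t ∧ φ t ≤ 1 + ε) ∧
    (∀ s t, s < t → 0 ≤ φ t - φ s ∧ φ t - φ s ≤ t - s) ∧
    ∀ u : dom, ∃ v : dom,
      ((v : L2 m) : X → ℝ) =ᵐ[m] (fun x => φ (((u : L2 m) : X → ℝ) x)) ∧ form v v ≤ form u u

variable {X : Type*} [MeasurableSpace X] {m : Measure X}

/-- The graph of the self-adjoint operator `A` associated with the form:
`u ∈ D(A)` and `A u = w`, i.e. `E(u, v) = (w, v)` for all `v` in the form domain. -/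
def DirichletForm.IsOp (E : DirichletForm m) (u w : L2 m) : Prop :=
  ∃ hu : u ∈ E.dom, ∀ v : E.dom, E.form ⟨u, hu⟩ v = inner ℝ w (v : L2 m)

/-- The embedding of the form domain (with the norm `(E(u,u) + ‖u‖²)^{1/2}`) into `L²` is
compact. -/
def DirichletForm.CompactEmbedding (E : DirichletForm m) : Prop :=
  IsCompact (closure {u : L2 m | ∃ v : E.dom, (v : L2 m) = u ∧ E.form v v + ‖(v : L2 m)‖ ^ 2 ≤ 1})

/-- The form domain embeds continuously into `L^{2r}(X, m)`. -/
def DirichletForm.SobolevEmbedding (E : DirichletForm m) (r : ℝ) : Prop :=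
  ∃ C : ℝ, 0 < C ∧ ∀ u : E.dom, eLpNorm ((u : L2 m) : X → ℝ) (ENNReal.ofReal (2 * r)) m ≤
    ENNReal.ofReal (C * Real.sqrt (E.form u u + ‖(u : L2 m)‖ ^ 2))

/-- All eigenvalues of `A` are positive. (The spectrum of `A` is discrete under the compactness
assumption, so this says that the smallest eigenvalue is positive.) -/
def DirichletForm.PosEigenvalues (E : DirichletForm m) : Prop :=
  ∀ (l : ℝ) (h : L2 m), h ≠ 0 → E.IsOp h (l • h) → 0 < l

/-- An orthonormal basis of `L²(X, m)` of eigenvectors of `A`, with eigenvalues bounded below by a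
positive number. The index type is left open because `L²(X, m)` may have finite dimension. -/
structure EigenBasis (E : DirichletForm m) (ι : Type*) where
  φ : HilbertBasis ι ℝ (L2 m)
  lam : ι → ℝ
  isOp : ∀ i, E.IsOp (φ i) (lam i • φ i)
  lower : ∃ c : ℝ, 0 < c ∧ ∀ i, c ≤ lam i

namespace EigenBasis

variable {E : DirichletForm m} {ι : Type*} (B : EigenBasis E ι)

theorem lam_pos (i : ι) : 0 < B.lam i := by
  obtain ⟨c, hc, h⟩ := B.lower
  exact hc.trans_le (h i)

/-- The sequence `λ_n^s (h, φ_n)` of coefficients of `A^s h`. -/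
def coef (s : ℝ) : L2 m →ₗ[ℝ] (ι → ℝ) where
  toFun h i := B.lam i ^ s * inner ℝ (B.φ i) h
  map_add' h k := by ext i; simp [inner_add_right, mul_add]
  map_smul' c h := by ext i; simp [inner_smul_right]; ring

/-- The subspace `D(A^s) = {h ∈ L² : ∑ λ_n^{2s} |(h, φ_n)|² < ∞}`. -/
def sub (s : ℝ) : Submodule ℝ (L2 m) where
  carrier := {h | Memℓp (B.coef s h) 2}
  add_mem' := by
    intro a b ha hb
    simp only [mem_ofPred_eq, map_add] at *
    exact ha.add hb
  zero_mem' := by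
    simp only [mem_ofPred_eq, map_zero]
    exact zero_memℓp
  smul_mem' := by
    intro c h hh
    simp only [mem_ofPred_eq, map_smul] at *
    exact hh.const_smul c

theorem mem_sub_iff (s : ℝ) (h : L2 m) :
    h ∈ B.sub s ↔ Summable fun i => B.lam i ^ (2 * s) * |inner ℝ h (B.φ i)| ^ 2 := by
  have e : (fun i => B.lam i ^ (2 * s) * |inner ℝ h (B.φ i)| ^ 2)
      = fun i => ‖B.coef s h i‖ ^ (2 : ℝ≥0∞).toReal := by
    ext i
    have h1 : B.lam i ^ (2 * s) = (B.lam i ^ s) ^ 2 := by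
      rw [mul_comm, Real.rpow_mul (B.lam_pos i).le]; norm_num
    simp [coef, h1, mul_pow, real_inner_comm]
  rw [e]
  exact memℓp_gen_iff (by norm_num)

/-- The space `V_s = D(A^s)`, to be normed by `(∑ λ_n^{2s} |(h, φ_n)|²)^{1/2}`. -/
def V (s : ℝ) : Type _ := B.sub s

instance (s : ℝ) : AddCommGroup (B.V s) := inferInstanceAs (AddCommGroup (B.sub s))
instance (s : ℝ) : Module ℝ (B.V s) := inferInstanceAs (Module ℝ (B.sub s))

/-- The inclusion of `V_s` in `L²`. -/
def incl (s : ℝ) : B.V s →ₗ[ℝ] L2 m := (B.sub s).subtype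

instance (s : ℝ) : CoeOut (B.V s) (L2 m) := ⟨B.incl s⟩

/-- `h ↦ (λ_n^s (h, φ_n))_n` as a map into `ℓ²`. -/
def toEll2 (s : ℝ) : B.V s →ₗ[ℝ] lp (fun _ : ι => ℝ) 2 where
  toFun h := ⟨B.coef s (B.incl s h), h.2⟩
  map_add' h k := Subtype.ext (by simp [map_add]; rfl)
  map_smul' c h := Subtype.ext (by simp [map_smul]; rfl)

theorem toEll2_injective (s : ℝ) : Function.Injective (B.toEll2 s) := by
  rw [← LinearMap.ker_eq_bot, LinearMap.ker_eq_bot']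
  intro h hh
  have h0 : ∀ i, inner ℝ (B.φ i) (B.incl s h) = 0 := by
    intro i
    have h1 : B.lam i ^ s * inner ℝ (B.φ i) (B.incl s h) = 0 := by
      have := congrArg (fun x : lp (fun _ : ι => ℝ) 2 => x i) hh
      simpa [toEll2, coef] using this
    exact (mul_eq_zero.1 h1).resolve_left (Real.rpow_pos_of_pos (B.lam_pos i) s).ne'
  have h2 : B.incl s h = 0 := by
    apply B.φ.repr.injective
    ext i
    simp [HilbertBasis.repr_apply_apply, h0 i]
  exact Subtype.ext h2

instance (s : ℝ) : NormedAddCommGroup (B.V s) :=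
  NormedAddCommGroup.induced (B.V s) (lp (fun _ : ι => ℝ) 2) (B.toEll2 s) (B.toEll2_injective s)

instance (s : ℝ) : NormedSpace ℝ (B.V s) :=
  NormedSpace.induced ℝ (B.V s) (lp (fun _ : ι => ℝ) 2) (B.toEll2 s)

theorem hasSum_norm_sq (s : ℝ) (h : B.V s) :
    HasSum (fun i => (B.lam i ^ s * inner ℝ (B.φ i) (B.incl s h)) ^ 2) (‖h‖ ^ 2) := by
  have h1 := lp.hasSum_norm (p := 2) (by norm_num) (B.toEll2 s h)
  have h2 : ‖B.toEll2 s h‖ = ‖h‖ := rfl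
  rw [h2] at h1
  simpa [toEll2, coef, mul_pow] using h1

theorem exists_bound {s : ℝ} (hs : 0 ≤ s) : ∃ C : ℝ, ∀ h : B.V s, ‖B.incl s h‖ ≤ C * ‖h‖ := by
  obtain ⟨c, hc, hl⟩ := B.lower
  have hcs : 0 < c ^ s := Real.rpow_pos_of_pos hc s
  refine ⟨(c ^ s)⁻¹, fun h => ?_⟩
  have h1 : HasSum (fun i => (inner ℝ (B.φ i) (B.incl s h)) ^ 2) (‖B.incl s h‖ ^ 2) := by
    have := lp.hasSum_norm (p := 2) (by norm_num) (B.φ.repr (B.incl s h))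
    simpa [HilbertBasis.repr_apply_apply] using this
  have h2 : (c ^ s * ‖B.incl s h‖) ^ 2 ≤ ‖h‖ ^ 2 := by
    rw [mul_pow]
    refine hasSum_le (fun i => ?_) (h1.mul_left ((c ^ s) ^ 2)) (B.hasSum_norm_sq s h)
    rw [mul_pow]
    have : c ^ s ≤ B.lam i ^ s := Real.rpow_le_rpow hc.le (hl i) hs
    gcongr
  have h3 := abs_le_of_sq_le_sq h2 (norm_nonneg _)
  rw [inv_mul_eq_div, le_div_iff₀ hcs, mul_comm]
  exact (le_abs_self _).trans h3

/-- The inclusion `V_s → L²` as a continuous linear map, `s ≥ 0`. -/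
def inclL {s : ℝ} (hs : 0 ≤ s) : B.V s →L[ℝ] L2 m :=
  (B.incl s).mkContinuousOfExistsBound (B.exists_bound hs)

/-- The space `V_{-s}`, the dual of `V_s`. -/
abbrev VDual (s : ℝ) := B.V s →L[ℝ] ℝ

/-- The embedding `L² → V_{-s}`, `h ↦ (h, ·)`, of the Gelfand triple. -/
def gelfand {s : ℝ} (hs : 0 ≤ s) : L2 m →L[ℝ] B.VDual s :=
  (ContinuousLinearMap.compL ℝ (B.V s) (L2 m) ℝ).flip (B.inclL hs) ∘L innerSL ℝ

theorem gelfand_apply {s : ℝ} (hs : 0 ≤ s) (h : L2 m) (v : B.V s) :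
    B.gelfand hs h v = inner ℝ h (v : L2 m) := rfl

/-- `u(t) ∈ V_s` for small `t > 0` and `‖u(t)‖_{V_s} → 0` as `t → 0⁺`. -/
def TendstoZeroIn (s : ℝ) (u : ℝ → L2 m) : Prop :=
  ∃ U : ℝ → B.V s, (∀ᶠ t in 𝓝[>] (0 : ℝ), (U t : L2 m) = u t) ∧
    Tendsto (fun t => ‖U t‖) (𝓝[>] 0) (𝓝 0)

end EigenBasis

/-- The Mittag-Leffler function `E_{a,b}` on the real line. -/
def mittagLeffler (a b z : ℝ) : ℝ := ∑' n : ℕ, z ^ n / Real.Gamma (a * n + b)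

section Time

variable {H : Type*} [NormedAddCommGroup H] [NormedSpace ℝ H]

/-- The time derivative on `[0, T]`, one-sided at the end points. -/
def dt (T : ℝ) (u : ℝ → H) : ℝ → H := derivWithin u (Icc 0 T)

/-- `g` is the weak derivative of `f` on `(0, T)`. -/
def IsWeakDeriv (T : ℝ) (f g : ℝ → H) : Prop :=
  ∀ ψ : ℝ → ℝ, ContDiff ℝ ∞ ψ → HasCompactSupport ψ → tsupport ψ ⊆ Ioo 0 T →
    ∫ t in Ioo 0 T, deriv ψ t • f t = - ∫ t in Ioo 0 T, ψ t • g t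

/-- `f ∈ W^{1,q}((0, T); H)` with weak derivative `g`. -/
structure IsW1 (q : ℝ≥0∞) (T : ℝ) (f g : ℝ → H) : Prop where
  memLp : MemLp f q (volume.restrict (Ioo 0 T))
  memLp_deriv : MemLp g q (volume.restrict (Ioo 0 T))
  weak : IsWeakDeriv T f g

/-- The norm of `L^q((0, T); H)`. -/
def lqNorm (q : ℝ≥0∞) (T : ℝ) (g : ℝ → H) : ℝ :=
  (eLpNorm g q (volume.restrict (Ioo 0 T))).toReal

/-- `Γ(2-α)⁻¹ ∫₀ᵗ (t-s)^{1-α} (u(s) - u(0) - s u'(0)) ds`. -/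
def caputoPrimitive (α T : ℝ) (u : ℝ → H) (t : ℝ) : H :=
  (Real.Gamma (2 - α))⁻¹ • ∫ s in (0 : ℝ)..t, (t - s) ^ (1 - α) • (u s - u 0 - s • dt T u 0)

end Time

namespace EigenBasis

variable {E : DirichletForm m} {ι : Type*} (B : EigenBasis E ι) {α : ℝ}

theorem gamma_nonneg (hα : 1 < α) : 0 ≤ 1 / α := by positivity

/-- `w` is the fractional derivative `D_t^α u` on `(0, T)`, as a `V_{-1/α}`-valued function: the
second derivative, taken in `V_{-1/α}`, of `caputoPrimitive`. -/
def HasCaputoDeriv (hα : 1 < α) (T : ℝ) (u : ℝ → L2 m) (w : ℝ → B.VDual (1 / α)) : Prop :=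
  ∃ G' : ℝ → B.VDual (1 / α), ∀ t ∈ Ioo 0 T,
    HasDerivAt (fun r => B.gelfand (gamma_nonneg hα) (caputoPrimitive α T u r)) (G' t) t ∧
    HasDerivAt G' (w t) t

/-- Weak solution on `(0, T)` of `D_t^α u + A u = f`, `u(0) = u₀`, `∂_t u(0) = u₁`. -/
structure IsWeakSolution (hα : 1 < α) (T : ℝ) (f : ℝ → L2 m) (u₀ u₁ : L2 m) (u : ℝ → L2 m) :
    Prop where
  continuous_V : ∃ U : ℝ → B.V (1 / α), ContinuousOn U (Icc 0 T) ∧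
    ∀ t ∈ Icc 0 T, (U t : L2 m) = u t
  contDiff_L2 : ContDiffOn ℝ 1 u (Icc 0 T)
  init : u 0 = u₀
  init_deriv : dt T u 0 = u₁
  init_lim : ∃ σ : ℝ, 0 ≤ σ ∧ σ < 1 / α ∧ B.TendstoZeroIn σ (fun t => u t - u₀)
  init_deriv_lim : ∃ (β : ℝ) (hβ : 0 < β), β ≤ 1 - 1 / α ∧
    Tendsto (fun t => ‖B.gelfand hβ.le (dt T u t - u₁)‖) (𝓝[>] 0) (𝓝 0)
  /-- `D_t^α u` is in `C([0, T]; V_{-1/α})` and the variational identity holds. -/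
  equation : ∃ w : ℝ → B.VDual (1 / α), B.HasCaputoDeriv hα T u w ∧ ContinuousOn w (Icc 0 T) ∧
    ∀ ψ : B.V (1 / α), ∀ᵐ t ∂(volume.restrict (Ioo 0 T)),
      ∃ (hu : u t ∈ E.dom) (hψ : (ψ : L2 m) ∈ E.dom),
        w t ψ + E.form ⟨u t, hu⟩ ⟨(ψ : L2 m), hψ⟩ = inner ℝ (f t) (ψ : L2 m)

/-- Strong solution: a weak solution with `D_t^α u ∈ L¹((0, T); L²)` and `u ∈ L¹((0, T); D(A))`. -/
structure IsStrongSolution (hα : 1 < α) (T : ℝ) (f : ℝ → L2 m) (u₀ u₁ : L2 m) (u : ℝ → L2 m) :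
    Prop where
  weak : B.IsWeakSolution hα T f u₀ u₁ u
  caputo_L1 : ∃ w : ℝ → B.VDual (1 / α), B.HasCaputoDeriv hα T u w ∧
    ∃ d : ℝ → L2 m, IntegrableOn d (Ioo 0 T) ∧
      ∀ᵐ t ∂(volume.restrict (Ioo 0 T)), B.gelfand (gamma_nonneg hα) (d t) = w t
  dom_L1 : ∃ U : ℝ → B.V 1, IntegrableOn U (Ioo 0 T) ∧
    ∀ᵐ t ∂(volume.restrict (Ioo 0 T)), (U t : L2 m) = u t

/-- `x` is the value at time `t` of the spectral solution formula
`∑ (u₀,φ_n) E_{α,1}(-λ_n t^α) φ_n + ∑ (u₁,φ_n) t E_{α,2}(-λ_n t^α) φ_n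
  + ∑ (∫₀ᵗ (f(τ),φ_n) (t-τ)^{α-1} E_{α,α}(-λ_n (t-τ)^α) dτ) φ_n`,
all three series converging in `L²`. -/
def IsSpectralValue (α : ℝ) (f : ℝ → L2 m) (u₀ u₁ : L2 m) (t : ℝ) (x : L2 m) : Prop :=
  ∃ x₁ x₂ x₃ : L2 m, x = x₁ + x₂ + x₃ ∧
    HasSum (fun i => (inner ℝ u₀ (B.φ i) * mittagLeffler α 1 (-B.lam i * t ^ α)) • B.φ i) x₁ ∧
    HasSum (fun i => (inner ℝ u₁ (B.φ i) * (t * mittagLeffler α 2 (-B.lam i * t ^ α))) • B.φ i)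
      x₂ ∧
    HasSum (fun i => (∫ τ in (0 : ℝ)..t, inner ℝ (f τ) (B.φ i) *
      ((t - τ) ^ (α - 1) * mittagLeffler α α (-B.lam i * (t - τ) ^ α))) • B.φ i) x₃

end EigenBasis

end FracWave

end

open FracWave

/-! The eigenbasis diagonalises everything, so (P) splits into scalar problems D_t^α y + λ y = F,
which Mittag-Leffler functions solve. What remains is an estimate uniform in λ that lets the
coordinates be summed, the link between the second derivative in V_{-γ} and a scalar integral
equation, and uniqueness.

Eigenbasis: with J the inclusion of the form domain in L², (A+1)⁻¹ = J J* is compact, symmetric and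
injective, so the spectral theorem applies; compactness leaves finitely many eigenvalues below 1,
hence a positive lower bound (`DirichletForm.exists_eigenBasis`).

Uniform estimate: the one hard analytic input is |E_{α,b}(-x)| ≤ C/(1+x) for x ≥ 0
(`exists_abs_mittagLeffler_le`). It comes from a contour integral of exp(s) s^{α-b}/(s^α+x) along a
ray whose angle θ lies between π/2 and π/α: exp decays along the ray, and s^α stays away from the
negative half-line, so |s^α+x| is comparable to |s|^α+x. Expanding in powers of x and applying
Hankel's formula for 1/Γ identifies the integral with the series. Consequently (t^α A)^θ
E_{α,b}(-t^α A), 0 ≤ θ ≤ 1, is bounded uniformly in t (`exists_abs_mlMult_le`).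

Equation: put k_b(t) = t^{b-1}/Γ(b). Convolution with k_a turns t^{b-1}E_{α,b}(-λt^α) into the same
kernel with b+a in place of b (`conv_rl_mlk`). With the recurrence for E_{α,b} this gives the
integrated equation k_{2-α} * (y - y(0) - t y'(0)) = k_2 * (F - λy) (`conv_rl_scalarSol_eq`), and
k_2 * w is the double primitive of w. Since f = f(0) + ∫f', an integration by parts raises the
forcing kernel from order α to α+1, where a full power of A is absorbed without singularity; the
initial data cost t^{1-α}, and Hölder's inequality gives t^{1/p}.

Uniqueness: a coordinate z of a difference of solutions satisfies k_{2-α} * z + λ k_2 * z = 0, and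
convolving with t^{α-2}E_{α,α-1}(-λt^α) leaves ∫₀ᵗ z = 0 (`eq_zero_of_conv_rl_add`).

Part (b): the velocity is shown to be a primitive of an explicit function with singularities
t^{ασ-2}, t^{αβ-α}, t^{α-2}, integrable under the assumptions on σ and β, plus the convolution of f'
with an integrable kernel (`EigenBasis.exists_solAcc`). -/

noncomputable section

namespace FracWave

/-! ### Rays in the complex plane and Hankel's formula for 1/Γ. -/

/-- The point at distance `r` from `a` in the direction `exp (θ i)`. -/
def ray (θ a r : ℝ) : ℂ := a + r * Complex.exp (θ * Complex.I)

theorem ray_re (θ a r : ℝ) : (ray θ a r).re = a + r * Real.cos θ := by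
  simp [ray, Complex.exp_ofReal_mul_I_re]

theorem ray_im (θ a r : ℝ) : (ray θ a r).im = r * Real.sin θ := by
  simp [ray, Complex.exp_ofReal_mul_I_im]

theorem ray_zero (θ a : ℝ) : ray θ a 0 = a := by simp [ray]

theorem norm_ray_le {θ a r : ℝ} (ha : 0 ≤ a) (hr : 0 ≤ r) : ‖ray θ a r‖ ≤ a + r := by
  refine (norm_add_le _ _).trans ?_
  simp [Complex.norm_exp_ofReal_mul_I, abs_of_nonneg ha, abs_of_nonneg hr]

theorem sub_le_norm_ray {θ a r : ℝ} (ha : 0 ≤ a) : r - a ≤ ‖ray θ a r‖ := by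
  have h := norm_sub_norm_le (r * Complex.exp (θ * Complex.I)) (-(a : ℂ))
  simp only [norm_mul, Complex.norm_exp_ofReal_mul_I, mul_one, norm_neg, Complex.norm_real,
    Real.norm_eq_abs, abs_of_nonneg ha, sub_neg_eq_add] at h
  rw [ray, add_comm]
  linarith [le_abs_self r]

/-- A bound independent of r: multiplication by exp(-iθ) makes the ray horizontal, at height -a sin
θ. -/
theorem mul_sin_le_norm_ray (θ a r : ℝ) : a * Real.sin θ ≤ ‖ray θ a r‖ := by
  have h : ‖ray θ a r‖ = ‖ray θ a r * Complex.exp ((-θ : ℝ) * Complex.I)‖ := by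
    rw [norm_mul, Complex.norm_exp_ofReal_mul_I, mul_one]
  rw [h]
  have h2 : (ray θ a r * Complex.exp ((-θ : ℝ) * Complex.I)).im = -(a * Real.sin θ) := by
    rw [Complex.mul_im, Complex.exp_ofReal_mul_I_im, Complex.exp_ofReal_mul_I_re, ray_re, ray_im,
      Real.sin_neg, Real.cos_neg]
    ring
  have := Complex.abs_im_le_norm (ray θ a r * Complex.exp ((-θ : ℝ) * Complex.I))
  rw [h2, abs_neg] at this
  exact (le_abs_self _).trans this

theorem ray_mem_slitPlane {θ a r : ℝ} (hs : 0 < Real.sin θ) (hr : 0 ≤ r)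
    (h : 0 < a ∨ 0 < r) : ray θ a r ∈ Complex.slitPlane := by
  rw [Complex.mem_slitPlane_iff]
  rcases hr.eq_or_lt with rfl | hr
  · left; rw [ray_re]; simpa using h
  · right; rw [ray_im]; positivity

theorem hasDerivAt_ray (θ a r : ℝ) :
    HasDerivAt (ray θ a) (Complex.exp (θ * Complex.I)) r := by
  have h : HasDerivAt (fun r : ℝ => (r : ℂ)) 1 r := Complex.ofRealCLM.hasDerivAt
  have h' := (h.mul_const (Complex.exp (θ * Complex.I))).const_add (a : ℂ)
  rw [one_mul] at h'
  exact h'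

theorem hasDerivAt_ray_apex (θ a r : ℝ) :
    HasDerivAt (fun a => ray θ a r) 1 a := by
  have h : HasDerivAt (fun r : ℝ => (r : ℂ)) 1 a := Complex.ofRealCLM.hasDerivAt
  exact h.add_const _

theorem continuous_ray (θ : ℝ) : Continuous fun p : ℝ × ℝ => ray θ p.1 p.2 := by
  unfold ray; fun_prop

/-- The imaginary part of the integral along a ray does not depend on its origin on the real
line. -/
theorem im_integral_ray_eq {θ a₀ a₁ : ℝ} (h₀ : 0 ≤ a₀) (h₀₁ : a₀ ≤ a₁)
    {G : ℂ → ℂ} {g : ℝ → ℝ}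
    (hd : ∀ a ∈ Icc a₀ a₁, ∀ r, 0 ≤ r → (0 < a ∨ 0 < r) → DifferentiableAt ℂ G (ray θ a r))
    (hg : IntegrableOn g (Ioi 0))
    (hb : ∀ a ∈ Icc a₀ a₁, ∀ r, 0 < r → ‖deriv G (ray θ a r)‖ ≤ g r)
    (hlim : ∀ a ∈ Icc a₀ a₁, Tendsto (fun r => G (ray θ a r)) atTop (𝓝 0))
    (hInt : ∀ a ∈ Icc a₀ a₁, IntegrableOn (fun r => G (ray θ a r)) (Ioi 0))
    (hreal : ∀ a ∈ Ioc a₀ a₁, (G a).im = 0) :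
    (∫ r in Ioi 0, G (ray θ a₀ r) * Complex.exp (θ * Complex.I)).im =
      (∫ r in Ioi 0, G (ray θ a₁ r) * Complex.exp (θ * Complex.I)).im := by
  set e := Complex.exp (θ * Complex.I) with he
  have he1 : ‖e‖ = 1 := Complex.norm_exp_ofReal_mul_I θ
  have hmeas : Measurable fun p : ℝ × ℝ => deriv G (ray θ p.1 p.2) * e :=
    ((measurable_deriv G).comp (continuous_ray θ).measurable).mul_const e
  have hI : Integrable (Function.uncurry fun a r => deriv G (ray θ a r) * e)
      ((volume.restrict (Ioc a₀ a₁)).prod (volume.restrict (Ioi 0))) := by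
    have hgi : Integrable (fun p : ℝ × ℝ => (1 : ℝ) * g p.2)
        ((volume.restrict (Ioc a₀ a₁)).prod (volume.restrict (Ioi 0))) :=
      Integrable.mul_prod (integrable_const (1 : ℝ)) hg
    refine hgi.mono' hmeas.aestronglyMeasurable ?_
    rw [Measure.prod_restrict]
    refine (ae_restrict_iff' (measurableSet_Ioc.prod measurableSet_Ioi)).2 (ae_of_all _ ?_)
    rintro ⟨a, r⟩ ⟨ha, hr⟩
    simpa [Function.uncurry, he1] using hb a ⟨ha.1.le, ha.2⟩ r hr
  -- Fubini for G' over the region between the two rays stands in for Cauchy's theorem. Integrating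
  -- in r first leaves -∫G over the real segment, which has no imaginary part; integrating in a
  -- first leaves the difference of the two ray integrals.
  have hswap := integral_integral_swap hI
  have h1 : ∀ a ∈ Ioc a₀ a₁, ∫ r in Ioi 0, deriv G (ray θ a r) * e = - G a := by
    intro a ha
    have haI : a ∈ Icc a₀ a₁ := ⟨ha.1.le, ha.2⟩
    have ha0 : 0 < a := h₀.trans_lt ha.1
    have hder : ∀ r ∈ Ici (0 : ℝ),
        HasDerivAt (fun r => G (ray θ a r)) (deriv G (ray θ a r) * e) r := fun r hr =>
      (hd a haI r hr (Or.inl ha0)).hasDerivAt.comp r (hasDerivAt_ray θ a r)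
    have hii : IntegrableOn (fun r => deriv G (ray θ a r) * e) (Ioi 0) := by
      refine hg.mono' ?_ ?_
      · exact (hmeas.comp (measurable_const.prodMk measurable_id)).aestronglyMeasurable
      · refine (ae_restrict_iff' measurableSet_Ioi).2 (ae_of_all _ fun r hr => ?_)
        simpa [he1] using hb a haI r hr
    rw [integral_Ioi_of_hasDerivAt_of_tendsto' hder hii (hlim a haI), ray_zero, zero_sub]
  have h2 : ∀ r ∈ Ioi (0 : ℝ), ∫ a in Ioc a₀ a₁, deriv G (ray θ a r) * e =
      G (ray θ a₁ r) * e - G (ray θ a₀ r) * e := by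
    intro r hr
    rw [← intervalIntegral.integral_of_le h₀₁]
    have hder : ∀ a ∈ uIcc a₀ a₁,
        HasDerivAt (fun a => G (ray θ a r) * e) (deriv G (ray θ a r) * e) a := by
      intro a ha
      rw [uIcc_of_le h₀₁] at ha
      have := (hd a ha r (le_of_lt hr) (Or.inr hr)).hasDerivAt.comp a (hasDerivAt_ray_apex θ a r)
      simpa using this.mul_const e
    refine intervalIntegral.integral_eq_sub_of_hasDerivAt hder ?_
    rw [intervalIntegrable_iff_integrableOn_Ioc_of_le h₀₁]
    refine (integrable_const (g r)).mono' ?_ ?_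
    · exact (hmeas.comp (measurable_id.prodMk measurable_const)).aestronglyMeasurable
    · refine (ae_restrict_iff' measurableSet_Ioc).2 (ae_of_all _ fun a ha => ?_)
      simpa [he1] using hb a ⟨ha.1.le, ha.2⟩ r hr
  rw [setIntegral_congr_fun measurableSet_Ioc h1, setIntegral_congr_fun measurableSet_Ioi h2,
    integral_sub ((hInt a₁ ⟨h₀₁, le_rfl⟩).mul_const e) ((hInt a₀ ⟨le_rfl, h₀₁⟩).mul_const e)]
    at hswap
  have h3 : (∫ a in Ioc a₀ a₁, - G a).im = 0 := by
    by_cases hGi : IntegrableOn (fun a : ℝ => - G a) (Ioc a₀ a₁)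
    · rw [← RCLike.im_eq_complex_im, ← integral_im hGi]
      refine (setIntegral_congr_fun (g := fun _ => (0 : ℝ)) measurableSet_Ioc fun a ha => ?_).trans
        (by simp)
      simp [hreal a ha]
    · rw [integral_undef hGi]; simp
  rw [hswap, Complex.sub_im] at h3
  linarith

/-- Half of the exponential rate absorbs the power. -/
theorem isBigO_rpow_mul_exp {R κ : ℝ} (hκ : 0 < κ) (c : ℝ) :
    (fun r => (R + r) ^ c * Real.exp (-κ * r)) =O[atTop] fun r => Real.exp (-(κ / 2) * r) := by
  have h1 : (fun r : ℝ => (R + r) ^ c) =O[atTop] fun r => Real.exp (κ / 2 * (R + r)) :=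
    (isLittleO_rpow_exp_pos_mul_atTop c (half_pos hκ)).isBigO.comp_tendsto
      (tendsto_atTop_add_const_left _ _ tendsto_id)
  have h2 := h1.mul (Asymptotics.isBigO_refl (fun r : ℝ => Real.exp (-κ * r)) atTop)
  refine h2.trans ?_
  have h3 : (fun r => Real.exp (κ / 2 * (R + r)) * Real.exp (-κ * r)) =
      fun r => Real.exp (κ / 2 * R) * Real.exp (-(κ / 2) * r) := by
    ext r; rw [← Real.exp_add, ← Real.exp_add]; ring_nf
  rw [h3]
  exact Asymptotics.isBigO_const_mul_self _ _ _

theorem integrableOn_rpow_mul_exp {R κ : ℝ} (hR : 0 < R) (hκ : 0 < κ) (c : ℝ) :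
    IntegrableOn (fun r => (R + r) ^ c * Real.exp (-κ * r)) (Ioi 0) := by
  refine integrable_of_isBigO_exp_neg (half_pos hκ) ?_ (isBigO_rpow_mul_exp hκ c)
  refine ContinuousOn.mul (ContinuousOn.rpow_const (by fun_prop) fun r hr => Or.inl ?_)
    (by fun_prop)
  have : (0 : ℝ) ≤ r := hr
  positivity

theorem tendsto_rpow_mul_exp {R κ : ℝ} (hκ : 0 < κ) (c : ℝ) :
    Tendsto (fun r => (R + r) ^ c * Real.exp (-κ * r)) atTop (𝓝 0) := by
  refine (isBigO_rpow_mul_exp hκ c).trans_tendsto ?_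
  refine Real.tendsto_exp_atBot.comp ?_
  exact tendsto_id.const_mul_atTop_of_neg (by linarith)

/-- One bound for both signs of c: the power is largest at M when c ≥ 0 and at m when c ≤ 0. -/
theorem rpow_le_add_of_mem_Icc {m M x : ℝ} (hm : 0 < m) (h1 : m ≤ x) (h2 : x ≤ M) (c : ℝ) :
    x ^ c ≤ m ^ c + M ^ c := by
  rcases le_total 0 c with hc | hc
  · have := Real.rpow_le_rpow (hm.le.trans h1) h2 hc
    have := Real.rpow_nonneg hm.le c
    linarith
  · have := Real.rpow_le_rpow_of_nonpos hm h1 hc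
    have := Real.rpow_nonneg (hm.le.trans (h1.trans h2)) c
    linarith

theorem norm_exp_ray (θ a r : ℝ) :
    ‖Complex.exp (ray θ a r)‖ = Real.exp a * Real.exp (-(-Real.cos θ) * r) := by
  rw [Complex.norm_exp, ray_re, ← Real.exp_add]; congr 1; ring

/-- Both sides are analytic on Re w > 0 and agree for positive real w, where this is Euler's
integral; the identity theorem does the rest. -/
theorem integral_rpow_mul_cexp {c : ℝ} (hc : 0 < c) {w : ℂ} (hw : 0 < w.re) :
    ∫ r : ℝ in Ioi 0, ((r ^ (c - 1) : ℝ) : ℂ) * Complex.exp (-(w * r)) =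
      w ^ (-c : ℂ) * Real.Gamma c := by
  set U : Set ℂ := {w | 0 < w.re}
  have hUo : IsOpen U := isOpen_lt continuous_const Complex.continuous_re
  set F : ℂ → ℂ := fun w => ∫ r : ℝ in Ioi 0, ((r ^ (c - 1) : ℝ) : ℂ) * Complex.exp (-(w * r))
  have hInt : ∀ (κ p : ℝ), 0 < κ → 0 < p →
      IntegrableOn (fun r : ℝ => r ^ (p - 1) * Real.exp (-(κ * r))) (Ioi 0) := by
    intro κ p hκ hp
    have := integrableOn_rpow_mul_exp_neg_mul_rpow (s := p - 1) (p := 1) (b := κ)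
      (by linarith) one_pos hκ
    simpa using this
  have hdiff : DifferentiableOn ℂ F U := by
    intro w₀ hw₀
    have hw₀' : 0 < w₀.re := hw₀
    have hball : Metric.ball w₀ (w₀.re / 2) ∈ 𝓝 w₀ := Metric.ball_mem_nhds _ (half_pos hw₀')
    have hre : ∀ w ∈ Metric.ball w₀ (w₀.re / 2), w₀.re / 2 ≤ w.re := by
      intro w hw
      have h1 := Complex.abs_re_le_norm (w - w₀)
      rw [Metric.mem_ball, dist_eq_norm] at hw
      rw [Complex.sub_re] at h1
      linarith [(abs_le.1 h1).1]
    have hnorm : ∀ (w : ℂ) (r : ℝ), ‖Complex.exp (-(w * r))‖ = Real.exp (-(w.re * r)) := by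
      intro w r; rw [Complex.norm_exp]; simp
    have hmeas : ∀ w : ℂ, Measurable fun r : ℝ =>
        ((r ^ (c - 1) : ℝ) : ℂ) * Complex.exp (-(w * r)) := by
      intro w
      fun_prop
    -- On the ball of radius Re w₀ / 2 the real part stays above Re w₀ / 2; the derivative in w
    -- brings down a factor r, whence the exponent c + 1 in the bound.
    have key := hasDerivAt_integral_of_dominated_loc_of_deriv_le (𝕜 := ℂ)
      (μ := volume.restrict (Ioi (0 : ℝ)))
      (F := fun w r => ((r ^ (c - 1) : ℝ) : ℂ) * Complex.exp (-(w * r)))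
      (F' := fun w r => ((r ^ (c - 1) : ℝ) : ℂ) * (Complex.exp (-(w * r)) * (-(r : ℂ))))
      (x₀ := w₀) (bound := fun r => r ^ ((c + 1) - 1) * Real.exp (-(w₀.re / 2 * r)))
      hball ?_ ?_ ?_ ?_ ?_ ?_
    · exact key.2.differentiableAt.differentiableWithinAt
    · exact Eventually.of_forall fun w => (hmeas w).aestronglyMeasurable
    · refine (hInt w₀.re c hw₀' hc).mono' (hmeas w₀).aestronglyMeasurable ?_
      refine (ae_restrict_iff' measurableSet_Ioi).2 (ae_of_all _ fun r hr => ?_)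
      have hr0 : (0 : ℝ) < r := hr
      rw [norm_mul, hnorm, Complex.norm_real, Real.norm_of_nonneg (by positivity)]
    · have : Measurable fun r : ℝ =>
          ((r ^ (c - 1) : ℝ) : ℂ) * (Complex.exp (-(w₀ * r)) * (-(r : ℂ))) := by fun_prop
      exact this.aestronglyMeasurable
    · refine (ae_restrict_iff' measurableSet_Ioi).2 (ae_of_all _ fun r hr w hw => ?_)
      have hr0 : (0 : ℝ) < r := hr
      rw [norm_mul, norm_mul, hnorm, Complex.norm_real, Real.norm_of_nonneg (by positivity),
        norm_neg, Complex.norm_real, Real.norm_of_nonneg hr0.le]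
      have h1 : r ^ (c + 1 - 1) = r ^ (c - 1) * r := by
        rw [← Real.rpow_add_one hr0.ne']; ring_nf
      rw [h1, mul_assoc, mul_comm (Real.exp _) r]
      have h2 : Real.exp (-(w.re * r)) ≤ Real.exp (-(w₀.re / 2 * r)) := by
        apply Real.exp_le_exp.2
        have := hre w hw
        nlinarith
      gcongr
    · exact hInt _ _ (half_pos hw₀') (by linarith)
    · refine ae_of_all _ fun r w _ => ?_
      have h1 : HasDerivAt (fun w : ℂ => -(w * r)) (-(r : ℂ)) w := by
        have h2 := ((hasDerivAt_id' w).mul_const (r : ℂ)).neg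
        rw [one_mul] at h2
        exact h2
      exact h1.cexp.const_mul _
  have hG : DifferentiableOn ℂ (fun w : ℂ => w ^ (-c : ℂ) * Real.Gamma c) U := by
    intro w hw
    have hw' : w ∈ Complex.slitPlane := Or.inl hw
    exact ((DifferentiableAt.cpow_const differentiableAt_id hw').mul_const
      _).differentiableWithinAt
  have hconv : Convex ℝ U := convex_halfSpace_re_gt 0
  have hreal : ∀ x : ℝ, 0 < x → F x = (x : ℂ) ^ (-c : ℂ) * Real.Gamma c := by
    intro x hx
    have h1 := Real.integral_rpow_mul_exp_neg_mul_Ioi hc hx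
    have h2 : F x = ((∫ r : ℝ in Ioi 0, r ^ (c - 1) * Real.exp (-(x * r)) : ℝ) : ℂ) := by
      refine Eq.trans ?_ (integral_ofReal (𝕜 := ℂ))
      refine integral_congr_ae (ae_of_all _ fun r => ?_)
      simp
    rw [h2, h1, one_div, Real.inv_rpow hx.le, ← Real.rpow_neg hx.le]
    push_cast
    rw [Complex.ofReal_cpow hx.le]
    simp
  have h1U : (1 : ℂ) ∈ U := by simp [U]
  have hfreq : ∃ᶠ z in 𝓝[≠] (1 : ℂ), F z = z ^ (-c : ℂ) * Real.Gamma c := by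
    have ht : Tendsto (fun n : ℕ => ((1 + 1 / ((n : ℝ) + 1) : ℝ) : ℂ)) atTop (𝓝[≠] 1) := by
      refine tendsto_nhdsWithin_iff.2 ⟨?_, Eventually.of_forall fun n => ?_⟩
      · have h := (tendsto_one_div_add_atTop_nhds_zero_nat (𝕜 := ℝ)).const_add 1
        rw [add_zero] at h
        exact (Complex.continuous_ofReal.tendsto 1).comp h
      · have : (0 : ℝ) < 1 / ((n : ℝ) + 1) := by positivity
        intro h
        have h' : (1 + 1 / ((n : ℝ) + 1) : ℝ) = 1 := Complex.ofReal_injective (by simpa using h)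
        linarith
    refine ht.frequently (Frequently.of_forall fun n => ?_)
    exact hreal _ (by positivity)
  exact (hdiff.analyticOnNhd hUo).eqOn_of_preconnected_of_frequently_eq
    (hG.analyticOnNhd hUo) hconv.isPreconnected h1U hfreq hw

/-- The integrand `exp s * s ^ c` of Hankel's integral. -/
def hankel (c : ℝ) (s : ℂ) : ℂ := Complex.exp s * s ^ (c : ℂ)

theorem hasDerivAt_hankel (c : ℝ) {s : ℂ} (hs : s ∈ Complex.slitPlane) :
    HasDerivAt (hankel c) (hankel c s + c * hankel (c - 1) s) s := by
  have h := (Complex.hasDerivAt_exp s).mul ((hasDerivAt_id' s).cpow_const (c := (c : ℂ)) hs)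
  refine HasDerivAt.congr_deriv (f := hankel c) h ?_
  rw [hankel, hankel]
  push_cast
  ring

theorem norm_hankel_ray (c θ a r : ℝ) : ‖hankel c (ray θ a r)‖ =
    Real.exp a * Real.exp (-(-Real.cos θ) * r) * ‖ray θ a r‖ ^ c := by
  rw [hankel, norm_mul, norm_exp_ray, Complex.norm_cpow_real]

theorem im_hankel_ofReal (c : ℝ) {a : ℝ} (ha : 0 ≤ a) : (hankel c a).im = 0 := by
  rw [hankel, ← Complex.ofReal_cpow ha, ← Complex.ofReal_exp, ← Complex.ofReal_mul,
    Complex.ofReal_im]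

theorem measurable_hankel_ray (c θ a : ℝ) : Measurable fun r => hankel c (ray θ a r) := by
  unfold hankel ray
  fun_prop

section

variable {θ : ℝ}

theorem norm_hankel_ray_le (hs : 0 < Real.sin θ) (c : ℝ) {a r : ℝ} (ha : 0 < a) (hr : 0 ≤ r) :
    ‖hankel c (ray θ a r)‖ ≤ Real.exp a * (a * Real.sin θ) ^ c *
        ((a + r) ^ (0 : ℝ) * Real.exp (-(-Real.cos θ) * r)) +
      Real.exp a * ((a + r) ^ c * Real.exp (-(-Real.cos θ) * r)) := by
  rw [norm_hankel_ray, Real.rpow_zero]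
  have := rpow_le_add_of_mem_Icc (mul_pos ha hs) (mul_sin_le_norm_ray θ a r)
    (norm_ray_le ha.le hr) c
  have h2 : 0 ≤ Real.exp a * Real.exp (-(-Real.cos θ) * r) := by positivity
  have := mul_le_mul_of_nonneg_left this h2
  linarith

theorem integrableOn_hankel_ray (hs : 0 < Real.sin θ) (hc : Real.cos θ < 0) (c : ℝ) {a : ℝ} (ha : 0 < a) :
    IntegrableOn (fun r => hankel c (ray θ a r)) (Ioi 0) := by
  have hκ : 0 < -Real.cos θ := by linarith
  refine Integrable.mono' (((integrableOn_rpow_mul_exp ha hκ 0).const_mul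
    (Real.exp a * (a * Real.sin θ) ^ c)).add
    ((integrableOn_rpow_mul_exp ha hκ c).const_mul (Real.exp a)))
    (measurable_hankel_ray c θ a).aestronglyMeasurable ?_
  exact (ae_restrict_iff' measurableSet_Ioi).2 (ae_of_all _ fun r hr =>
    norm_hankel_ray_le hs c ha (le_of_lt hr))

theorem tendsto_hankel_ray (hs : 0 < Real.sin θ) (hc : Real.cos θ < 0) (c : ℝ) {a : ℝ} (ha : 0 < a) :
    Tendsto (fun r => hankel c (ray θ a r)) atTop (𝓝 0) := by
  have hκ : 0 < -Real.cos θ := by linarith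
  have h := ((tendsto_rpow_mul_exp (R := a) hκ 0).const_mul
    (Real.exp a * (a * Real.sin θ) ^ c)).add
    ((tendsto_rpow_mul_exp (R := a) hκ c).const_mul (Real.exp a))
  simp only [mul_zero, add_zero] at h
  refine squeeze_zero_norm' ?_ h
  filter_upwards [eventually_ge_atTop 0] with r hr using norm_hankel_ray_le hs c ha hr

/-- Hankel's integral along the ray that leaves `a` in the direction `exp (θ i)`. -/
def hankelInt (θ c a : ℝ) : ℂ :=
  ∫ r in Ioi 0, hankel c (ray θ a r) * Complex.exp (θ * Complex.I)

/-- The derivative of exp(s) s^c along the ray integrates to minus its value at a, which is real.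
This is the counterpart of Γ(z) = (z-1) Γ(z-1), and it raises z by one in Hankel's formula. -/
theorem im_hankelInt_recurrence (hs : 0 < Real.sin θ) (hc : Real.cos θ < 0) (c : ℝ) {a : ℝ} (ha : 0 < a) :
    (hankelInt θ c a).im + c * (hankelInt θ (c - 1) a).im = 0 := by
  have hder : ∀ r ∈ Ici (0 : ℝ), HasDerivAt (fun r => hankel c (ray θ a r))
      ((hankel c (ray θ a r) + c * hankel (c - 1) (ray θ a r)) * Complex.exp (θ * Complex.I)) r :=
    fun r hr => (hasDerivAt_hankel c (ray_mem_slitPlane hs hr (Or.inl ha))).comp r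
      (hasDerivAt_ray θ a r)
  have hi1 := (integrableOn_hankel_ray hs hc c ha).mul_const (Complex.exp (θ * Complex.I))
  have hi2 := ((integrableOn_hankel_ray hs hc (c - 1) ha).mul_const
    (Complex.exp (θ * Complex.I))).const_mul (c : ℂ)
  have heq : (fun r => (hankel c (ray θ a r) + c * hankel (c - 1) (ray θ a r)) *
      Complex.exp (θ * Complex.I)) = fun r => hankel c (ray θ a r) * Complex.exp (θ * Complex.I) +
        c * (hankel (c - 1) (ray θ a r) * Complex.exp (θ * Complex.I)) := by
    ext r; ring
  have h := integral_Ioi_of_hasDerivAt_of_tendsto' hder (by rw [heq]; exact hi1.add hi2)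
    (tendsto_hankel_ray hs hc c ha)
  rw [heq, integral_add hi1 hi2, integral_const_mul, ray_zero, zero_sub] at h
  have h2 := congrArg Complex.im h
  rw [Complex.add_im, Complex.im_ofReal_mul, Complex.neg_im, im_hankel_ofReal c ha.le] at h2
  simpa [hankelInt] using h2

/-- The apex may reach the branch point because for c ≥ 1 both s^c and its derivative stay bounded
near 0. Smaller exponents are reached by the recurrence. -/
theorem im_hankelInt_eq_zero_apex (hs : 0 < Real.sin θ) (hc : Real.cos θ < 0) {c a : ℝ} (h1c : 1 ≤ c) (ha : 0 < a) :
    (hankelInt θ c a).im = (hankelInt θ c 0).im := by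
  have hκ : 0 < -Real.cos θ := by linarith
  have hbd : ∀ (p : ℝ), 0 ≤ p → ∀ a' ∈ Icc 0 a, ∀ r, 0 < r → ‖hankel p (ray θ a' r)‖ ≤
      Real.exp a * ((a + r) ^ p * Real.exp (-(-Real.cos θ) * r)) := by
    intro p hp a' ha' r hr
    rw [norm_hankel_ray]
    have h1 : ‖ray θ a' r‖ ^ p ≤ (a + r) ^ p :=
      Real.rpow_le_rpow (norm_nonneg _) ((norm_ray_le ha'.1 hr.le).trans (by linarith [ha'.2])) hp
    have h2 : Real.exp a' ≤ Real.exp a := Real.exp_le_exp.2 ha'.2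
    calc _ ≤ Real.exp a * Real.exp (-(-Real.cos θ) * r) * (a + r) ^ p := by gcongr
      _ = _ := by ring
  have hInt : ∀ p : ℝ, IntegrableOn (fun r => Real.exp a * ((a + r) ^ p *
      Real.exp (-(-Real.cos θ) * r))) (Ioi 0) := fun p =>
    (integrableOn_rpow_mul_exp ha hκ p).const_mul _
  refine (im_integral_ray_eq (G := hankel c) (g := fun r => Real.exp a * ((a + r) ^ c *
      Real.exp (-(-Real.cos θ) * r)) + c * (Real.exp a * ((a + r) ^ (c - 1) *
      Real.exp (-(-Real.cos θ) * r)))) le_rfl ha.le ?_ ?_ ?_ ?_ ?_ ?_).symm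
  · intro a' _ r hr h
    exact (hasDerivAt_hankel c (ray_mem_slitPlane hs hr h)).differentiableAt
  · exact (hInt c).add ((hInt (c - 1)).const_mul c)
  · intro a' ha' r hr
    rw [(hasDerivAt_hankel c (ray_mem_slitPlane hs hr.le (Or.inr hr))).deriv]
    refine (norm_add_le _ _).trans (add_le_add (hbd c (by linarith) a' ha' r hr) ?_)
    rw [norm_mul, Complex.norm_real, Real.norm_of_nonneg (by linarith)]
    exact mul_le_mul_of_nonneg_left (hbd (c - 1) (by linarith) a' ha' r hr) (by linarith)
  · intro a' ha'
    have h := (tendsto_rpow_mul_exp (R := a) hκ c).const_mul (Real.exp a)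
    rw [mul_zero] at h
    refine squeeze_zero_norm' ?_ h
    filter_upwards [eventually_gt_atTop 0] with r hr using hbd c (by linarith) a' ha' r hr
  · intro a' ha'
    refine Integrable.mono' (hInt c) (measurable_hankel_ray c θ a').aestronglyMeasurable ?_
    exact (ae_restrict_iff' measurableSet_Ioi).2 (ae_of_all _ fun r hr =>
      hbd c (by linarith) a' ha' r hr)
  · intro a' ha'
    exact im_hankel_ofReal c ha'.1.le

end

/-- From the origin the ray is s = r exp(iθ), so this is Euler's integral at w = -exp(iθ), whose
real part -cos θ is positive. The phases combine to exp(iπ(c+1)): θ drops out. -/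
theorem im_hankelInt_zero {θ : ℝ} (hθ0 : 0 < θ) (hθ : θ < Real.pi) (hc : Real.cos θ < 0)
    {c : ℝ} (h1c : -1 < c) :
    (hankelInt θ c 0).im = Real.sin (Real.pi * (c + 1)) * Real.Gamma (c + 1) := by
  set e := Complex.exp (θ * Complex.I) with he
  have hlog : ∀ r : ℝ, 0 < r → Complex.log (r * e) = Real.log r + θ * Complex.I := by
    intro r hr
    rw [Complex.log_ofReal_mul hr (Complex.exp_ne_zero _), Complex.log_exp] <;>
      simp <;> linarith
  have h1 : ∀ r ∈ Ioi (0 : ℝ), hankel c (ray θ 0 r) * e =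
      (Complex.exp (c * θ * Complex.I) * e) *
        (((r ^ (c + 1 - 1) : ℝ) : ℂ) * Complex.exp (-(-e * r))) := by
    intro r hr
    have hr0 : (0 : ℝ) < r := hr
    have hne : (r * e : ℂ) ≠ 0 :=
      mul_ne_zero (Complex.ofReal_ne_zero.2 hr0.ne') (Complex.exp_ne_zero _)
    have h2 : (r * e : ℂ) ^ (c : ℂ) = Complex.exp (c * θ * Complex.I) * ((r ^ c : ℝ) : ℂ) := by
      rw [Complex.cpow_def_of_ne_zero hne, hlog r hr0, Real.rpow_def_of_pos hr0,
        Complex.ofReal_exp, ← Complex.exp_add]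
      congr 1
      push_cast
      ring
    have h3 : ray θ 0 r = r * e := by simp [ray, he]
    rw [hankel, h3, h2, add_sub_cancel_right, neg_mul, neg_neg, mul_comm e (r : ℂ)]
    ring
  have hre : 0 < (-e).re := by
    rw [Complex.neg_re, he, Complex.exp_ofReal_mul_I_re]; linarith
  have hpow : (-e) ^ (-((c + 1 : ℝ) : ℂ)) =
      Complex.exp (-(c + 1) * (θ - Real.pi) * Complex.I) := by
    have h4 : -e = Complex.exp ((θ - Real.pi) * Complex.I) := by
      rw [sub_mul, Complex.exp_sub, Complex.exp_pi_mul_I, div_neg, div_one]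
    rw [Complex.cpow_def_of_ne_zero (neg_ne_zero.2 (Complex.exp_ne_zero _)), h4, Complex.log_exp]
    · congr 1; push_cast; ring
    · simp; linarith
    · simp; linarith
  rw [hankelInt, setIntegral_congr_fun measurableSet_Ioi h1, integral_const_mul,
    integral_rpow_mul_cexp (by linarith) hre, hpow, ← mul_assoc, he, ← Complex.exp_add,
    ← Complex.exp_add]
  have h5 : (c * θ * Complex.I + θ * Complex.I + -(c + 1) * (θ - Real.pi) * Complex.I : ℂ) =
      ((Real.pi * (c + 1) : ℝ) : ℂ) * Complex.I := by push_cast; ring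
  rw [h5, Complex.im_mul_ofReal, Complex.exp_ofReal_mul_I_im]

/-- Hankel's formula for the reciprocal Gamma function. -/
theorem im_hankelInt_eq {θ : ℝ} (hθ0 : 0 < θ) (hθ : θ < Real.pi) (hc : Real.cos θ < 0)
    {z a : ℝ} (hz : 0 < z) (ha : 0 < a) :
    (hankelInt θ (-z) a).im = Real.pi / Real.Gamma z := by
  have hs : 0 < Real.sin θ := Real.sin_pos_of_pos_of_lt_pi hθ0 hθ
  -- Non-integer z first. For z ≤ -1 the apex moves to 0 and the reflection formula turns sin(πz)
  -- Γ(1-z) into π/Γ(z); each induction step raises z by one. Being non-integer keeps Γ off its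
  -- poles and sin(πz) off zero.
  have key : ∀ n : ℕ, ∀ z : ℝ, z ≤ n - 1 → (∀ k : ℤ, z ≠ k) →
      (hankelInt θ (-z) a).im = Real.pi / Real.Gamma z := by
    intro n
    induction n with
    | zero =>
      intro z hz hk
      have hz1 : z ≤ -1 := by simpa using hz
      rw [im_hankelInt_eq_zero_apex hs hc (by linarith) ha, im_hankelInt_zero hθ0 hθ hc
        (by linarith)]
      have h1 := Real.Gamma_mul_Gamma_one_sub z
      have hΓ : Real.Gamma z ≠ 0 := Real.Gamma_ne_zero fun m h => hk (-m) (by push_cast; exact h)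
      have hsin : Real.sin (Real.pi * z) ≠ 0 := by
        intro h0
        obtain ⟨k, hk'⟩ := Real.sin_eq_zero_iff.1 h0
        have : (k : ℝ) = z := by
          have hpi := Real.pi_ne_zero
          apply mul_right_cancel₀ hpi
          linarith
        exact hk k this.symm
      have h2 : Real.sin (Real.pi * (-z + 1)) = Real.sin (Real.pi * z) := by
        rw [show Real.pi * (-z + 1) = Real.pi - Real.pi * z by ring, Real.sin_pi_sub]
      rw [h2, neg_add_eq_sub]
      rw [eq_div_iff hΓ, mul_assoc, mul_comm (Real.Gamma (1 - z)), h1, mul_div_cancel₀ _ hsin]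
    | succ n ih =>
      intro z hz hk
      have hz' : z - 1 ≤ n - 1 := by push_cast at hz; linarith
      have hk' : ∀ k : ℤ, z - 1 ≠ k := fun k h => hk (k + 1) (by push_cast; linarith)
      have h1 := ih (z - 1) hz' hk'
      have h2 := im_hankelInt_recurrence hs hc (-(z - 1)) ha
      have hz0 : z - 1 ≠ 0 := by simpa using hk' 0
      have h3 := Real.Gamma_add_one hz0
      rw [sub_add_cancel] at h3
      rw [show -(z - 1) - 1 = -z by ring, h1] at h2
      have hΓ : Real.Gamma (z - 1) ≠ 0 :=
        Real.Gamma_ne_zero fun m h => hk' (-m) (by push_cast; exact h)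
      rw [h3, eq_div_iff (mul_ne_zero hz0 hΓ)]
      field_simp at h2
      linarith
  by_cases hk : ∀ k : ℤ, z ≠ k
  · obtain ⟨n, hn⟩ := exists_nat_ge (z + 1)
    exact key n z (by linarith) hk
  push Not at hk
  obtain ⟨k, rfl⟩ := hk
  set z : ℝ := (k : ℝ)
  -- A positive integer z is approached from the right by non-integers, and both sides are
  -- continuous there.
  have hev : ∀ᶠ y in 𝓝[>] z, (hankelInt θ (-y) a).im = Real.pi / Real.Gamma y := by
    have : Ioo z (z + 1) ∈ 𝓝[>] z := Ioo_mem_nhdsGT (by linarith)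
    filter_upwards [this] with y hy
    obtain ⟨n, hn⟩ := exists_nat_ge (y + 1)
    refine key n y (by linarith) fun j hj => ?_
    rw [hj] at hy
    have h1 : k < j := Int.cast_lt.1 hy.1
    have h2 : (j : ℝ) < ((k + 1 : ℤ) : ℝ) := by push_cast; exact hy.2
    rw [Int.cast_lt] at h2
    omega
  have hright : Tendsto (fun y => Real.pi / Real.Gamma y) (𝓝[>] z) (𝓝 (Real.pi / Real.Gamma z)) := by
    have hΓ : ContinuousAt Real.Gamma z :=
      (Real.differentiableAt_Gamma fun m h => by
        have : (0 : ℝ) ≤ m := Nat.cast_nonneg m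
        linarith).continuousAt
    exact ((continuousAt_const.div hΓ (Real.Gamma_pos_of_pos hz).ne').tendsto).mono_left
      nhdsWithin_le_nhds
  have hleft : Tendsto (fun y => (hankelInt θ (-y) a).im) (𝓝[>] z) (𝓝 (hankelInt θ (-z) a).im) := by
    refine Tendsto.mono_left ?_ nhdsWithin_le_nhds
    refine (Complex.continuous_im.tendsto _).comp ?_
    have hκ : 0 < -Real.cos θ := by linarith
    -- Cutting at 1 makes μ^(-y) ≤ μ^(-(z+1)) for all y < z + 1, a majorant uniform in y.
    set μ := min (a * Real.sin θ) 1
    have hμ : 0 < μ := lt_min (mul_pos ha hs) one_pos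
    refine continuousAt_of_dominated (F := fun y r => hankel (-y) (ray θ a r) *
      Complex.exp (θ * Complex.I)) (bound := fun r => Real.exp a * μ ^ (-(z + 1)) *
        ((a + r) ^ (0 : ℝ) * Real.exp (-(-Real.cos θ) * r))) ?_ ?_ ?_ ?_
    · exact Eventually.of_forall fun y =>
        ((measurable_hankel_ray (-y) θ a).mul_const _).aestronglyMeasurable
    · have : Ioo 0 (z + 1) ∈ 𝓝 z := Ioo_mem_nhds hz (by linarith)
      filter_upwards [this] with y hy
      refine (ae_restrict_iff' measurableSet_Ioi).2 (ae_of_all _ fun r hr => ?_)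
      rw [norm_mul, Complex.norm_exp_ofReal_mul_I, mul_one, norm_hankel_ray, Real.rpow_zero,
        one_mul]
      have h1 : μ ≤ ‖ray θ a r‖ := (min_le_left _ _).trans (mul_sin_le_norm_ray θ a r)
      have h2 : ‖ray θ a r‖ ^ (-y) ≤ μ ^ (-y) :=
        Real.rpow_le_rpow_of_nonpos hμ h1 (by linarith [hy.1])
      have h3 : μ ^ (-y) ≤ μ ^ (-(z + 1)) :=
        Real.rpow_le_rpow_of_exponent_ge hμ (min_le_right _ _) (by linarith [hy.2])
      calc _ ≤ Real.exp a * Real.exp (-(-Real.cos θ) * r) * μ ^ (-(z + 1)) := by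
            gcongr; exact h2.trans h3
        _ = _ := by ring
    · exact (integrableOn_rpow_mul_exp ha hκ 0).const_mul _
    · refine (ae_restrict_iff' measurableSet_Ioi).2 (ae_of_all _ fun r hr => ?_)
      have hne : ray θ a r ≠ 0 :=
        Complex.slitPlane_ne_zero (ray_mem_slitPlane hs (le_of_lt hr) (Or.inl ha))
      unfold hankel
      have h1 : ContinuousAt (fun y : ℝ => ((-y : ℝ) : ℂ)) z := by fun_prop
      exact ((continuousAt_const.mul ((continuousAt_const_cpow hne).comp h1))).mul
        continuousAt_const
  refine tendsto_nhds_unique hleft (hright.congr' ?_)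
  filter_upwards [hev] with y hy using hy.symm

/-! ### Contour integral and decay of the Mittag-Leffler function on the negative half-line. -/

theorem arg_ray_mem {θ a r : ℝ} (hθ0 : 0 < θ) (hθ : θ < Real.pi) (hc : Real.cos θ < 0)
    (ha : 0 < a) (hr : 0 ≤ r) : (ray θ a r).arg ∈ Icc 0 θ := by
  have hs : 0 < Real.sin θ := Real.sin_pos_of_pos_of_lt_pi hθ0 hθ
  have h0 : 0 ≤ (ray θ a r).arg := by
    rw [Complex.arg_nonneg_iff, ray_im]; positivity
  refine ⟨h0, ?_⟩
  -- An argument beyond θ would give a + r cos θ < |s| cos θ. As cos θ < 0 and |s| ≥ r - a, this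
  -- forces a (1 + cos θ) < 0.
  by_contra! h
  have h1 : Real.cos (ray θ a r).arg < Real.cos θ :=
    Real.cos_lt_cos_of_nonneg_of_le_pi hθ0.le (Complex.arg_le_pi _) h
  have hne : ray θ a r ≠ 0 := Complex.slitPlane_ne_zero (ray_mem_slitPlane hs hr (Or.inl ha))
  rw [Complex.cos_arg hne, div_lt_iff₀ (norm_pos_iff.2 hne), ray_re] at h1
  have h2 := sub_le_norm_ray (θ := θ) (r := r) ha.le
  nlinarith [Real.neg_one_le_cos θ]

/-- The summands s^α and x cannot cancel: s^α has argument in [0, αθ], and rotation by the half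
angle -αθ/2 puts its direction within αθ/2 of the positive axis, while x acquires real part exactly
x cos(αθ/2). Real parts then add up. -/
theorem le_norm_cpow_add {α θ x : ℝ} (hα : 0 < α) (hαθ : α * θ ≤ Real.pi)
    {s : ℂ} (hs : s ≠ 0) (harg : s.arg ∈ Icc 0 θ) :
    Real.cos (α * θ / 2) * (‖s‖ ^ α + x) ≤ ‖s ^ (α : ℂ) + x‖ := by
  have hθ : 0 ≤ θ := harg.1.trans harg.2
  set η := α * θ / 2
  have h1 : ‖s ^ (α : ℂ) + x‖ =
      ‖(s ^ (α : ℂ) + x) * Complex.exp ((-η : ℝ) * Complex.I)‖ := by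
    rw [norm_mul, Complex.norm_exp_ofReal_mul_I, mul_one]
  rw [h1]
  refine le_trans ?_ (Complex.re_le_norm _)
  have h2 : s ^ (α : ℂ) = ((‖s‖ ^ α : ℝ) : ℂ) * Complex.exp ((α * s.arg : ℝ) * Complex.I) := by
    rw [Complex.cpow_def_of_ne_zero hs, Real.rpow_def_of_pos (norm_pos_iff.2 hs),
      Complex.ofReal_exp, ← Complex.exp_add]
    congr 1
    rw [Complex.log]
    push_cast
    ring
  have h3 : (s ^ (α : ℂ) + x) * Complex.exp ((-η : ℝ) * Complex.I) =
      ((‖s‖ ^ α : ℝ) : ℂ) * Complex.exp ((α * s.arg - η : ℝ) * Complex.I) +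
        (x : ℂ) * Complex.exp ((-η : ℝ) * Complex.I) := by
    rw [h2, add_mul, mul_assoc, ← Complex.exp_add]
    congr 3
    push_cast
    ring
  rw [h3, Complex.add_re, Complex.re_ofReal_mul, Complex.re_ofReal_mul,
    Complex.exp_ofReal_mul_I_re, Complex.exp_ofReal_mul_I_re, Real.cos_neg]
  have h4 : Real.cos η ≤ Real.cos (α * s.arg - η) := by
    rw [← Real.cos_abs (α * s.arg - η)]
    have h5 : 0 ≤ α * s.arg := mul_nonneg hα.le harg.1
    have h6 : α * s.arg ≤ α * θ := mul_le_mul_of_nonneg_left harg.2 hα.le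
    refine Real.cos_le_cos_of_nonneg_of_le_pi (abs_nonneg _) ?_ ?_
    · simp only [η]; linarith [Real.pi_pos]
    · rw [abs_le]; constructor <;> simp only [η] <;> linarith
  have h7 : 0 ≤ ‖s‖ ^ α := by positivity
  nlinarith

/-- The integrand of the contour integral of the Mittag-Leffler function. -/
def mlKernel (α b x : ℝ) (s : ℂ) : ℂ :=
  Complex.exp s * (s ^ ((α - b : ℝ) : ℂ) / (s ^ (α : ℂ) + x))

/-- An angle adapted to the exponent `α ∈ (1, 2)`. -/
structure IsWedgeAngle (α θ : ℝ) : Prop where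
  pos : 0 < θ
  lt_pi : θ < Real.pi
  cos_neg : Real.cos θ < 0
  mul_lt : α * θ < Real.pi

/-- The witness is the midpoint of π/2 and π/α, and α < 2 makes this interval non-empty. Beyond π/2
the exponential decays along the ray; below π/α the power s^α avoids the negative half-line, where
s^α + x could vanish. -/
theorem exists_isWedgeAngle {α : ℝ} (hα : 1 < α) (hα2 : α < 2) : ∃ θ, IsWedgeAngle α θ := by
  have hp := Real.pi_pos
  have h0 : 0 < α := by linarith
  have h1 : Real.pi / 2 < Real.pi / α := div_lt_div_of_pos_left hp h0 hα2
  have h2 : Real.pi / α < Real.pi := div_lt_self hp hα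
  refine ⟨(Real.pi / 2 + Real.pi / α) / 2, by linarith, by linarith, ?_, ?_⟩
  · exact Real.cos_neg_of_pi_div_two_lt_of_lt (by linarith) (by linarith)
  · have h3 : α * (Real.pi / α) = Real.pi := by field_simp
    nlinarith

variable {α θ : ℝ}

namespace IsWedgeAngle

theorem sin_pos (hθ : IsWedgeAngle α θ) : 0 < Real.sin θ :=
  Real.sin_pos_of_pos_of_lt_pi hθ.pos hθ.lt_pi

theorem cos_half_pos (hθ : IsWedgeAngle α θ) (hα : 0 < α) : 0 < Real.cos (α * θ / 2) :=
  Real.cos_pos_of_mem_Ioo ⟨by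
    have := mul_pos hα hθ.pos
    linarith [Real.pi_pos], by linarith [hθ.mul_lt]⟩

theorem le_norm (hθ : IsWedgeAngle α θ) (hα : 0 < α) {a r x : ℝ} (ha : 0 < a) (hr : 0 ≤ r) :
    Real.cos (α * θ / 2) * (‖ray θ a r‖ ^ α + x) ≤
      ‖ray θ a r ^ (α : ℂ) + x‖ :=
  le_norm_cpow_add hα hθ.mul_lt.le
    (Complex.slitPlane_ne_zero (ray_mem_slitPlane hθ.sin_pos hr (Or.inl ha)))
    (arg_ray_mem hθ.pos hθ.lt_pi hθ.cos_neg ha hr)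

theorem norm_ray_pos (hθ : IsWedgeAngle α θ) {a r : ℝ} (ha : 0 < a) : 0 < ‖ray θ a r‖ :=
  (mul_pos ha hθ.sin_pos).trans_le (mul_sin_le_norm_ray θ a r)

theorem cpow_add_ne_zero (hθ : IsWedgeAngle α θ) (hα : 0 < α) {a r x : ℝ} (ha : 0 < a)
    (hr : 0 ≤ r) (hx : 0 ≤ x) : ray θ a r ^ (α : ℂ) + x ≠ 0 := by
  rw [← norm_pos_iff]
  refine lt_of_lt_of_le ?_ (hθ.le_norm hα ha hr)
  have := Real.rpow_pos_of_pos (hθ.norm_ray_pos (r := r) ha) α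
  have := hθ.cos_half_pos hα
  positivity

/-- The denominator keeps x, the source of the decay in x. The variant `norm_mlKernel_le_hankel`
gives x up and provides bounds uniform in x, for integrability. -/
theorem norm_mlKernel_le (hθ : IsWedgeAngle α θ) (hα : 0 < α) {b a r x : ℝ}
    (ha : 0 < a) (hr : 0 ≤ r) (hx : 0 ≤ x) :
    ‖mlKernel α b x (ray θ a r)‖ ≤ (Real.cos (α * θ / 2))⁻¹ *
      (‖hankel (α - b) (ray θ a r)‖ / (‖ray θ a r‖ ^ α + x)) := by
  have h0 := hθ.cos_half_pos hα
  have h1 := hθ.le_norm hα (x := x) ha hr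
  have h2 := Real.rpow_pos_of_pos (hθ.norm_ray_pos (r := r) ha) α
  have h3 : ‖mlKernel α b x (ray θ a r)‖ =
      ‖hankel (α - b) (ray θ a r)‖ / ‖ray θ a r ^ (α : ℂ) + x‖ := by
    rw [mlKernel, hankel, ← norm_div, mul_div_assoc]
  rw [h3, ← div_eq_inv_mul, div_div, mul_comm (‖ray θ a r‖ ^ α + x)]
  gcongr

theorem norm_mlKernel_le_hankel (hθ : IsWedgeAngle α θ) (hα : 0 < α) {b a r x : ℝ}
    (ha : 0 < a) (hr : 0 ≤ r) (hx : 0 ≤ x) :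
    ‖mlKernel α b x (ray θ a r)‖ ≤ (Real.cos (α * θ / 2))⁻¹ * ‖hankel (-b) (ray θ a r)‖ := by
  refine (hθ.norm_mlKernel_le hα ha hr hx).trans ?_
  have h0 := hθ.cos_half_pos hα
  have hp := hθ.norm_ray_pos (r := r) ha
  have h2 := Real.rpow_pos_of_pos hp α
  gcongr
  rw [div_le_iff₀ (by positivity), norm_hankel_ray, norm_hankel_ray, sub_eq_add_neg,
    Real.rpow_add hp, mul_comm (‖ray θ a r‖ ^ α), ← mul_assoc]
  gcongr
  linarith

theorem hasDerivAt_mlKernel (hθ : IsWedgeAngle α θ) (hα : 0 < α) (b : ℝ) {a r x : ℝ}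
    (ha : 0 < a) (hr : 0 ≤ r) (hx : 0 ≤ x) :
    HasDerivAt (mlKernel α b x) (mlKernel α b x (ray θ a r) +
      ((α - b : ℝ) * mlKernel α (b + 1) x (ray θ a r) -
        α * (mlKernel α b x (ray θ a r) * (ray θ a r ^ ((α - 1 : ℝ) : ℂ) /
          (ray θ a r ^ (α : ℂ) + x))))) (ray θ a r) := by
  set s := ray θ a r with hsdef
  have hs : s ∈ Complex.slitPlane := ray_mem_slitPlane hθ.sin_pos hr (Or.inl ha)
  have hne : s ^ (α : ℂ) + x ≠ 0 := hθ.cpow_add_ne_zero hα ha hr hx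
  have h1 := (hasDerivAt_id' s).cpow_const (c := ((α - b : ℝ) : ℂ)) hs
  have h2 := ((hasDerivAt_id' s).cpow_const (c := (α : ℂ)) hs).add_const (x : ℂ)
  have h := (Complex.hasDerivAt_exp s).mul (h1.div h2 hne)
  refine HasDerivAt.congr_deriv (f := mlKernel α b x) h ?_
  have e1 : (((α - (b + 1) : ℝ) : ℂ)) = ((α - b : ℝ) : ℂ) - 1 := by push_cast; ring
  have e2 : (((α - 1 : ℝ) : ℂ)) = (α : ℂ) - 1 := by push_cast; ring
  simp only [mlKernel, e1, e2, Pi.div_apply]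
  field_simp

/-- Differentiating the denominator contributes s^(α-1)/(s^α+x), which is of size 1/|s|; so both
terms from the fraction behave like the kernel with b + 1. -/
theorem norm_deriv_mlKernel_le (hθ : IsWedgeAngle α θ) (hα : 0 < α) (b : ℝ) {a r x : ℝ}
    (ha : 0 < a) (hr : 0 ≤ r) (hx : 0 ≤ x) :
    ‖deriv (mlKernel α b x) (ray θ a r)‖ ≤
      (Real.cos (α * θ / 2))⁻¹ * ‖hankel (-b) (ray θ a r)‖ +
        (|α - b| * ((Real.cos (α * θ / 2))⁻¹ * ‖hankel (-(b + 1)) (ray θ a r)‖) +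
          α * ((Real.cos (α * θ / 2))⁻¹ ^ 2 * ‖hankel (-(b + 1)) (ray θ a r)‖)) := by
  rw [(hθ.hasDerivAt_mlKernel hα b ha hr hx).deriv]
  refine (norm_add_le _ _).trans (add_le_add (hθ.norm_mlKernel_le_hankel hα ha hr hx) ?_)
  refine (norm_sub_le _ _).trans (add_le_add ?_ ?_)
  · rw [norm_mul, Complex.norm_real, Real.norm_eq_abs]
    exact mul_le_mul_of_nonneg_left (hθ.norm_mlKernel_le_hankel hα ha hr hx) (abs_nonneg _)
  · rw [norm_mul, Complex.norm_real, Real.norm_of_nonneg hα.le]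
    refine mul_le_mul_of_nonneg_left ?_ hα.le
    have h0 := hθ.cos_half_pos hα
    have hp := hθ.norm_ray_pos (r := r) ha
    have h2 := Real.rpow_pos_of_pos hp α
    have h3 : ‖ray θ a r ^ ((α - 1 : ℝ) : ℂ) / (ray θ a r ^ (α : ℂ) + x)‖ ≤
        (Real.cos (α * θ / 2))⁻¹ * ‖ray θ a r‖ ^ (-1 : ℝ) := by
      rw [norm_div, Complex.norm_cpow_real, div_le_iff₀
        (norm_pos_iff.2 (hθ.cpow_add_ne_zero hα ha hr hx))]
      have h4 := hθ.le_norm hα (x := x) ha hr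
      have h5 : Real.cos (α * θ / 2) * ‖ray θ a r‖ ^ α ≤ ‖ray θ a r ^ (α : ℂ) + x‖ := by
        refine le_trans ?_ h4
        gcongr
        linarith
      calc ‖ray θ a r‖ ^ (α - 1) = (Real.cos (α * θ / 2))⁻¹ * ‖ray θ a r‖ ^ (-1 : ℝ) *
            (Real.cos (α * θ / 2) * ‖ray θ a r‖ ^ α) := by
            rw [sub_eq_add_neg, Real.rpow_add hp]; field_simp
        _ ≤ _ := by gcongr
    rw [norm_mul]
    have h6 := hθ.norm_mlKernel_le_hankel hα (b := b) ha hr hx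
    calc _ ≤ ((Real.cos (α * θ / 2))⁻¹ * ‖hankel (-b) (ray θ a r)‖) *
          ((Real.cos (α * θ / 2))⁻¹ * ‖ray θ a r‖ ^ (-1 : ℝ)) := by gcongr
      _ = _ := by
        rw [norm_hankel_ray, norm_hankel_ray, neg_add, Real.rpow_add hp]; ring

theorem norm_hankel_neg_le (hθ : IsWedgeAngle α θ) {b a R r : ℝ} (hb : 0 ≤ b) (ha : 1 ≤ a)
    (haR : a ≤ R) : ‖hankel (-b) (ray θ a r)‖ ≤
      Real.exp R * Real.sin θ ^ (-b) * Real.exp (-(-Real.cos θ) * r) := by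
  rw [norm_hankel_ray]
  have h1 : Real.sin θ ≤ ‖ray θ a r‖ := by
    have := mul_sin_le_norm_ray θ a r
    nlinarith [hθ.sin_pos]
  have h2 : ‖ray θ a r‖ ^ (-b) ≤ Real.sin θ ^ (-b) :=
    Real.rpow_le_rpow_of_nonpos hθ.sin_pos h1 (by linarith)
  have h3 : Real.exp a ≤ Real.exp R := Real.exp_le_exp.2 haR
  have := hθ.sin_pos
  calc _ ≤ Real.exp R * Real.exp (-(-Real.cos θ) * r) * Real.sin θ ^ (-b) := by gcongr
    _ = _ := by ring

theorem integrableOn_exp (hθ : IsWedgeAngle α θ) :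
    IntegrableOn (fun r => Real.exp (-(-Real.cos θ) * r)) (Ioi 0) :=
  exp_neg_integrableOn_Ioi 0 (by linarith [hθ.cos_neg])

theorem tendsto_exp (hθ : IsWedgeAngle α θ) :
    Tendsto (fun r => Real.exp (-(-Real.cos θ) * r)) atTop (𝓝 0) :=
  Real.tendsto_exp_atBot.comp (tendsto_id.const_mul_atTop_of_neg (by linarith [hθ.cos_neg]))

theorem measurable_mlKernel_ray (α b x θ a : ℝ) :
    Measurable fun r => mlKernel α b x (ray θ a r) := by
  unfold mlKernel ray
  fun_prop

/-- The decay estimate wants the apex fixed at 1, but the expansion in powers of x converges only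
where |s|^α > x; moving the apex to a large R reconciles the two. -/
theorem im_integral_mlKernel_eq (hθ : IsWedgeAngle α θ) (hα : 0 < α) {b x R : ℝ} (hb : 0 ≤ b)
    (hx : 0 ≤ x) (hR : 1 ≤ R) :
    (∫ r in Ioi 0, mlKernel α b x (ray θ 1 r) * Complex.exp (θ * Complex.I)).im =
      (∫ r in Ioi 0, mlKernel α b x (ray θ R r) * Complex.exp (θ * Complex.I)).im := by
  have h0 := hθ.cos_half_pos hα
  have hbd : ∀ (p : ℝ), 0 ≤ p → ∀ a ∈ Icc 1 R, ∀ r, 0 < r → ‖mlKernel α p x (ray θ a r)‖ ≤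
      (Real.cos (α * θ / 2))⁻¹ * (Real.exp R * Real.sin θ ^ (-p) *
        Real.exp (-(-Real.cos θ) * r)) := by
    intro p hp a ha r hr
    refine (hθ.norm_mlKernel_le_hankel hα (by linarith [ha.1]) hr.le hx).trans ?_
    have := hθ.norm_hankel_neg_le (r := r) hp ha.1 ha.2
    gcongr
  have hInt : ∀ p : ℝ, IntegrableOn (fun r => Real.exp R * Real.sin θ ^ (-p) *
      Real.exp (-(-Real.cos θ) * r)) (Ioi 0) := fun p => hθ.integrableOn_exp.const_mul _
  refine im_integral_ray_eq (g := fun r => (Real.cos (α * θ / 2))⁻¹ * (Real.exp R *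
        Real.sin θ ^ (-b) * Real.exp (-(-Real.cos θ) * r)) +
        (|α - b| * ((Real.cos (α * θ / 2))⁻¹ * (Real.exp R *
        Real.sin θ ^ (-(b + 1)) * Real.exp (-(-Real.cos θ) * r))) +
          α * ((Real.cos (α * θ / 2))⁻¹ ^ 2 * (Real.exp R *
        Real.sin θ ^ (-(b + 1)) * Real.exp (-(-Real.cos θ) * r)))))
    zero_le_one hR ?_ ?_ ?_ ?_ ?_ ?_
  · intro a ha r hr _
    exact (hθ.hasDerivAt_mlKernel hα b (by linarith [ha.1]) hr hx).differentiableAt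
  · exact ((hInt b).const_mul _).add ((((hInt (b + 1)).const_mul _).const_mul _).add
      (((hInt (b + 1)).const_mul _).const_mul _))
  · intro a ha r hr
    refine (hθ.norm_deriv_mlKernel_le hα b (by linarith [ha.1]) hr.le hx).trans ?_
    have h1 := hθ.norm_hankel_neg_le (r := r) hb ha.1 ha.2
    have h2 := hθ.norm_hankel_neg_le (b := b + 1) (r := r) (by linarith) ha.1 ha.2
    gcongr
  · intro a ha
    have h := (hθ.tendsto_exp.const_mul (Real.exp R * Real.sin θ ^ (-b))).const_mul
      (Real.cos (α * θ / 2))⁻¹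
    rw [mul_zero, mul_zero] at h
    refine squeeze_zero_norm' ?_ h
    filter_upwards [eventually_gt_atTop 0] with r hr using hbd b hb a ha r hr
  · intro a ha
    refine Integrable.mono' ((hInt b).const_mul (Real.cos (α * θ / 2))⁻¹)
      (measurable_mlKernel_ray α b x θ a).aestronglyMeasurable ?_
    exact (ae_restrict_iff' measurableSet_Ioi).2 (ae_of_all _ fun r hr => hbd b hb a ha r hr)
  · intro a ha
    have ha0 : 0 ≤ a := by linarith [ha.1]
    rw [mlKernel, ← Complex.ofReal_cpow ha0, ← Complex.ofReal_cpow ha0, ← Complex.ofReal_exp,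
      ← Complex.ofReal_add, ← Complex.ofReal_div, ← Complex.ofReal_mul, Complex.ofReal_im]

/-- Once x (R sin θ)^(-α) < 1, the fraction is a geometric series ∑ (-x)^k s^(-(αk+b)) along the
whole ray, and Hankel's formula turns the k-th integral into π (-x)^k / Γ(αk+b). -/
theorem integral_mlKernel_eq_mittagLeffler (hθ : IsWedgeAngle α θ) (hα : 0 < α) {b x : ℝ}
    (hb : 0 < b) (hx : 0 ≤ x) :
    (∫ r in Ioi 0, mlKernel α b x (ray θ 1 r) * Complex.exp (θ * Complex.I)).im =
      Real.pi * mittagLeffler α b (-x) := by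
  have hs := hθ.sin_pos
  obtain ⟨R, hR1, hR⟩ : ∃ R : ℝ, 1 ≤ R ∧ x * (R * Real.sin θ) ^ (-α) < 1 := by
    have h1 : Tendsto (fun R : ℝ => x * (R * Real.sin θ) ^ (-α)) atTop (𝓝 (x * 0)) :=
      ((tendsto_rpow_neg_atTop hα).comp (tendsto_id.atTop_mul_const hs)).const_mul x
    rw [mul_zero] at h1
    obtain ⟨R, h⟩ := ((eventually_ge_atTop 1).and (h1.eventually (gt_mem_nhds one_pos))).exists
    exact ⟨R, h⟩
  rw [hθ.im_integral_mlKernel_eq hα hb.le hx hR1]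
  have hR0 : 0 < R := by linarith
  have hm : 0 < R * Real.sin θ := by positivity
  set e := Complex.exp (θ * Complex.I) with he
  have he1 : ‖e‖ = 1 := Complex.norm_exp_ofReal_mul_I θ
  have hz : ∀ k : ℕ, 0 < α * k + b := fun k => by positivity
  set F : ℕ → ℝ → ℂ := fun k r => ((-x) ^ k : ℝ) * (hankel (-(α * k + b)) (ray θ R r) * e) with hF
  have hFi : ∀ k, Integrable (F k) (volume.restrict (Ioi 0)) := fun k =>
    ((integrableOn_hankel_ray hs hθ.cos_neg _ hR0).mul_const e).const_mul _
  have hFb : ∀ k, ∀ r, ‖F k r‖ ≤ (Real.exp R * (R * Real.sin θ) ^ (-b)) *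
      (x * (R * Real.sin θ) ^ (-α)) ^ k * Real.exp (-(-Real.cos θ) * r) := by
    intro k r
    rw [hF]
    simp only [norm_mul, he1, mul_one, norm_hankel_ray, Complex.norm_real, Real.norm_eq_abs,
      abs_pow, abs_neg, abs_of_nonneg hx]
    have h1 : ‖ray θ R r‖ ^ (-(α * k + b)) ≤ (R * Real.sin θ) ^ (-(α * k + b)) :=
      Real.rpow_le_rpow_of_nonpos hm (mul_sin_le_norm_ray θ R r) (by linarith [hz k])
    have h2 : (R * Real.sin θ) ^ (-(α * k + b)) =
        ((R * Real.sin θ) ^ (-α)) ^ k * (R * Real.sin θ) ^ (-b) := by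
      rw [← Real.rpow_mul_natCast hm.le, ← Real.rpow_add hm]; ring_nf
    rw [h2] at h1
    calc _ ≤ x ^ k * (Real.exp R * Real.exp (-(-Real.cos θ) * r) *
          (((R * Real.sin θ) ^ (-α)) ^ k * (R * Real.sin θ) ^ (-b))) := by gcongr
      _ = _ := by rw [mul_pow]; ring
  have hsum : Summable fun k => ∫ r, ‖F k r‖ ∂(volume.restrict (Ioi 0)) := by
    have hgeo := ((summable_geometric_of_lt_one (by positivity) hR).mul_left
      (Real.exp R * (R * Real.sin θ) ^ (-b))).mul_right
      (∫ r in Ioi 0, Real.exp (-(-Real.cos θ) * r))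
    refine Summable.of_nonneg_of_le (fun k => integral_nonneg fun r => norm_nonneg _)
      (fun k => ?_) hgeo
    rw [← integral_const_mul]
    exact integral_mono (hFi k).norm (hθ.integrableOn_exp.const_mul _) (hFb k)
  have hS := hasSum_integral_of_summable_integral_norm hFi hsum
  have htsum : ∀ r ∈ Ioi (0 : ℝ), ∑' k, F k r = mlKernel α b x (ray θ R r) * e := by
    intro r hr
    set s := ray θ R r with hsdef
    have hs0 : s ≠ 0 :=
      Complex.slitPlane_ne_zero (ray_mem_slitPlane hs (le_of_lt hr) (Or.inl hR0))
    have hp : 0 < ‖s‖ := norm_pos_iff.2 hs0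
    have hq : ‖-(x : ℂ) * s ^ ((-α : ℝ) : ℂ)‖ < 1 := by
      rw [norm_mul, norm_neg, Complex.norm_real, Real.norm_of_nonneg hx, Complex.norm_cpow_real]
      refine lt_of_le_of_lt ?_ hR
      have := Real.rpow_le_rpow_of_nonpos hm (mul_sin_le_norm_ray θ R r) (neg_nonpos.2 hα.le)
      gcongr
    have hgeo := (hasSum_geometric_of_norm_lt_one hq).mul_left
      (Complex.exp s * s ^ ((-b : ℝ) : ℂ) * e)
    have hterm : (fun k => F k r) = fun k : ℕ => Complex.exp s * s ^ ((-b : ℝ) : ℂ) * e *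
        (-(x : ℂ) * s ^ ((-α : ℝ) : ℂ)) ^ k := by
      ext k
      simp only [hF, hankel, ← hsdef]
      have : s ^ ((-(α * k + b) : ℝ) : ℂ) = (s ^ ((-α : ℝ) : ℂ)) ^ k * s ^ ((-b : ℝ) : ℂ) := by
        rw [← Complex.cpow_mul_nat, ← Complex.cpow_add _ _ hs0]
        congr 1
        push_cast
        ring
      rw [this, mul_pow]
      push_cast
      ring
    rw [hterm, hgeo.tsum_eq, mlKernel]
    have hne : s ^ (α : ℂ) + x ≠ 0 := hθ.cpow_add_ne_zero hα hR0 (le_of_lt hr) hx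
    have hα0 : s ^ (α : ℂ) ≠ 0 := by
      rw [Complex.cpow_def_of_ne_zero hs0]; exact Complex.exp_ne_zero _
    have e1 : s ^ ((-α : ℝ) : ℂ) = (s ^ (α : ℂ))⁻¹ := by
      rw [Complex.ofReal_neg, Complex.cpow_neg]
    have e2 : s ^ ((α - b : ℝ) : ℂ) = s ^ (α : ℂ) * s ^ ((-b : ℝ) : ℂ) := by
      rw [← Complex.cpow_add _ _ hs0]; congr 1; push_cast; ring
    rw [e1, e2]
    have e3 : 1 - -(x : ℂ) * (s ^ (α : ℂ))⁻¹ = (s ^ (α : ℂ) + x) / s ^ (α : ℂ) := by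
      field_simp
      ring
    rw [e3, inv_div]
    ring
  rw [setIntegral_congr_fun measurableSet_Ioi htsum] at hS
  have hIm := Complex.imCLM.hasSum hS
  have hval : ∀ k, Complex.imCLM (∫ r in Ioi 0, F k r) =
      Real.pi * ((-x) ^ k / Real.Gamma (α * k + b)) := by
    intro k
    rw [hF]
    simp only
    rw [integral_const_mul, Complex.imCLM_apply, Complex.im_ofReal_mul]
    have := im_hankelInt_eq hθ.pos hθ.lt_pi hθ.cos_neg (hz k) hR0
    rw [hankelInt] at this
    rw [this]
    ring
  rw [mittagLeffler, ← tsum_mul_left, ← Complex.imCLM_apply, ← hIm.tsum_eq]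
  exact tsum_congr hval

end IsWedgeAngle

/-- The decay of the Mittag-Leffler function on the negative half-line. -/
theorem exists_abs_mittagLeffler_le (hα : 1 < α) (hα2 : α < 2) {b : ℝ} (hb : 0 < b) :
    ∃ C, 0 < C ∧ ∀ x, 0 ≤ x → |mittagLeffler α b (-x)| ≤ C / (1 + x) := by
  obtain ⟨θ, hθ⟩ := exists_isWedgeAngle hα hα2
  have hα0 : 0 < α := by linarith
  have h0 := hθ.cos_half_pos hα0
  have hs := hθ.sin_pos
  set μ := Real.sin θ ^ α
  have hμ : 0 < μ := Real.rpow_pos_of_pos hs α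
  have hμ1 : μ ≤ 1 := Real.rpow_le_one hs.le (Real.sin_le_one θ) hα0.le
  set K := ∫ r in Ioi 0, ‖hankel (α - b) (ray θ 1 r)‖
  have hK : 0 ≤ K := integral_nonneg fun r => norm_nonneg _
  refine ⟨Real.pi⁻¹ * ((Real.cos (α * θ / 2))⁻¹ * (μ⁻¹ * (K + 1))), by
    have := Real.pi_pos; positivity, fun x hx => ?_⟩
  have h1 := hθ.integral_mlKernel_eq_mittagLeffler hα0 hb hx
  have h2 : mittagLeffler α b (-x) = Real.pi⁻¹ *
      (∫ r in Ioi 0, mlKernel α b x (ray θ 1 r) * Complex.exp (θ * Complex.I)).im := by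
    rw [h1, inv_mul_cancel_left₀ Real.pi_ne_zero]
  rw [h2, abs_mul, abs_of_pos (inv_pos.2 Real.pi_pos), mul_div_assoc]
  refine mul_le_mul_of_nonneg_left ?_ (inv_pos.2 Real.pi_pos).le
  refine (Complex.abs_im_le_norm _).trans ?_
  -- On the ray from 1, |s| ≥ sin θ, hence |s|^α + x ≥ μ (1 + x) because μ ≤ 1. All dependence on x
  -- thus leaves the integral, and K is a fixed number.
  have h3 : ∀ r ∈ Ioi (0 : ℝ), ‖mlKernel α b x (ray θ 1 r) * Complex.exp (θ * Complex.I)‖ ≤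
      ((Real.cos (α * θ / 2))⁻¹ * (μ⁻¹ * (1 + x)⁻¹)) * ‖hankel (α - b) (ray θ 1 r)‖ := by
    intro r hr
    rw [norm_mul, Complex.norm_exp_ofReal_mul_I, mul_one]
    refine (hθ.norm_mlKernel_le hα0 one_pos (le_of_lt hr) hx).trans ?_
    rw [mul_assoc]
    gcongr
    rw [div_eq_inv_mul, ← mul_inv]
    have h4 : Real.sin θ ≤ ‖ray θ 1 r‖ := by simpa using mul_sin_le_norm_ray θ 1 r
    have h5 : μ ≤ ‖ray θ 1 r‖ ^ α := Real.rpow_le_rpow hs.le h4 hα0.le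
    gcongr
    nlinarith
  refine (norm_integral_le_of_norm_le ((integrableOn_hankel_ray hs hθ.cos_neg (α - b)
    one_pos).norm.const_mul _) ((ae_restrict_iff' measurableSet_Ioi).2 (ae_of_all _ h3))).trans ?_
  rw [integral_const_mul, div_eq_mul_inv]
  change _ * K ≤ _
  calc (Real.cos (α * θ / 2))⁻¹ * (μ⁻¹ * (1 + x)⁻¹) * K =
        (Real.cos (α * θ / 2))⁻¹ * (μ⁻¹ * K) * (1 + x)⁻¹ := by ring
    _ ≤ (Real.cos (α * θ / 2))⁻¹ * (μ⁻¹ * (K + 1)) * (1 + x)⁻¹ := by gcongr; linarith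

/-! ### The Mittag-Leffler series: convergence, continuity, recurrence. -/

section MittagLefflerSeries

variable {α b : ℝ}

/-- Since α > 1, αn + b ≥ n + 1 once (α-1) n ≥ 1. Monotonicity of Γ on [2,∞) then gives Γ(αn+b) ≥
n!, and the exponential series is a majorant. -/
theorem summable_mittagLeffler (hα : 1 < α) (hb : 0 < b) (z : ℝ) :
    Summable fun n : ℕ => z ^ n / Real.Gamma (α * n + b) := by
  refine (Real.summable_pow_div_factorial |z|).of_norm_bounded_eventually_nat ?_
  obtain ⟨N, hN⟩ := exists_nat_ge (1 / (α - 1))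
  filter_upwards [eventually_ge_atTop (max N 1)] with n hn
  have hα1 : 0 < α - 1 := by linarith
  have h1 : 1 / (α - 1) ≤ n := hN.trans (by exact_mod_cast (le_max_left _ _).trans hn)
  rw [div_le_iff₀ hα1] at h1
  have h2 : (1 : ℝ) ≤ n := by exact_mod_cast (le_max_right _ _).trans hn
  have h3 : (n : ℝ) + 1 ≤ α * n + b := by nlinarith
  have h4 : (n.factorial : ℝ) ≤ Real.Gamma (α * n + b) := by
    rw [← Real.Gamma_nat_eq_factorial]
    exact Real.Gamma_strictMonoOn_Ici.monotoneOn (by simp; linarith) (by simp; linarith) h3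
  have h5 : (0 : ℝ) < n.factorial := by positivity
  rw [norm_div, norm_pow, Real.norm_eq_abs, Real.norm_of_nonneg (h5.le.trans h4)]
  gcongr

theorem continuous_mittagLeffler (hα : 1 < α) (hb : 0 < b) : Continuous (mittagLeffler α b) := by
  rw [continuous_iff_continuousAt]
  intro z
  have hball : Metric.ball (0 : ℝ) (|z| + 1) ∈ 𝓝 z :=
    Metric.isOpen_ball.mem_nhds (by simp)
  refine ContinuousOn.continuousAt (s := Metric.ball (0 : ℝ) (|z| + 1)) ?_ hball
  refine continuousOn_tsum (fun n => by fun_prop) (summable_mittagLeffler hα hb (|z| + 1))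
    fun n x hx => ?_
  have h1 : 0 < Real.Gamma (α * n + b) := Real.Gamma_pos_of_pos (by positivity)
  rw [norm_div, norm_pow, Real.norm_of_nonneg h1.le]
  have h2 : ‖x‖ ≤ |z| + 1 := by simpa using (Metric.mem_ball.1 hx).le
  gcongr

theorem mittagLeffler_recurrence (hα : 1 < α) (hb : 0 < b) (z : ℝ) :
    mittagLeffler α b z = 1 / Real.Gamma b + z * mittagLeffler α (b + α) z := by
  rw [mittagLeffler, (summable_mittagLeffler hα hb z).tsum_eq_zero_add, mittagLeffler,
    ← tsum_mul_left]
  congr 1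
  · simp
  · refine tsum_congr fun n => ?_
    rw [pow_succ, show α * ((n + 1 : ℕ) : ℝ) + b = α * n + (b + α) by push_cast; ring]
    ring

theorem mittagLeffler_zero (hα : 1 < α) (hb : 0 < b) :
    mittagLeffler α b 0 = 1 / Real.Gamma b := by
  rw [mittagLeffler_recurrence hα hb, zero_mul, add_zero]

end MittagLefflerSeries

/-! ### Scalar convolutions on [0, t] and their associativity. -/

/-- The Riemann-Liouville kernel `t ^ (b - 1) / Γ(b)`. -/
def rl (b t : ℝ) : ℝ := t ^ (b - 1) / Real.Gamma b

/-- The kernel `t ^ (b - 1) E_{α,b}(-l t ^ α)`. -/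
def mlk (α b l t : ℝ) : ℝ := t ^ (b - 1) * mittagLeffler α b (-l * t ^ α)

/-- The convolution `∫₀ᵗ k(t - s) g(s) ds`. -/
def conv (k g : ℝ → ℝ) (t : ℝ) : ℝ := ∫ s in (0 : ℝ)..t, k (t - s) * g s

theorem conv_comm (k g : ℝ → ℝ) (t : ℝ) : conv k g t = conv g k t := by
  have h := intervalIntegral.integral_comp_sub_left (fun s => k (t - s) * g s) (a := 0) (b := t) t
  rw [sub_self, sub_zero] at h
  rw [conv, conv, ← h]
  refine intervalIntegral.integral_congr fun s _ => ?_
  simp only [sub_sub_cancel]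
  ring

theorem conv_zero (k g : ℝ → ℝ) : conv k g 0 = 0 := by simp [conv]

theorem conv_congr_right {k g h : ℝ → ℝ} {t : ℝ} (ht : 0 ≤ t) (H : ∀ s ∈ Ioc 0 t, g s = h s) :
    conv k g t = conv k h t := by
  rw [conv, conv, intervalIntegral.integral_of_le ht, intervalIntegral.integral_of_le ht]
  exact setIntegral_congr_fun measurableSet_Ioc fun s hs => by simp only [H s hs]

theorem conv_congr_left {k g h : ℝ → ℝ} {t : ℝ} (ht : 0 ≤ t) (H : ∀ s ∈ Ioc 0 t, k s = h s) :
    conv k g t = conv h g t := by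
  rw [conv_comm, conv_congr_right ht H, conv_comm]

theorem integrableOn_comp_sub {k : ℝ → ℝ} {t : ℝ} (hk : IntegrableOn k (Ioc 0 t)) {s : ℝ}
    (hs : s ∈ Icc 0 t) : IntegrableOn (fun r => k (s - r)) (Ioc 0 s) := by
  have h1 : IntervalIntegrable k volume 0 s :=
    (intervalIntegrable_iff_integrableOn_Ioc_of_le hs.1).2
      (hk.mono_set (Ioc_subset_Ioc_right hs.2))
  have h2 := (h1.comp_sub_left s).symm
  rw [sub_self, sub_zero] at h2
  exact (intervalIntegrable_iff_integrableOn_Ioc_of_le hs.1).1 h2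

theorem setIntegral_abs_comp_sub_le {k : ℝ → ℝ} {t : ℝ} (hk : IntegrableOn k (Ioc 0 t)) {s : ℝ}
    (hs : s ∈ Icc 0 t) : ∫ r in Ioc 0 s, |k (s - r)| ≤ ∫ r in Ioc 0 t, |k r| := by
  have h := intervalIntegral.integral_comp_sub_left (fun r => |k r|) (a := 0) (b := s) s
  rw [sub_self, sub_zero, intervalIntegral.integral_of_le hs.1,
    intervalIntegral.integral_of_le hs.1] at h
  rw [h]
  exact setIntegral_mono_set hk.norm (ae_of_all _ fun r => abs_nonneg _)
    (Ioc_subset_Ioc_right hs.2).eventuallyLE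

/-- Fubini on the triangle r < s, written as an indicator on the square so that both iterated
integrals have fixed limits. Integrability is verified in two settings: h bounded, for continuous
data, and k bounded, for an h that is merely integrable such as f'. -/
theorem conv_assoc_of_integrable {k g h : ℝ → ℝ} {t : ℝ} (ht : 0 ≤ t)
    (hI : Integrable (fun p : ℝ × ℝ => (Ioi p.2).indicator (fun s => k (t - s) * g (s - p.2)) p.1 *
      h p.2) ((volume.restrict (Ioc 0 t)).prod (volume.restrict (Ioc 0 t)))) :
    conv k (conv g h) t = conv (conv k g) h t := by
  have hswap := integral_integral_swap (f := fun s r =>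
    (Ioi r).indicator (fun s => k (t - s) * g (s - r)) s * h r) hI
  have h1 : conv k (conv g h) t = ∫ s in Ioc 0 t, ∫ r in Ioc 0 t,
      (Ioi r).indicator (fun s => k (t - s) * g (s - r)) s * h r := by
    rw [conv, intervalIntegral.integral_of_le ht]
    refine setIntegral_congr_fun measurableSet_Ioc fun s hs => ?_
    rw [conv, intervalIntegral.integral_of_le hs.1.le, ← integral_const_mul,
      integral_Ioc_eq_integral_Ioo]
    have hset : Ioo 0 s = Ioc 0 t ∩ Ioo 0 s :=
      (inter_eq_self_of_subset_right (Ioo_subset_Ioc_self.trans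
        (Ioc_subset_Ioc_right hs.2))).symm
    rw [hset, ← setIntegral_indicator measurableSet_Ioo]
    refine setIntegral_congr_fun measurableSet_Ioc fun r hr => ?_
    by_cases hrs : r < s
    · simp [indicator, hrs, hr.1, mul_assoc]
    · simp [indicator, hrs]
  have h2 : conv (conv k g) h t = ∫ r in Ioc 0 t, ∫ s in Ioc 0 t,
      (Ioi r).indicator (fun s => k (t - s) * g (s - r)) s * h r := by
    rw [conv, intervalIntegral.integral_of_le ht]
    refine setIntegral_congr_fun measurableSet_Ioc fun r hr => ?_
    rw [integral_mul_const]
    congr 1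
    have h3 := intervalIntegral.integral_comp_sub_right (fun σ => k (t - r - σ) * g σ)
      (a := r) (b := t) r
    rw [sub_self] at h3
    rw [conv, ← h3, setIntegral_indicator measurableSet_Ioi, intervalIntegral.integral_of_le hr.2]
    have h4 : Ioc 0 t ∩ Ioi r = Ioc r t := by
      ext s
      simp only [mem_inter_iff, mem_Ioc, mem_Ioi]
      exact ⟨fun h => ⟨h.2, h.1.2⟩, fun h => ⟨⟨hr.1.trans h.1, h.2⟩, h.1⟩⟩
    rw [h4]
    refine setIntegral_congr_fun measurableSet_Ioc fun s _ => ?_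
    simp only [sub_sub_sub_cancel_right]
  rw [h1, h2, hswap]

theorem aestronglyMeasurable_conv_kernel {k g h : ℝ → ℝ} {t : ℝ} (hk : Measurable k)
    (hg : Measurable g) (hh : AEStronglyMeasurable h (volume.restrict (Ioc 0 t))) :
    AEStronglyMeasurable (fun p : ℝ × ℝ => (Ioi p.2).indicator
      (fun s => k (t - s) * g (s - p.2)) p.1 * h p.2)
      ((volume.restrict (Ioc 0 t)).prod (volume.restrict (Ioc 0 t))) := by
  refine AEStronglyMeasurable.mul ?_ hh.comp_snd
  have h1 : (fun p : ℝ × ℝ => (Ioi p.2).indicator (fun s => k (t - s) * g (s - p.2)) p.1) =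
      {p : ℝ × ℝ | p.2 < p.1}.indicator (fun p => k (t - p.1) * g (p.1 - p.2)) := by
    ext p; simp [indicator]
  rw [h1]
  refine (Measurable.indicator ?_ (measurableSet_lt measurable_snd measurable_fst)
    ).aestronglyMeasurable
  fun_prop

/-- Associativity of the convolution when the last factor is bounded. -/
theorem conv_assoc_of_bounded {k g h : ℝ → ℝ} {t K : ℝ} (ht : 0 ≤ t) (hkm : Measurable k)
    (hgm : Measurable g) (hh : AEStronglyMeasurable h (volume.restrict (Ioc 0 t)))
    (hk : IntegrableOn k (Ioc 0 t)) (hg : IntegrableOn g (Ioc 0 t))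
    (hK : ∀ s ∈ Ioc 0 t, |h s| ≤ K) :
    conv k (conv g h) t = conv (conv k g) h t := by
  refine conv_assoc_of_integrable ht ?_
  have hm := aestronglyMeasurable_conv_kernel (t := t) hkm hgm hh
  have hbd : ∀ s ∈ Ioc 0 t, ∀ r ∈ Ioc 0 t,
      ‖(Ioi r).indicator (fun s => k (t - s) * g (s - r)) s * h r‖ ≤
        (Ioc 0 s).indicator (fun r => |k (t - s)| * K * |g (s - r)|) r := by
    intro s hs r hr
    have hK0 : 0 ≤ K := (abs_nonneg _).trans (hK r hr)
    by_cases hrs : r < s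
    · rw [indicator_of_mem (show s ∈ Ioi r from hrs), indicator_of_mem (show r ∈ Ioc 0 s from ⟨hr.1, hrs.le⟩), norm_mul,
        norm_mul, Real.norm_eq_abs, Real.norm_eq_abs, Real.norm_eq_abs]
      calc _ ≤ |k (t - s)| * |g (s - r)| * K := by gcongr; exact hK r hr
        _ = _ := by ring
    · rw [indicator_of_notMem (show s ∉ Ioi r from hrs), zero_mul, norm_zero]
      exact indicator_nonneg (fun _ _ => by positivity) _
  have hii : ∀ s ∈ Ioc 0 t, Integrable
      ((Ioc 0 s).indicator (fun r => |k (t - s)| * K * |g (s - r)|))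
      (volume.restrict (Ioc 0 t)) := by
    intro s hs
    rw [integrable_indicator_iff measurableSet_Ioc]
    exact (((integrableOn_comp_sub hg ⟨hs.1.le, hs.2⟩).abs.const_mul _).mono_measure
      (Measure.restrict_mono_measure Measure.restrict_le_self _))
  rw [integrable_prod_iff hm]
  constructor
  · have := hm.prodMk_left
    filter_upwards [this, ae_restrict_mem measurableSet_Ioc] with s hs1 hs
    refine (hii s hs).mono' hs1 ?_
    exact (ae_restrict_iff' measurableSet_Ioc).2 (ae_of_all _ (hbd s hs))
  · have hdom : Integrable (fun s => |k (t - s)| * (K * ∫ r in Ioc 0 t, |g r|))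
        (volume.restrict (Ioc 0 t)) :=
      (integrableOn_comp_sub hk ⟨ht, le_rfl⟩).abs.mul_const _
    refine hdom.mono' hm.norm.integral_prod_right' ?_
    filter_upwards [hm.prodMk_left, ae_restrict_mem measurableSet_Ioc] with s hs1 hs
    rw [Real.norm_of_nonneg (integral_nonneg fun r => norm_nonneg _)]
    have hsI : s ∈ Icc 0 t := ⟨hs.1.le, hs.2⟩
    have hK0 : 0 ≤ K := (abs_nonneg _).trans (hK s hs)
    have h1 : ∫ r in Ioc 0 t, ‖(Ioi r).indicator (fun s => k (t - s) * g (s - r)) s * h r‖ ≤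
        ∫ r in Ioc 0 t, (Ioc 0 s).indicator (fun r => |k (t - s)| * K * |g (s - r)|) r :=
      integral_mono_of_nonneg (ae_of_all _ fun r => norm_nonneg _) (hii s hs)
        ((ae_restrict_iff' measurableSet_Ioc).2 (ae_of_all _ (hbd s hs)))
    refine h1.trans ?_
    rw [setIntegral_indicator measurableSet_Ioc, inter_eq_self_of_subset_right
      (Ioc_subset_Ioc_right hs.2), integral_const_mul, mul_assoc]
    have := setIntegral_abs_comp_sub_le hg hsI
    gcongr

/-- Associativity of the convolution when the first factor is bounded. -/
theorem conv_assoc_of_bounded_left {k g h : ℝ → ℝ} {t K : ℝ} (ht : 0 ≤ t) (hkm : Measurable k)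
    (hgm : Measurable g) (hh : IntegrableOn h (Ioc 0 t)) (hg : IntegrableOn g (Ioc 0 t))
    (hK : ∀ s ∈ Icc 0 t, |k s| ≤ K) :
    conv k (conv g h) t = conv (conv k g) h t := by
  refine conv_assoc_of_integrable ht ?_
  have hm := aestronglyMeasurable_conv_kernel (t := t) hkm hgm hh.aestronglyMeasurable
  have hK0 : 0 ≤ K := (abs_nonneg _).trans (hK 0 ⟨le_rfl, ht⟩)
  have hsub : ∀ r ∈ Ioc 0 t, IntegrableOn (fun s => g (s - r)) (Ioc r t) := by
    intro r hr
    have h1 : IntervalIntegrable g volume 0 (t - r) :=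
      (intervalIntegrable_iff_integrableOn_Ioc_of_le (by linarith [hr.2])).2
        (hg.mono_set (Ioc_subset_Ioc_right (by linarith [hr.1])))
    have h2 := h1.comp_sub_right r
    rw [zero_add, sub_add_cancel] at h2
    exact (intervalIntegrable_iff_integrableOn_Ioc_of_le hr.2).1 h2
  have hbd : ∀ r ∈ Ioc 0 t, ∀ s ∈ Ioc 0 t,
      ‖(Ioi r).indicator (fun s => k (t - s) * g (s - r)) s * h r‖ ≤
        (Ioc r t).indicator (fun s => K * |h r| * |g (s - r)|) s := by
    intro r hr s hs
    by_cases hrs : r < s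
    · rw [indicator_of_mem (show s ∈ Ioi r from hrs), indicator_of_mem (show s ∈ Ioc r t from ⟨hrs, hs.2⟩), norm_mul,
        norm_mul, Real.norm_eq_abs, Real.norm_eq_abs, Real.norm_eq_abs]
      calc _ ≤ K * |g (s - r)| * |h r| := by
            gcongr; exact hK _ ⟨by linarith [hs.2], by linarith [hs.1]⟩
        _ = _ := by ring
    · rw [indicator_of_notMem (show s ∉ Ioi r from hrs), zero_mul, norm_zero]
      exact indicator_nonneg (fun _ _ => by positivity) _
  have hii : ∀ r ∈ Ioc 0 t, Integrable
      ((Ioc r t).indicator (fun s => K * |h r| * |g (s - r)|))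
      (volume.restrict (Ioc 0 t)) := by
    intro r hr
    rw [integrable_indicator_iff measurableSet_Ioc]
    exact (((hsub r hr).abs.const_mul _).mono_measure
      (Measure.restrict_mono_measure Measure.restrict_le_self _))
  rw [integrable_prod_iff' hm]
  have hm' := hm.prod_swap
  constructor
  · filter_upwards [hm'.prodMk_left, ae_restrict_mem measurableSet_Ioc] with r hr1 hr
    refine (hii r hr).mono' hr1 ?_
    exact (ae_restrict_iff' measurableSet_Ioc).2 (ae_of_all _ (hbd r hr))
  · have hdom : Integrable (fun r => (K * |h r|) * (∫ r in Ioc 0 t, |g r|))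
        (volume.restrict (Ioc 0 t)) := (hh.abs.const_mul _).mul_const _
    refine hdom.mono' hm'.norm.integral_prod_right' ?_
    filter_upwards [hm'.prodMk_left, ae_restrict_mem measurableSet_Ioc] with r hr1 hr
    rw [Real.norm_of_nonneg (integral_nonneg fun r => norm_nonneg _)]
    have h1 : ∫ s in Ioc 0 t, ‖(Ioi r).indicator (fun s => k (t - s) * g (s - r)) s * h r‖ ≤
        ∫ s in Ioc 0 t, (Ioc r t).indicator (fun s => K * |h r| * |g (s - r)|) s :=
      integral_mono_of_nonneg (ae_of_all _ fun r => norm_nonneg _) (hii r hr)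
        ((ae_restrict_iff' measurableSet_Ioc).2 (ae_of_all _ (hbd r hr)))
    refine h1.trans ?_
    rw [setIntegral_indicator measurableSet_Ioc, inter_eq_self_of_subset_right
      (Ioc_subset_Ioc_left hr.1.le), integral_const_mul]
    have h2 : ∫ s in Ioc r t, |g (s - r)| ≤ ∫ r in Ioc 0 t, |g r| := by
      have h3 := intervalIntegral.integral_comp_sub_right (fun σ => |g σ|) (a := r) (b := t) r
      rw [sub_self, intervalIntegral.integral_of_le hr.2,
        intervalIntegral.integral_of_le (by linarith [hr.2])] at h3
      rw [h3]
      exact setIntegral_mono_set hg.norm (ae_of_all _ fun r => abs_nonneg _)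
        (Ioc_subset_Ioc_right (by linarith [hr.1])).eventuallyLE
    gcongr

/-! ### The kernels t^(b-1)/Γ(b) and t^(b-1) E_{α,b}(-l t^α). -/

section Kernels

variable {α a b l t : ℝ}

theorem measurable_rl (b : ℝ) : Measurable (rl b) := by
  unfold rl; fun_prop

theorem rl_one (t : ℝ) : rl 1 t = 1 := by simp [rl]

theorem rl_two (t : ℝ) : rl 2 t = t := by
  simp [rl, show (2 : ℝ) - 1 = 1 by norm_num]

theorem rl_nonneg (hb : 0 < b) (ht : 0 ≤ t) : 0 ≤ rl b t := by
  have := Real.Gamma_pos_of_pos hb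
  unfold rl; positivity

theorem integrableOn_rpow_Ioc (hb : 0 < b) (t : ℝ) :
    IntegrableOn (fun s : ℝ => s ^ (b - 1)) (Ioc 0 t) := by
  rcases le_total 0 t with ht | ht
  · exact (intervalIntegrable_iff_integrableOn_Ioc_of_le ht).1
      (intervalIntegral.intervalIntegrable_rpow' (by linarith))
  · simp [Ioc_eq_empty_of_le ht]

theorem integrableOn_rl (hb : 0 < b) (t : ℝ) : IntegrableOn (rl b) (Ioc 0 t) :=
  (integrableOn_rpow_Ioc hb t).div_const _

theorem measurable_mlk (hα : 1 < α) (hb : 0 < b) (l : ℝ) : Measurable (mlk α b l) := by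
  have := (continuous_mittagLeffler hα hb).measurable
  unfold mlk
  fun_prop

theorem continuous_mittagLeffler_rpow (hα : 1 < α) (hb : 0 < b) (l : ℝ) :
    Continuous fun t : ℝ => mittagLeffler α b (-l * t ^ α) :=
  (continuous_mittagLeffler hα hb).comp
    (continuous_const.mul (Real.continuous_rpow_const (by linarith)))

theorem continuous_mlk (hα : 1 < α) (hb : 1 ≤ b) (l : ℝ) : Continuous (mlk α b l) :=
  (Real.continuous_rpow_const (by linarith)).mul
    (continuous_mittagLeffler_rpow hα (by linarith) l)

theorem integrableOn_mlk (hα : 1 < α) (hb : 0 < b) (l t : ℝ) :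
    IntegrableOn (mlk α b l) (Ioc 0 t) := by
  obtain ⟨C, hC⟩ := isCompact_Icc.exists_bound_of_continuousOn (s := Icc 0 t)
    (continuous_mittagLeffler_rpow hα hb l).continuousOn
  refine ((integrableOn_rpow_Ioc hb t).norm.mul_const C).mono'
    (measurable_mlk hα hb l).aestronglyMeasurable ?_
  refine (ae_restrict_iff' measurableSet_Ioc).2 (ae_of_all _ fun s hs => ?_)
  rw [mlk, norm_mul]
  exact mul_le_mul_of_nonneg_left (hC s ⟨hs.1.le, hs.2⟩) (norm_nonneg _)

theorem mlk_recurrence (hα : 1 < α) (hb : 0 < b) (l : ℝ) (ht : 0 < t) :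
    mlk α b l t = rl b t - l * mlk α (b + α) l t := by
  rw [mlk, mittagLeffler_recurrence hα hb, rl, mlk,
    show b + α - 1 = (b - 1) + α by ring, Real.rpow_add ht]
  ring

theorem mlk_at_zero (hb : 1 < b) : mlk α b l 0 = 0 := by
  rw [mlk, Real.zero_rpow (by linarith), zero_mul]

theorem mlk_one_at_zero (hα : 1 < α) : mlk α 1 l 0 = 1 := by
  rw [mlk, sub_self, Real.rpow_zero, Real.zero_rpow (by linarith), mul_zero,
    mittagLeffler_zero hα one_pos]
  simp

theorem hasSum_mlk (hα : 1 < α) (hb : 0 < b) (l : ℝ) (ht : 0 < t) :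
    HasSum (fun n : ℕ => (-l) ^ n * rl (α * n + b) t) (mlk α b l t) := by
  have h := (summable_mittagLeffler hα hb (-l * t ^ α)).hasSum.mul_left (t ^ (b - 1))
  refine h.congr_fun fun n => ?_
  rw [rl, mul_pow, ← Real.rpow_mul_natCast ht.le,
    show α * (n : ℝ) + b - 1 = (b - 1) + α * n by ring, Real.rpow_add ht]
  ring

/-- The Beta integral, rescaled to [0, t] and read off from its complex form. -/
theorem conv_rl_rl (ha : 0 < a) (hb : 0 < b) (ht : 0 < t) :
    conv (rl a) (rl b) t = rl (a + b) t := by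
  have h1 := Complex.betaIntegral_scaled (b : ℂ) (a : ℂ) ht
  have h2 := Complex.Gamma_mul_Gamma_eq_betaIntegral (s := (b : ℂ)) (t := (a : ℂ)) (by simpa)
    (by simpa)
  have h3 : ((∫ s in (0 : ℝ)..t, s ^ (b - 1) * (t - s) ^ (a - 1) : ℝ) : ℂ) =
      ∫ s in (0 : ℝ)..t, (s : ℂ) ^ ((b : ℂ) - 1) * ((t : ℂ) - s) ^ ((a : ℂ) - 1) := by
    rw [← intervalIntegral.integral_ofReal]
    refine intervalIntegral.integral_congr fun s hs => ?_
    rw [uIcc_of_le ht.le] at hs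
    rw [Complex.ofReal_mul, Complex.ofReal_cpow hs.1, Complex.ofReal_cpow (by linarith [hs.2])]
    push_cast
    rfl
  have ha' := Real.Gamma_pos_of_pos ha
  have hb' := Real.Gamma_pos_of_pos hb
  have hab' := Real.Gamma_pos_of_pos (add_pos ha hb)
  have h4 : Real.Gamma (a + b) * ∫ s in (0 : ℝ)..t, s ^ (b - 1) * (t - s) ^ (a - 1) =
      t ^ (a + b - 1) * (Real.Gamma a * Real.Gamma b) := by
    apply Complex.ofReal_injective
    rw [Complex.ofReal_mul, h3, h1, Complex.ofReal_mul, Complex.ofReal_mul, ← Complex.Gamma_ofReal,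
      ← Complex.Gamma_ofReal, ← Complex.Gamma_ofReal, mul_comm (Complex.Gamma a), h2,
      Complex.ofReal_cpow ht.le, add_comm a b]
    push_cast
    ring
  have h5 : conv (rl a) (rl b) t = (Real.Gamma a)⁻¹ * (Real.Gamma b)⁻¹ *
      ∫ s in (0 : ℝ)..t, s ^ (b - 1) * (t - s) ^ (a - 1) := by
    rw [conv, ← intervalIntegral.integral_const_mul]
    refine intervalIntegral.integral_congr fun s _ => ?_
    simp only [rl]
    ring
  rw [h5, rl]
  field_simp
  linarith

/-- Termwise from `conv_rl_rl`; the norms of the terms sum to the same series with |l| in place of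
-l. The rule "fractional integration of order a raises b by a" drives all later computations with
these kernels. -/
theorem conv_rl_mlk (hα : 1 < α) (ha : 0 < a) (hb : 0 < b) (l : ℝ) (ht : 0 < t) :
    conv (rl a) (mlk α b l) t = mlk α (a + b) l t := by
  set F : ℕ → ℝ → ℝ := fun n s => (-l) ^ n * (rl a (t - s) * rl (α * n + b) s) with hF
  have hz : ∀ n : ℕ, 0 < α * n + b := fun n => by positivity
  have hInt : ∀ c, 0 < c → IntegrableOn (fun s => rl a (t - s) * rl c s) (Ioc 0 t) := by
    intro c hc
    -- A non-integrable function has integral 0 by convention, whereas `conv_rl_rl` gives a positive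
    -- value.
    by_contra h
    have h1 := conv_rl_rl ha hc ht
    rw [conv, intervalIntegral.integral_of_le ht.le, integral_undef h, rl] at h1
    have h2 := Real.Gamma_pos_of_pos (add_pos ha hc)
    have h3 := Real.rpow_pos_of_pos ht (a + c - 1)
    exact (div_pos h3 h2).ne h1
  have hval : ∀ c, 0 < c → ∫ s in Ioc 0 t, rl a (t - s) * rl c s = rl (a + c) t := by
    intro c hc
    rw [← conv_rl_rl ha hc ht, conv, intervalIntegral.integral_of_le ht.le]
  have hFi : ∀ n, Integrable (F n) (volume.restrict (Ioc 0 t)) := fun n =>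
    (hInt _ (hz n)).const_mul _
  have hnorm : ∀ n, ∫ s in Ioc 0 t, ‖F n s‖ = |l| ^ n * rl (α * n + (a + b)) t := by
    intro n
    rw [show α * n + (a + b) = a + (α * n + b) by ring, ← hval _ (hz n), ← integral_const_mul]
    refine setIntegral_congr_fun measurableSet_Ioc fun s hs => ?_
    simp only [hF]
    rw [norm_mul, norm_pow, norm_neg, Real.norm_eq_abs, Real.norm_of_nonneg]
    exact mul_nonneg (rl_nonneg ha (by linarith [hs.2])) (rl_nonneg (hz n) hs.1.le)
  have hsum : Summable fun n => ∫ s, ‖F n s‖ ∂(volume.restrict (Ioc 0 t)) := by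
    simp_rw [hnorm]
    have := (hasSum_mlk hα (add_pos ha hb) (-|l|) ht).summable
    simpa using this
  have hS := hasSum_integral_of_summable_integral_norm hFi hsum
  have h1 : ∫ s in Ioc 0 t, ∑' n, F n s = conv (rl a) (mlk α b l) t := by
    rw [conv, intervalIntegral.integral_of_le ht.le]
    refine setIntegral_congr_fun measurableSet_Ioc fun s hs => ?_
    have := ((hasSum_mlk hα hb l hs.1).mul_left (rl a (t - s))).tsum_eq
    simp only [← this, hF]
    exact tsum_congr fun n => by ring
  rw [h1] at hS
  have h2 := hasSum_mlk hα (add_pos ha hb) l ht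
  refine hS.unique (h2.congr_fun fun n => ?_)
  simp only [hF]
  rw [integral_const_mul, hval _ (hz n)]
  congr 2
  ring

theorem conv_mlk_rl (hα : 1 < α) (ha : 0 < a) (hb : 0 < b) (l : ℝ) (ht : 0 < t) :
    conv (mlk α b l) (rl a) t = mlk α (a + b) l t := by
  rw [conv_comm, conv_rl_mlk hα ha hb l ht]

theorem conv_one (g : ℝ → ℝ) (t : ℝ) : conv (rl 1) g t = ∫ s in (0 : ℝ)..t, g s := by
  simp [conv, rl_one]

theorem integral_mlk (hα : 1 < α) (hb : 0 < b) (l : ℝ) (ht : 0 ≤ t) :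
    ∫ s in (0 : ℝ)..t, mlk α b l s = mlk α (b + 1) l t := by
  rcases ht.eq_or_lt with rfl | ht
  · rw [intervalIntegral.integral_same, mlk_at_zero (by linarith)]
  · rw [← conv_one, conv_rl_mlk hα one_pos hb l ht, add_comm]

end Kernels

/-- The only continuous function with `k_{2-α} * z + l (k_2 * z) = 0` is zero. -/
theorem eq_zero_of_conv_rl_add {α l T : ℝ} (hα : 1 < α) (hα2 : α < 2) {z : ℝ → ℝ}
    (hz : ContinuousOn z (Icc 0 T))
    (h : ∀ t ∈ Ioo 0 T, conv (rl (2 - α)) z t + l * conv (rl 2) z t = 0) :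
    ∀ t ∈ Ioo 0 T, z t = 0 := by
  obtain ⟨K, hK⟩ := isCompact_Icc.exists_bound_of_continuousOn hz
  -- Convolution with the kernel of order α - 1 sends k_{2-α} to E_{α,1}(-l t^α) and k_2 to t^α
  -- E_{α,1+α}(-l t^α). By the recurrence the first plus l times the second is the constant 1, so
  -- only the integral of z survives.
  have h0 : ∀ t ∈ Ioo 0 T, ∫ s in (0 : ℝ)..t, z s = 0 := by
    intro t ht
    have hzm : AEStronglyMeasurable z (volume.restrict (Ioc 0 t)) :=
      (hz.mono fun s hs => ⟨hs.1.le, hs.2.trans ht.2.le⟩).aestronglyMeasurable measurableSet_Ioc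
    have hzb : ∀ s ∈ Ioc 0 t, |z s| ≤ K := fun s hs => hK s ⟨hs.1.le, hs.2.trans ht.2.le⟩
    have hm := measurable_mlk (b := α - 1) hα (by linarith) l
    have hi := integrableOn_mlk (b := α - 1) hα (by linarith) l t
    have e1 := conv_assoc_of_bounded ht.1.le hm (measurable_rl (2 - α)) hzm hi
      (integrableOn_rl (by linarith) t) hzb
    have e2 := conv_assoc_of_bounded ht.1.le hm (measurable_rl 2) hzm hi
      (integrableOn_rl (by norm_num) t) hzb
    have e3 : conv (mlk α (α - 1) l) (conv (rl (2 - α)) z) t =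
        -l * conv (mlk α (α - 1) l) (conv (rl 2) z) t := by
      rw [conv, conv, ← intervalIntegral.integral_const_mul,
        intervalIntegral.integral_of_le ht.1.le, intervalIntegral.integral_of_le ht.1.le]
      refine setIntegral_congr_fun measurableSet_Ioc fun s hs => ?_
      have := h s ⟨hs.1, hs.2.trans_lt ht.2⟩
      simp only [show conv (rl (2 - α)) z s = -l * conv (rl 2) z s by linarith]
      ring
    rw [e1, e2, conv_congr_left ht.1.le (h := mlk α 1 l), conv_congr_left
      (k := conv (mlk α (α - 1) l) (rl 2)) ht.1.le (h := mlk α (1 + α) l)] at e3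
    · have hmul : ∀ b, 1 ≤ b → IntervalIntegrable (fun s => mlk α b l (t - s) * z s)
          volume 0 t := by
        intro b hb
        refine (ContinuousOn.mul ?_ ?_).intervalIntegrable
        · exact ((continuous_mlk hα hb l).comp (continuous_const.sub continuous_id)).continuousOn
        · rw [uIcc_of_le ht.1.le]
          exact hz.mono fun s hs => ⟨hs.1, hs.2.trans ht.2.le⟩
      rw [conv, conv, ← intervalIntegral.integral_const_mul] at e3
      rw [← sub_eq_zero, ← intervalIntegral.integral_sub (hmul 1 le_rfl)
        ((hmul (1 + α) (by linarith)).const_mul _)] at e3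
      refine Eq.trans ?_ e3
      rw [intervalIntegral.integral_of_le ht.1.le, intervalIntegral.integral_of_le ht.1.le,
        integral_Ioc_eq_integral_Ioo, integral_Ioc_eq_integral_Ioo]
      refine setIntegral_congr_fun measurableSet_Ioo fun s hs => ?_
      simp only [mlk_recurrence hα one_pos l (sub_pos.2 hs.2), rl_one]
      ring
    · intro s hs
      rw [conv_mlk_rl hα (by norm_num) (by linarith) l hs.1]
      congr 1; ring
    · intro s hs
      rw [conv_mlk_rl hα (by linarith) (by linarith) l hs.1]
      congr 1; ring
  intro t ht
  have hcont : ContinuousAt z t := hz.continuousAt (Icc_mem_nhds ht.1 ht.2)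
  have hInt : IntervalIntegrable z volume 0 t := by
    refine ContinuousOn.intervalIntegrable ?_
    rw [uIcc_of_le ht.1.le]
    exact hz.mono fun s hs => ⟨hs.1, hs.2.trans ht.2.le⟩
  have hd := intervalIntegral.integral_hasDerivAt_right hInt
    (hz.mono Ioo_subset_Icc_self |>.stronglyMeasurableAtFilter isOpen_Ioo t ht) hcont
  have hd0 : HasDerivAt (fun u => ∫ s in (0 : ℝ)..u, z s) 0 t := by
    refine (hasDerivAt_const t (0 : ℝ)).congr_of_eventuallyEq ?_
    filter_upwards [Ioo_mem_nhds ht.1 ht.2] with u hu using h0 u hu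
  exact hd.unique hd0

/-! ### Diagonal operators in a Hilbert basis. -/

section Diagonal

variable {ι H : Type*} [NormedAddCommGroup H] [InnerProductSpace ℝ H] (φ : HilbertBasis ι ℝ H)

theorem hasSum_inner_sq (x : H) : HasSum (fun i => (inner ℝ (φ i) x) ^ 2) (‖x‖ ^ 2) := by
  have := lp.hasSum_norm (p := 2) (by norm_num) (φ.repr x)
  simpa [HilbertBasis.repr_apply_apply] using this

theorem ext_inner_basis {x y : H} (h : ∀ i, inner ℝ (φ i) x = inner ℝ (φ i) y) : x = y := by
  apply φ.repr.injective
  ext i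
  simpa [HilbertBasis.repr_apply_apply] using h i

theorem memℓp_mul_repr {a : ι → ℝ} (ha : ∃ C, ∀ i, |a i| ≤ C) (h : H) :
    Memℓp (fun i => a i * inner ℝ (φ i) h) 2 := by
  obtain ⟨C, hC⟩ := ha
  rw [memℓp_gen_iff (by norm_num)]
  refine Summable.of_nonneg_of_le (fun i => by positivity) (fun i => ?_)
    ((hasSum_inner_sq φ h).summable.mul_left (C ^ 2))
  simp only [ENNReal.toReal_ofNat, Real.rpow_ofNat, norm_mul, mul_pow, Real.norm_eq_abs, sq_abs]
  rw [← sq_abs (a i)]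
  have := hC i
  gcongr

/-- The linear map that multiplies the coefficients with respect to an orthonormal basis. -/
def diagLM {a : ι → ℝ} (ha : ∃ C, ∀ i, |a i| ≤ C) : H →ₗ[ℝ] H where
  toFun h := φ.repr.symm ⟨fun i => a i * inner ℝ (φ i) h, memℓp_mul_repr φ ha h⟩
  map_add' h k := by
    rw [← map_add]
    congr 1
    ext i
    simp [inner_add_right, mul_add]
    rfl
  map_smul' c h := by
    rw [RingHom.id_apply, ← map_smul]
    congr 1
    ext i
    simp [inner_smul_right]
    ring

theorem inner_diagLM {a : ι → ℝ} (ha : ∃ C, ∀ i, |a i| ≤ C) (h : H) (i : ι) :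
    inner ℝ (φ i) (diagLM φ ha h) = a i * inner ℝ (φ i) h := by
  rw [← HilbertBasis.repr_apply_apply]
  simp [diagLM]

theorem norm_le_of_abs_inner_le {x y : H} {C : ℝ} (hC : 0 ≤ C)
    (h : ∀ i, |inner ℝ (φ i) x| ≤ C * |inner ℝ (φ i) y|) : ‖x‖ ≤ C * ‖y‖ := by
  refine abs_le_of_sq_le_sq' ?_ (by positivity) |>.2
  rw [mul_pow]
  refine hasSum_le (fun i => ?_) (hasSum_inner_sq φ x) ((hasSum_inner_sq φ y).mul_left (C ^ 2))
  rw [← mul_pow, sq_le_sq, abs_mul, abs_of_nonneg hC]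
  exact h i

open Classical in
/-- The diagonal operator with bounded coefficients `a`. -/
def diagL (a : ι → ℝ) : H →L[ℝ] H :=
  if ha : ∃ C, ∀ i, |a i| ≤ C then (diagLM φ ha).mkContinuousOfExistsBound (by
    obtain ⟨C, hC⟩ := id ha
    refine ⟨|C|, fun h => norm_le_of_abs_inner_le φ (abs_nonneg C) fun i => ?_⟩
    rw [inner_diagLM, abs_mul]
    exact mul_le_mul_of_nonneg_right ((hC i).trans (le_abs_self C)) (abs_nonneg _)) else 0

variable {φ}

theorem inner_diagL {a : ι → ℝ} {C : ℝ} (ha : ∀ i, |a i| ≤ C) (h : H) (i : ι) :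
    inner ℝ (φ i) (diagL φ a h) = a i * inner ℝ (φ i) h := by
  have h1 : ∃ C, ∀ i, |a i| ≤ C := ⟨C, ha⟩
  rw [diagL, dif_pos h1]
  exact inner_diagLM φ h1 h i

theorem norm_diagL_le {a : ι → ℝ} {C : ℝ} (hC : 0 ≤ C) (ha : ∀ i, |a i| ≤ C) (h : H) :
    ‖diagL φ a h‖ ≤ C * ‖h‖ := by
  refine norm_le_of_abs_inner_le φ hC fun i => ?_
  rw [inner_diagL ha, abs_mul]
  exact mul_le_mul_of_nonneg_right (ha i) (abs_nonneg _)

/-- For fixed h, dominated convergence in the series of squared coefficients, with majorant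
(2C)²(φ_i,h)²; the common bound C upgrades this to joint continuity. Joint continuity later makes τ
↦ K(t-τ) g(τ) measurable. -/
theorem continuous_diagL {Y : Type*} [TopologicalSpace Y] {a : Y → ι → ℝ} {C : ℝ} (hC : 0 ≤ C)
    (ha : ∀ y i, |a y i| ≤ C) (hcont : ∀ i, Continuous fun y => a y i) :
    Continuous fun p : Y × H => diagL φ (a p.1) p.2 := by
  have hstrong : ∀ h : H, Continuous fun y => diagL φ (a y) h := by
    intro h
    rw [continuous_iff_continuousAt]
    intro y₀
    rw [ContinuousAt, tendsto_iff_norm_sub_tendsto_zero]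
    have hsq : Tendsto (fun y => ‖diagL φ (a y) h - diagL φ (a y₀) h‖ ^ 2) (𝓝 y₀) (𝓝 0) := by
      have h1 : ∀ y, ‖diagL φ (a y) h - diagL φ (a y₀) h‖ ^ 2 =
          ∑' i, ((a y i - a y₀ i) * inner ℝ (φ i) h) ^ 2 := by
        intro y
        rw [← (hasSum_inner_sq φ _).tsum_eq]
        refine tsum_congr fun i => ?_
        rw [inner_sub_right, inner_diagL (ha y), inner_diagL (ha y₀), sub_mul]
      simp_rw [h1]
      have h2 : (0 : ℝ) = ∑' i, ((a y₀ i - a y₀ i) * inner ℝ (φ i) h) ^ 2 := by simp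
      rw [h2]
      refine tendsto_tsum_of_dominated_convergence
        (bound := fun i => (2 * C) ^ 2 * (inner ℝ (φ i) h) ^ 2)
        ((hasSum_inner_sq φ h).summable.mul_left _) (fun i => ?_) ?_
      · exact ((((hcont i).sub continuous_const).mul continuous_const).pow 2).tendsto y₀
      · refine Eventually.of_forall fun y i => ?_
        rw [Real.norm_of_nonneg (sq_nonneg _), mul_pow]
        have h3 : |a y i - a y₀ i| ≤ 2 * C := by
          refine (abs_sub _ _).trans ?_
          linarith [ha y i, ha y₀ i]
        rw [← sq_abs (a y i - a y₀ i)]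
        gcongr
    have h4 := (Real.continuous_sqrt.tendsto 0).comp hsq
    simpa [Function.comp_def, Real.sqrt_sq (norm_nonneg _)] using h4
  rw [continuous_iff_continuousAt]
  rintro ⟨y₀, h₀⟩
  rw [ContinuousAt, tendsto_iff_norm_sub_tendsto_zero]
  have h1 : Tendsto (fun p : Y × H => C * ‖p.2 - h₀‖ + ‖diagL φ (a p.1) h₀ - diagL φ (a y₀) h₀‖)
      (𝓝 (y₀, h₀)) (𝓝 (C * ‖h₀ - h₀‖ + ‖diagL φ (a y₀) h₀ - diagL φ (a y₀) h₀‖)) := by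
    refine Continuous.tendsto (f := fun p : Y × H => C * ‖p.2 - h₀‖ +
      ‖diagL φ (a p.1) h₀ - diagL φ (a y₀) h₀‖) ?_ (y₀, h₀)
    have := (hstrong h₀).comp (continuous_fst : Continuous (Prod.fst : Y × H → Y))
    exact (continuous_const.mul (continuous_snd.sub continuous_const).norm).add
      (this.sub continuous_const).norm
  simp only [sub_self, norm_zero, mul_zero, add_zero] at h1
  refine squeeze_zero (fun _ => norm_nonneg _) (fun p => ?_) h1
  have h2 : diagL φ (a p.1) p.2 - diagL φ (a y₀) h₀ =
      diagL φ (a p.1) (p.2 - h₀) + (diagL φ (a p.1) h₀ - diagL φ (a y₀) h₀) := by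
    rw [map_sub]; abel
  rw [h2]
  exact (norm_add_le _ _).trans (add_le_add (norm_diagL_le hC (ha p.1) _) le_rfl)

theorem hasSum_of_inner {x : H} {c : ι → ℝ} (h : ∀ i, inner ℝ (φ i) x = c i) :
    HasSum (fun i => c i • φ i) x := by
  have := φ.hasSum_repr x
  simpa [HilbertBasis.repr_apply_apply, h] using this

end Diagonal

/-! ### Fractional powers of A, the spaces V_s and the Mittag-Leffler operators. -/

theorem rpow_le_one_add {x θ : ℝ} (hx : 0 ≤ x) (h0 : 0 ≤ θ) (h1 : θ ≤ 1) : x ^ θ ≤ 1 + x := by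
  rcases le_total x 1 with h | h
  · linarith [Real.rpow_le_one hx h h0]
  · have := Real.rpow_le_rpow_of_exponent_le h h1
    rw [Real.rpow_one] at this
    linarith

namespace EigenBasis

variable {X : Type*} [MeasurableSpace X] {m : Measure X} {E : DirichletForm m} {ι : Type*}
  (B : EigenBasis E ι)

theorem exists_rpow_neg_le {s : ℝ} (hs : 0 ≤ s) : ∃ C, ∀ i, |B.lam i ^ (-s)| ≤ C := by
  obtain ⟨c, hc, hl⟩ := B.lower
  refine ⟨c ^ (-s), fun i => ?_⟩
  rw [abs_of_pos (Real.rpow_pos_of_pos (B.lam_pos i) _)]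
  exact Real.rpow_le_rpow_of_nonpos hc (hl i) (by linarith)

/-- The operator `A^{-s}` on `L²`, `s ≥ 0`. -/
def negPow (s : ℝ) : L2 m →L[ℝ] L2 m := diagL B.φ fun i => B.lam i ^ (-s)

theorem inner_negPow {s : ℝ} (hs : 0 ≤ s) (h : L2 m) (i : ι) :
    inner ℝ (B.φ i) (B.negPow s h) = B.lam i ^ (-s) * inner ℝ (B.φ i) h := by
  obtain ⟨C, hC⟩ := B.exists_rpow_neg_le hs
  exact inner_diagL hC h i

/-- The isometry `A^s` from `V_s` to `L²`. -/
def powLI (s : ℝ) : B.V s →ₗᵢ[ℝ] L2 m where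
  toLinearMap := B.φ.repr.symm.toLinearEquiv.toLinearMap ∘ₗ B.toEll2 s
  norm_map' u := by
    change ‖B.φ.repr.symm (B.toEll2 s u)‖ = ‖u‖
    rw [LinearIsometryEquiv.norm_map]
    rfl

theorem inner_powLI (s : ℝ) (u : B.V s) (i : ι) :
    inner ℝ (B.φ i) (B.powLI s u) = B.lam i ^ s * inner ℝ (B.φ i) (u : L2 m) := by
  rw [← HilbertBasis.repr_apply_apply]
  change B.φ.repr (B.φ.repr.symm (B.toEll2 s u)) i = _
  rw [LinearIsometryEquiv.apply_symm_apply]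
  rfl

theorem exists_of_inner {s : ℝ} {x h : L2 m}
    (hx : ∀ i, inner ℝ (B.φ i) h = B.lam i ^ s * inner ℝ (B.φ i) x) :
    ∃ u : B.V s, (u : L2 m) = x ∧ B.powLI s u = h := by
  have hmem : x ∈ B.sub s := by
    change Memℓp (B.coef s x) 2
    have h1 : B.coef s x = fun i => B.φ.repr h i := by
      ext i
      rw [HilbertBasis.repr_apply_apply, hx i]
      rfl
    rw [h1]
    exact (B.φ.repr h).2
  let u : B.V s := ⟨x, hmem⟩
  have hu : (u : L2 m) = x := rfl
  refine ⟨u, hu, ext_inner_basis B.φ fun i => ?_⟩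
  rw [inner_powLI, hu, hx i]

/-- The isometric isomorphism `A^s` from `V_s` to `L²`, `s ≥ 0`. -/
def powEquiv {s : ℝ} (hs : 0 ≤ s) : B.V s ≃ₗᵢ[ℝ] L2 m :=
  LinearIsometryEquiv.ofSurjective (B.powLI s) fun h => by
    obtain ⟨u, _, hu⟩ := B.exists_of_inner (s := s) (x := B.negPow s h) (h := h) fun i => by
      rw [B.inner_negPow hs, ← mul_assoc, ← Real.rpow_add (B.lam_pos i), add_neg_cancel,
        Real.rpow_zero, one_mul]
    exact ⟨u, hu⟩

theorem inner_powEquiv {s : ℝ} (hs : 0 ≤ s) (u : B.V s) (i : ι) :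
    inner ℝ (B.φ i) (B.powEquiv hs u) = B.lam i ^ s * inner ℝ (B.φ i) (u : L2 m) :=
  B.inner_powLI s u i

theorem inner_powEquiv_symm {s : ℝ} (hs : 0 ≤ s) (h : L2 m) (i : ι) :
    inner ℝ (B.φ i) ((B.powEquiv hs).symm h : L2 m) = B.lam i ^ (-s) * inner ℝ (B.φ i) h := by
  have := B.inner_powEquiv hs ((B.powEquiv hs).symm h) i
  rw [LinearIsometryEquiv.apply_symm_apply] at this
  rw [this, ← mul_assoc, ← Real.rpow_add (B.lam_pos i), neg_add_cancel, Real.rpow_zero, one_mul]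

/-- `(B.powEquiv hs).symm h` is the element of `V_s` equal to `x` when `h = A^s x`. -/
theorem powEquiv_symm_eq {s : ℝ} (hs : 0 ≤ s) {x h : L2 m}
    (hx : ∀ i, inner ℝ (B.φ i) h = B.lam i ^ s * inner ℝ (B.φ i) x) :
    ((B.powEquiv hs).symm h : L2 m) = x := by
  refine ext_inner_basis B.φ fun i => ?_
  rw [B.inner_powEquiv_symm hs, hx i, ← mul_assoc, ← Real.rpow_add (B.lam_pos i), neg_add_cancel,
    Real.rpow_zero, one_mul]

/-- The basis vector `φ_i` as an element of `V_s`. -/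
def basisV {s : ℝ} (hs : 0 ≤ s) (i : ι) : B.V s :=
  (B.powEquiv hs).symm (B.lam i ^ s • B.φ i)

theorem coe_basisV {s : ℝ} (hs : 0 ≤ s) (i : ι) : (B.basisV hs i : L2 m) = B.φ i := by
  refine B.powEquiv_symm_eq hs fun j => ?_
  rw [inner_smul_right]
  by_cases h : j = i
  · rw [h]
  · rw [B.φ.orthonormal.2 h, mul_zero, mul_zero]

/-- The φ_i span a dense subspace of V_s, because A^s carries V_s isometrically onto L² and each φ_i
to a multiple of itself. Identities in the dual can therefore be tested on coordinates. -/
theorem vdual_ext {s : ℝ} (hs : 0 ≤ s) {F G : B.VDual s}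
    (h : ∀ i, F (B.basisV hs i) = G (B.basisV hs i)) : F = G := by
  let L : B.V s ≃L[ℝ] L2 m := (B.powEquiv hs).toContinuousLinearEquiv
  have key : F ∘L (L.symm : L2 m →L[ℝ] B.V s) = G ∘L (L.symm : L2 m →L[ℝ] B.V s) := by
    refine ContinuousLinearMap.ext_on (s := Set.range B.φ) ?_ ?_
    · have := B.φ.dense_span
      rw [Submodule.dense_iff_topologicalClosure_eq_top]
      exact this
    · rintro _ ⟨i, rfl⟩
      have h1 := h i
      have h2 : B.basisV hs i = B.lam i ^ s • L.symm (B.φ i) := by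
        rw [← map_smul]; rfl
      rw [h2, map_smul, map_smul, smul_eq_mul, smul_eq_mul] at h1
      exact mul_left_cancel₀ (Real.rpow_pos_of_pos (B.lam_pos i) s).ne' h1
  ext v
  have h3 := DFunLike.congr_fun key (L v)
  simpa using h3

variable (α : ℝ)

/-- The multiplier `(λ |t|^α)^θ E_{α,b}(-λ |t|^α)`. -/
def mlMult (b θ t : ℝ) (i : ι) : ℝ :=
  (B.lam i * |t| ^ α) ^ θ * mittagLeffler α b (-(B.lam i * |t| ^ α))

/-- The operator `(|t|^α A)^θ E_{α,b}(-|t|^α A)`. -/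
def mlOp (b θ t : ℝ) : L2 m →L[ℝ] L2 m := diagL B.φ (B.mlMult α b θ t)

variable {α}

/-- The growth x^θ ≤ 1 + x is beaten by the decay C/(1+x), uniformly in t and in the eigenvalue. In
other words A^θ E_{α,b}(-t^α A) costs t^(-αθ), which is the source of the powers of time in the
estimates. -/
theorem exists_abs_mlMult_le (hα : 1 < α) (hα2 : α < 2) {b θ : ℝ} (hb : 0 < b) (h0 : 0 ≤ θ)
    (h1 : θ ≤ 1) : ∃ C, 0 < C ∧ ∀ t i, |B.mlMult α b θ t i| ≤ C := by
  obtain ⟨C, hC, h⟩ := exists_abs_mittagLeffler_le hα hα2 hb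
  refine ⟨C, hC, fun t i => ?_⟩
  have hx : 0 ≤ B.lam i * |t| ^ α := by
    have := B.lam_pos i
    positivity
  rw [mlMult, abs_mul, abs_of_nonneg (by positivity)]
  have h2 := rpow_le_one_add hx h0 h1
  have h3 := h _ hx
  rw [le_div_iff₀ (by positivity)] at h3
  calc _ ≤ (1 + B.lam i * |t| ^ α) * |mittagLeffler α b (-(B.lam i * |t| ^ α))| := by gcongr
    _ ≤ C := by linarith

/-- The absolute value of t in the multiplier makes continuity hold on the whole line, with no
separate discussion of t = 0. -/
theorem continuous_mlMult (hα : 1 < α) {b θ : ℝ} (hb : 0 < b) (h0 : 0 ≤ θ) (i : ι) :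
    Continuous fun t => B.mlMult α b θ t i := by
  have h1 : Continuous fun t : ℝ => B.lam i * |t| ^ α :=
    continuous_const.mul (continuous_abs.rpow_const fun _ => Or.inr (by linarith))
  exact (h1.rpow_const fun _ => Or.inr h0).mul ((continuous_mittagLeffler hα hb).comp h1.neg)

theorem exists_norm_mlOp_le (hα : 1 < α) (hα2 : α < 2) {b θ : ℝ} (hb : 0 < b) (h0 : 0 ≤ θ)
    (h1 : θ ≤ 1) : ∃ C, 0 < C ∧ ∀ t h, ‖B.mlOp α b θ t h‖ ≤ C * ‖h‖ := by
  obtain ⟨C, hC, h⟩ := B.exists_abs_mlMult_le hα hα2 hb h0 h1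
  exact ⟨C, hC, fun t x => norm_diagL_le hC.le (h t) x⟩

theorem inner_mlOp (hα : 1 < α) (hα2 : α < 2) {b θ : ℝ} (hb : 0 < b) (h0 : 0 ≤ θ)
    (h1 : θ ≤ 1) (t : ℝ) (h : L2 m) (i : ι) :
    inner ℝ (B.φ i) (B.mlOp α b θ t h) = B.mlMult α b θ t i * inner ℝ (B.φ i) h := by
  obtain ⟨C, _, hb⟩ := B.exists_abs_mlMult_le hα hα2 hb h0 h1
  exact inner_diagL (hb t) h i

theorem continuous_mlOp (hα : 1 < α) (hα2 : α < 2) {b θ : ℝ} (hb : 0 < b) (h0 : 0 ≤ θ)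
    (h1 : θ ≤ 1) : Continuous fun p : ℝ × L2 m => B.mlOp α b θ p.1 p.2 := by
  obtain ⟨C, hC, h⟩ := B.exists_abs_mlMult_le hα hα2 hb h0 h1
  exact continuous_diagL hC.le h (B.continuous_mlMult hα hb h0)

/-- The multiplier as a multiple of the kernel `t^{b-1} E_{α,b}(-λ t^α)`. -/
theorem mlMult_eq {b θ t : ℝ} (ht : 0 < t) (i : ι) :
    B.mlMult α b θ t i = B.lam i ^ θ * (t ^ (α * θ - (b - 1)) * mlk α b (B.lam i) t) := by
  rw [mlMult, abs_of_pos ht, Real.mul_rpow (B.lam_pos i).le (by positivity),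
    ← Real.rpow_mul ht.le, mlk, Real.rpow_sub ht, neg_mul]
  field_simp

end EigenBasis

/-! ### Eigenvector bases of compact symmetric operators, and orthonormal families. -/

section Spectral

universe u

variable {H : Type u} [NormedAddCommGroup H] [InnerProductSpace ℝ H]

/-- The union of Hilbert bases of an orthogonal family of closed subspaces with dense span. -/
theorem orthogonal_span_sigma_eq_bot {κ : Type*} {V : κ → Submodule ℝ H} {w : κ → Type*}
    (b : ∀ μ, HilbertBasis (w μ) ℝ (V μ)) (hV : (⨆ μ, V μ)ᗮ = ⊥) :
    (Submodule.span ℝ (Set.range fun a : Σ μ, w μ => ((b a.1 a.2 : V a.1) : H)))ᗮ = ⊥ := by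
  have hle : ∀ μ, V μ ≤ (Submodule.span ℝ
      (Set.range fun a : Σ μ, w μ => ((b a.1 a.2 : V a.1) : H))).topologicalClosure := by
    intro μ x hx
    have h1 : (⟨x, hx⟩ : V μ) ∈ (Submodule.span ℝ (Set.range (b μ))).topologicalClosure := by
      rw [(b μ).dense_span]; trivial
    have h2 : Set.MapsTo ((↑) : V μ → H) (Submodule.span ℝ (Set.range (b μ)) : Set (V μ))
        (Submodule.span ℝ (Set.range fun a : Σ μ, w μ => ((b a.1 a.2 : V a.1) : H)) : Set H) := by
      intro y hy
      have h3 : (y : H) ∈ (Submodule.span ℝ (Set.range (b μ))).map (V μ).subtype :=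
        ⟨y, hy, rfl⟩
      rw [Submodule.map_span] at h3
      refine Submodule.span_mono ?_ h3
      rintro _ ⟨_, ⟨i, rfl⟩, rfl⟩
      exact ⟨⟨μ, i⟩, rfl⟩
    exact h2.closure continuous_subtype_val h1
  rw [eq_bot_iff, ← hV, ← Submodule.orthogonal_closure (Submodule.span ℝ _)]
  exact Submodule.orthogonal_le (iSup_le hle)

/-- A compact symmetric operator has a Hilbert basis of eigenvectors. -/
theorem exists_hilbertBasis_eigenvectors [CompleteSpace H] {R : H →L[ℝ] H}
    (hR : IsCompactOperator R) (hs : (R : H →ₗ[ℝ] H).IsSymmetric) :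
    ∃ (κ : Type u) (b : HilbertBasis κ ℝ H) (μ : κ → ℝ), ∀ i, R (b i) = μ i • b i := by
  have hcl : ∀ μ, IsClosed (Module.End.eigenspace (R : H →ₗ[ℝ] H) μ : Set H) := fun μ => by
    have : (Module.End.eigenspace (R : H →ₗ[ℝ] H) μ : Set H) = {x | R x = μ • x} := by
      ext x; simp
    rw [this]
    exact isClosed_eq R.continuous (continuous_const_smul μ)
  have hcomp : ∀ μ, CompleteSpace (Module.End.eigenspace (R : H →ₗ[ℝ] H) μ) :=
    fun μ => (hcl μ).completeSpace_coe
  -- A basis is chosen in every eigenspace, that of 0 included, which need not be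
  -- finite-dimensional; completeness of the space is enough.
  have hb : ∀ μ, ∃ (w : Set (Module.End.eigenspace (R : H →ₗ[ℝ] H) μ)),
      Nonempty (HilbertBasis w ℝ (Module.End.eigenspace (R : H →ₗ[ℝ] H) μ)) := fun μ => by
    obtain ⟨w, b, -⟩ := exists_hilbertBasis ℝ (Module.End.eigenspace (R : H →ₗ[ℝ] H) μ)
    exact ⟨w, ⟨b⟩⟩
  choose w hb using hb
  have b := fun μ => (hb μ).some
  have hon := hs.orthogonalFamily_eigenspaces.orthonormal_sigma_orthonormal
    (v_family := fun μ => ⇑(b μ)) fun μ => (b μ).orthonormal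
  have hspan := orthogonal_span_sigma_eq_bot b
    (ContinuousLinearMap.orthogonalComplement_iSup_eigenspaces_eq_bot hR hs)
  let b' := HilbertBasis.mkOfOrthogonalEqBot hon hspan
  have hb' : ⇑b' = _ := HilbertBasis.coe_mkOfOrthogonalEqBot hon hspan
  refine ⟨_, b', fun a => a.1, fun a => ?_⟩
  rw [hb']
  exact Module.End.mem_eigenspace_iff.1 (b a.1 a.2).2

theorem dist_orthonormal {κ : Type*} {v : κ → H} (hv : Orthonormal ℝ v) {i j : κ} (h : i ≠ j) :
    dist (v i) (v j) = Real.sqrt 2 := by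
  rw [dist_eq_norm, ← Real.sqrt_sq (norm_nonneg _), norm_sub_sq_real, hv.1, hv.1, hv.2 h]
  norm_num

/-- The balls of radius √2/2 around orthonormal vectors are disjoint open sets. -/
theorem countable_of_orthonormal [TopologicalSpace.SeparableSpace H] {κ : Type*} {v : κ → H}
    (hv : Orthonormal ℝ v) : Countable κ := by
  have hpos : (0 : ℝ) < Real.sqrt 2 / 2 := by positivity
  refine Pairwise.countable_of_isOpen_disjoint (s := fun i => Metric.ball (v i) (Real.sqrt 2 / 2))
    (fun i j hij => ?_) (fun i => Metric.isOpen_ball) fun i => ⟨v i, Metric.mem_ball_self hpos⟩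
  refine Metric.ball_disjoint_ball ?_
  rw [dist_orthonormal hv hij]
  linarith

/-- Finitely many balls of radius √2/2 cover K, and two orthonormal vectors, at distance √2, cannot
share one. -/
theorem finite_of_orthonormal_of_isCompact {κ : Type*} {v : κ → H} (hv : Orthonormal ℝ v)
    {K : Set H} (hK : IsCompact K) {S : Set κ} (hS : ∀ i ∈ S, v i ∈ K) : S.Finite := by
  have hpos : (0 : ℝ) < Real.sqrt 2 / 2 := by positivity
  obtain ⟨t, ht, hcov⟩ := Metric.totallyBounded_iff.1 hK.totallyBounded _ hpos
  have hmem : ∀ i ∈ S, ∃ y ∈ t, v i ∈ Metric.ball y (Real.sqrt 2 / 2) := fun i hi => by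
    simpa using hcov (hS i hi)
  choose! f hft hf using hmem
  refine Set.Finite.of_finite_image (ht.subset (image_subset_iff.2 hft)) fun i hi j hj hij => ?_
  by_contra hne
  have h1 := hf i hi
  have h2 := hf j hj
  rw [hij] at h1
  rw [Metric.mem_ball] at h1 h2
  have h3 := dist_triangle_right (v i) (v j) (f j)
  rw [dist_orthonormal hv hne] at h3
  linarith

end Spectral

/-! ### The form domain as a Hilbert space, the resolvent and the eigenbasis. -/

section FormDomain

variable {X : Type*} [MeasurableSpace X] {m : Measure X}

namespace DirichletForm

variable (E : DirichletForm m)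

/-- The form domain, to be normed by `(E(u,u) + ‖u‖²)^{1/2}`. -/
def FormDom : Type _ := E.dom

instance : AddCommGroup E.FormDom := inferInstanceAs (AddCommGroup E.dom)
instance : Module ℝ E.FormDom := inferInstanceAs (Module ℝ E.dom)

/-- The inclusion of the form domain in `L²`. -/
def domIncl : E.FormDom →ₗ[ℝ] L2 m := E.dom.subtype

/-- The form on the form domain. -/
def domForm : E.FormDom →ₗ[ℝ] E.FormDom →ₗ[ℝ] ℝ := E.form

/-- The inner product `E(u,v) + (u,v)`. -/
abbrev core : InnerProductSpace.Core ℝ E.FormDom where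
  inner u v := E.domForm u v + inner ℝ (E.domIncl u) (E.domIncl v)
  conj_inner_symm u v := by
    simp only [conj_trivial]
    rw [real_inner_comm]
    congr 1
    exact E.symm v u
  re_inner_nonneg u := by
    simp only [RCLike.re_to_real]
    exact add_nonneg (E.nonneg u) real_inner_self_nonneg
  add_left u v w := by
    simp only [map_add, LinearMap.add_apply, inner_add_left]; ring
  smul_left u v r := by
    simp only [map_smul, LinearMap.smul_apply, inner_smul_left, conj_trivial, smul_eq_mul]; ring
  definite u h := by
    have h1 : 0 ≤ E.domForm u u := E.nonneg u
    have h2 : 0 ≤ inner ℝ (E.domIncl u) (E.domIncl u) := real_inner_self_nonneg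
    have h3 : inner ℝ (E.domIncl u) (E.domIncl u) = 0 := by linarith
    rw [inner_self_eq_zero] at h3
    exact Subtype.ext h3

instance : NormedAddCommGroup E.FormDom :=
  @InnerProductSpace.Core.toNormedAddCommGroup ℝ E.FormDom _ _ _ E.core

instance : InnerProductSpace ℝ E.FormDom := InnerProductSpace.ofCore E.core.toCore

theorem inner_formDom (u v : E.FormDom) :
    inner ℝ u v = E.domForm u v + inner ℝ (E.domIncl u) (E.domIncl v) := rfl

theorem norm_sq_formDom (u : E.FormDom) :
    ‖u‖ ^ 2 = E.domForm u u + ‖E.domIncl u‖ ^ 2 := by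
  rw [← real_inner_self_eq_norm_sq, inner_formDom, real_inner_self_eq_norm_sq]

/-- Closedness of the form, taken with l = 1, is completeness for this norm. -/
instance : CompleteSpace E.FormDom := by
  refine Metric.complete_of_cauchySeq_tendsto fun u hu => ?_
  have h1 : Tendsto (fun k : ℕ × ℕ => E.domForm (u k.1 - u k.2) (u k.1 - u k.2) +
      1 * ‖E.domIncl (u k.1 - u k.2)‖ ^ 2) atTop (𝓝 0) := by
    have h2 := cauchySeq_iff_tendsto_dist_atTop_0.1 hu
    have h3 := h2.pow 2
    simp only [ne_eq, OfNat.ofNat_ne_zero, not_false_eq_true, zero_pow] at h3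
    refine h3.congr fun k => ?_
    rw [dist_eq_norm, norm_sq_formDom, one_mul]
  obtain ⟨v, hv⟩ : ∃ v : E.FormDom, Tendsto (fun n => E.domForm (u n - v) (u n - v) +
      1 * ‖E.domIncl (u n - v)‖ ^ 2) atTop (𝓝 0) := E.closed 1 one_pos u h1
  refine ⟨v, ?_⟩
  rw [tendsto_iff_norm_sub_tendsto_zero]
  have h4 : Tendsto (fun n => ‖u n - v‖ ^ 2) atTop (𝓝 0) := by
    refine hv.congr fun n => ?_
    rw [norm_sq_formDom, one_mul]
  have h5 := (Real.continuous_sqrt.tendsto 0).comp h4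
  simpa [Function.comp_def, Real.sqrt_sq (norm_nonneg _)] using h5

/-- The continuous inclusion of the form domain in `L²`. -/
def domInclL : E.FormDom →L[ℝ] L2 m :=
  E.domIncl.mkContinuous 1 fun u => by
    rw [one_mul]
    refine abs_le_of_sq_le_sq' ?_ (norm_nonneg _) |>.2
    rw [norm_sq_formDom]
    have : 0 ≤ E.domForm u u := E.nonneg u
    linarith

theorem isCompactOperator_domInclL (hE : E.CompactEmbedding) : IsCompactOperator E.domInclL := by
  refine ⟨_, hE, ?_⟩
  filter_upwards [Metric.closedBall_mem_nhds (0 : E.FormDom) one_pos] with u hu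
  refine subset_closure ⟨u, rfl, ?_⟩
  have h1 := E.norm_sq_formDom u
  have h2 : ‖u‖ ≤ 1 := by simpa using hu
  have h3 : E.domForm u u + ‖E.domIncl u‖ ^ 2 ≤ 1 := by
    rw [← h1]; exact pow_le_one₀ (norm_nonneg _) h2
  exact h3

/-- The resolvent `(A + 1)⁻¹`. -/
def resolvent : L2 m →L[ℝ] L2 m := E.domInclL ∘L ContinuousLinearMap.adjoint E.domInclL

theorem isSymmetric_resolvent : (E.resolvent : L2 m →ₗ[ℝ] L2 m).IsSymmetric := by
  intro x y
  change inner ℝ (E.domInclL (ContinuousLinearMap.adjoint E.domInclL x)) y =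
    inner ℝ x (E.domInclL (ContinuousLinearMap.adjoint E.domInclL y))
  exact (ContinuousLinearMap.adjoint_inner_right E.domInclL _ y).symm.trans
    (ContinuousLinearMap.adjoint_inner_left E.domInclL _ x)

/-- With J the inclusion, J J* h = 0 forces J* h = 0, so h is orthogonal to the dense form domain.
-/
theorem resolvent_injective {h : L2 m} (hh : E.resolvent h = 0) : h = 0 := by
  have h1 : ContinuousLinearMap.adjoint E.domInclL h = 0 := Subtype.ext hh
  have h2 : ∀ v ∈ (E.dom : Set (L2 m)), inner ℝ h v = 0 := by
    intro v hv
    let v' : E.FormDom := Subtype.mk v hv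
    have := ContinuousLinearMap.adjoint_inner_left E.domInclL v' h
    rw [h1, inner_zero_left] at this
    exact this.symm
  exact E.dense_dom.eq_zero_of_inner_left ℝ h2

/-- J* h is the Riesz representative: E(J* h, v) + (J* h, v) = (h, v). Dividing by μ gives the form
of h. -/
theorem isOp_of_resolvent {h : L2 m} {μ : ℝ} (hμ : μ ≠ 0) (hh : E.resolvent h = μ • h) :
    E.IsOp h ((μ⁻¹ - 1) • h) := by
  set g : E.FormDom := μ⁻¹ • ContinuousLinearMap.adjoint E.domInclL h with hg
  have hgh : E.domIncl g = h := by
    rw [hg, map_smul]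
    change μ⁻¹ • E.resolvent h = h
    rw [hh, smul_smul, inv_mul_cancel₀ hμ, one_smul]
  have hmem : h ∈ E.dom := by rw [← hgh]; exact g.2
  refine ⟨hmem, fun v' => ?_⟩
  let v : E.FormDom := v'
  have hgeq : (⟨h, hmem⟩ : E.FormDom) = g := Subtype.ext hgh.symm
  have h1 := ContinuousLinearMap.adjoint_inner_left E.domInclL v h
  have h2 : inner ℝ g v = μ⁻¹ * inner ℝ h (E.domIncl v) := by
    rw [hg, inner_smul_left, h1]; rfl
  rw [inner_formDom, hgh] at h2
  change E.domForm ⟨h, hmem⟩ v = inner ℝ _ (E.domIncl v)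
  rw [hgeq, inner_smul_left, conj_trivial, sub_mul, one_mul]
  linarith

/-- Eigenvectors of the resolvent for μ are eigenvectors of A for 1/μ - 1. Only finitely many of
these values are at most 1, so there is a positive lower bound; separability makes the index set
countable. -/
theorem exists_eigenBasis [TopologicalSpace.SeparableSpace (L2 m)] (hE : E.CompactEmbedding)
    (hpos : E.PosEigenvalues) : ∃ N : Set ℕ, Nonempty (EigenBasis E N) := by
  obtain ⟨κ, b, μ, hb⟩ := exists_hilbertBasis_eigenvectors (R := E.resolvent)
    ((E.isCompactOperator_domInclL hE).comp_clm (ContinuousLinearMap.adjoint E.domInclL)) E.isSymmetric_resolvent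
  have hne : ∀ i, b i ≠ 0 := fun i => b.orthonormal.ne_zero i
  have hμ : ∀ i, μ i ≠ 0 := fun i h0 => hne i (E.resolvent_injective (by rw [hb i, h0, zero_smul]))
  have hop : ∀ i, E.IsOp (b i) (((μ i)⁻¹ - 1) • b i) := fun i => E.isOp_of_resolvent (hμ i) (hb i)
  have hlam : ∀ i, 0 < (μ i)⁻¹ - 1 := fun i => hpos _ _ (hne i) (hop i)
  have hfin : {i | (μ i)⁻¹ - 1 ≤ 1}.Finite := by
    -- An eigenvector with eigenvalue at most 1 has squared form norm at most 2, so it lies in √2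
    -- times the compact set.
    have hK := hE.smul (Real.sqrt 2)
    refine finite_of_orthonormal_of_isCompact b.orthonormal hK fun i hi => ?_
    obtain ⟨hd, hf⟩ := hop i
    refine ⟨(Real.sqrt 2)⁻¹ • b i, subset_closure ⟨(Real.sqrt 2)⁻¹ • ⟨b i, hd⟩, rfl, ?_⟩, ?_⟩
    · have h1 := hf ⟨b i, hd⟩
      have h2 : (Real.sqrt 2)⁻¹ * (Real.sqrt 2)⁻¹ = 2⁻¹ := by
        rw [← mul_inv, Real.mul_self_sqrt (by norm_num)]
      rw [map_smul, map_smul, LinearMap.smul_apply, h1, inner_smul_left,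
        real_inner_self_eq_norm_sq, b.orthonormal.1 i, Submodule.coe_smul, norm_smul,
        b.orthonormal.1 i]
      simp only [conj_trivial, smul_eq_mul, norm_inv, mul_one, one_pow, ← mul_assoc, h2]
      rw [Real.norm_of_nonneg (Real.sqrt_nonneg _), sq, h2]
      have : (μ i)⁻¹ - 1 ≤ 1 := hi
      linarith
    · simp only
      rw [smul_smul, mul_inv_cancel₀ (by positivity), one_smul]
  have hlow : ∃ c : ℝ, 0 < c ∧ ∀ i, c ≤ (μ i)⁻¹ - 1 := by
    rcases eq_empty_or_nonempty {i | (μ i)⁻¹ - 1 ≤ 1} with he | hne'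
    · refine ⟨1, one_pos, fun i => ?_⟩
      by_contra! h
      have : i ∈ {i | (μ i)⁻¹ - 1 ≤ 1} := h.le
      rw [he] at this
      exact this
    · obtain ⟨i₀, hi₀, hmin⟩ := hfin.exists_minimalFor (fun i => (μ i)⁻¹ - 1) _ hne'
      refine ⟨(μ i₀)⁻¹ - 1, hlam i₀, fun i => ?_⟩
      by_contra! h
      have hi₀' : (μ i₀)⁻¹ - 1 ≤ 1 := hi₀
      have hi : i ∈ {i | (μ i)⁻¹ - 1 ≤ 1} := (h.le.trans hi₀')
      exact absurd (hmin hi h.le) (not_le.2 h)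
  have : Countable κ := countable_of_orthonormal b.orthonormal
  obtain ⟨f, hf⟩ := exists_injective_nat κ
  let e : κ ≃ Set.range f := Equiv.ofInjective f hf
  have hon : Orthonormal ℝ fun n : Set.range f => b (e.symm n) :=
    b.orthonormal.comp _ e.symm.injective
  have hrange : Set.range (fun n : Set.range f => b (e.symm n)) = Set.range b :=
    e.symm.surjective.range_comp b
  have hsp : ⊤ ≤ (Submodule.span ℝ (Set.range fun n : Set.range f =>
      b (e.symm n))).topologicalClosure := by
    rw [hrange, b.dense_span]
  refine ⟨Set.range f, ⟨⟨HilbertBasis.mk hon hsp, fun n => (μ (e.symm n))⁻¹ - 1,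
    fun n => ?_, ?_⟩⟩⟩
  · rw [HilbertBasis.coe_mk]
    exact hop _
  · obtain ⟨c, hc, h⟩ := hlow
    exact ⟨c, hc, fun n => h _⟩

end DirichletForm

end FormDomain

/-! ### The domain of A and the form domain in spectral terms. -/

section FormDomainSpectral

variable {X : Type*} [MeasurableSpace X] {m : Measure X} {E : DirichletForm m}

theorem DirichletForm.inner_resolvent_adjoint (k : L2 m) (v : E.FormDom) :
    E.domForm (ContinuousLinearMap.adjoint E.domInclL k) v +
      inner ℝ (E.resolvent k) (E.domIncl v) = inner ℝ k (E.domIncl v) :=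
  ContinuousLinearMap.adjoint_inner_left E.domInclL v k

/-- With the converse `DirichletForm.isOp_of_resolvent_add`, the graph of A becomes an equation for
a bounded operator, which can be tested on coordinates. -/
theorem DirichletForm.resolvent_of_isOp {h a : L2 m} (ha : E.IsOp h a) :
    E.resolvent (a + h) = h := by
  obtain ⟨hd, hf⟩ := ha
  let h' : E.FormDom := Subtype.mk h hd
  have h1 : ContinuousLinearMap.adjoint E.domInclL (a + h) = h' := by
    refine ext_inner_right ℝ fun v => ?_
    rw [ContinuousLinearMap.adjoint_inner_left, DirichletForm.inner_formDom, inner_add_left]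
    congr 1
    exact (hf v).symm
  change E.domInclL (ContinuousLinearMap.adjoint E.domInclL (a + h)) = h
  rw [h1]
  rfl

theorem DirichletForm.isOp_of_resolvent_add {h a : L2 m} (hh : E.resolvent (a + h) = h) :
    E.IsOp h a := by
  have hmem : h ∈ E.dom := by
    rw [← hh]; exact (ContinuousLinearMap.adjoint E.domInclL (a + h)).2
  refine ⟨hmem, fun v' => ?_⟩
  let v : E.FormDom := v'
  have h1 := E.inner_resolvent_adjoint (a + h) v
  have h2 : ContinuousLinearMap.adjoint E.domInclL (a + h) = (Subtype.mk h hmem : E.dom) :=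
    Subtype.ext hh
  rw [h2, hh, inner_add_left] at h1
  exact add_right_cancel h1

namespace EigenBasis

variable {ι : Type*} (B : EigenBasis E ι)

theorem resolvent_basis (i : ι) : E.resolvent (B.φ i) = (1 + B.lam i)⁻¹ • B.φ i := by
  have h1 := DirichletForm.resolvent_of_isOp (B.isOp i)
  have h2 : B.lam i • B.φ i + B.φ i = (1 + B.lam i) • B.φ i := by module
  have h3 : 1 + B.lam i ≠ 0 := by linarith [B.lam_pos i]
  rw [h2, map_smul] at h1
  nth_rewrite 2 [← h1]
  rw [smul_smul, inv_mul_cancel₀ h3, one_smul]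

/-- A vector with `λ_i (h, φ_i) = (a, φ_i)` is in the domain of `A` and `A h = a`. -/
theorem isOp_of_inner {h a : L2 m}
    (H : ∀ i, inner ℝ (B.φ i) a = B.lam i * inner ℝ (B.φ i) h) : E.IsOp h a := by
  refine DirichletForm.isOp_of_resolvent_add (ext_inner_basis B.φ fun i => ?_)
  have h1 := E.isSymmetric_resolvent (B.φ i) (a + h)
  have h3 : 1 + B.lam i ≠ 0 := by linarith [B.lam_pos i]
  simp only [ContinuousLinearMap.coe_coe] at h1
  rw [← h1, B.resolvent_basis, inner_smul_left, inner_add_right, H]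
  simp only [conj_trivial]
  field_simp
  ring

/-- The eigenvectors as elements of the form domain. -/
def basisDom (i : ι) : E.FormDom := Subtype.mk (B.φ i) (B.isOp i).choose

theorem domIncl_basisDom (i : ι) : E.domIncl (B.basisDom i) = B.φ i := rfl

theorem inner_basisDom (i : ι) (v : E.FormDom) :
    inner ℝ (B.basisDom i) v = (1 + B.lam i) * inner ℝ (B.φ i) (E.domIncl v) := by
  have h1 : E.domForm (B.basisDom i) v = inner ℝ (B.lam i • B.φ i) (E.domIncl v) :=
    (B.isOp i).choose_spec v
  rw [DirichletForm.inner_formDom, h1, domIncl_basisDom, inner_smul_left]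
  simp only [conj_trivial]
  ring

theorem orthonormal_basisDom :
    Orthonormal ℝ fun i => (Real.sqrt (1 + B.lam i))⁻¹ • B.basisDom i := by
  classical
  rw [orthonormal_iff_ite]
  intro i j
  have hi : 0 < 1 + B.lam i := by linarith [B.lam_pos i]
  rw [inner_smul_left, inner_smul_right, inner_basisDom, domIncl_basisDom,
    orthonormal_iff_ite.1 B.φ.orthonormal i j]
  split_ifs with hij
  · subst hij
    simp only [conj_trivial, mul_one]
    rw [← mul_assoc, ← mul_inv, Real.mul_self_sqrt hi.le, inv_mul_cancel₀ hi.ne']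
  · simp

/-- The vectors φ_i/√(1+λ_i) are orthonormal in the form domain, which is complete; the expansion of
h therefore converges there, and its image in L² is h. -/
theorem mem_dom_of_summable {h : L2 m}
    (hh : Summable fun i => (1 + B.lam i) * (inner ℝ (B.φ i) h) ^ 2) : h ∈ E.dom := by
  have hpos : ∀ i, 0 < 1 + B.lam i := fun i => by linarith [B.lam_pos i]
  have h1 : Summable fun i => LinearIsometry.toSpanSingleton ℝ E.FormDom
      (B.orthonormal_basisDom.1 i) (Real.sqrt (1 + B.lam i) * inner ℝ (B.φ i) h) := by
    rw [B.orthonormal_basisDom.orthogonalFamily.summable_iff_norm_sq_summable]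
    refine hh.congr fun i => ?_
    rw [Real.norm_eq_abs, sq_abs, mul_pow, Real.sq_sqrt (hpos i).le]
  have h2 : Summable fun i => inner ℝ (B.φ i) h • B.basisDom i := by
    refine h1.congr fun i => ?_
    rw [LinearIsometry.toSpanSingleton_apply, smul_smul, mul_comm, ← mul_assoc,
      inv_mul_cancel₀ (Real.sqrt_pos.2 (hpos i)).ne', one_mul]
  have h3 : HasSum (fun i => inner ℝ (B.φ i) h • B.φ i)
      (E.domInclL (∑' i, inner ℝ (B.φ i) h • B.basisDom i)) := by
    convert h2.hasSum.mapL E.domInclL using 2 with i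
    rw [map_smul]
    rfl
  have h4 : HasSum (fun i => inner ℝ (B.φ i) h • B.φ i) h := by
    simpa [HilbertBasis.repr_apply_apply] using B.φ.hasSum_repr h
  have h5 : h = E.domInclL (∑' i, inner ℝ (B.φ i) h • B.basisDom i) := h4.unique h3
  rw [h5]
  exact Subtype.property (p := (· ∈ E.dom)) _

/-- `V_s` is contained in the form domain for `s ≥ 1/2`. -/
theorem V_mem_dom {s : ℝ} (hs : 1 / 2 ≤ s) (h : B.V s) : (h : L2 m) ∈ E.dom := by
  obtain ⟨c, hc, hl⟩ := B.lower
  refine B.mem_dom_of_summable (Summable.of_nonneg_of_le (fun i => ?_) (fun i => ?_)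
    ((B.hasSum_norm_sq s h).summable.mul_left ((1 + c⁻¹) * c ^ (1 - 2 * s))))
  · have := B.lam_pos i
    positivity
  · have hp := B.lam_pos i
    have h1 : 1 + B.lam i ≤ (1 + c⁻¹) * B.lam i := by
      have : 1 ≤ c⁻¹ * B.lam i := by
        rw [← inv_mul_cancel₀ hc.ne']
        gcongr
        exact hl i
      linarith
    have h2 : B.lam i ≤ c ^ (1 - 2 * s) * (B.lam i ^ s) ^ 2 := by
      have h3 : B.lam i ^ (1 - 2 * s) ≤ c ^ (1 - 2 * s) :=
        Real.rpow_le_rpow_of_nonpos hc (hl i) (by linarith)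
      calc B.lam i = B.lam i ^ (1 - 2 * s) * (B.lam i ^ s) ^ 2 := by
            rw [← Real.rpow_natCast, ← Real.rpow_mul hp.le, ← Real.rpow_add hp]
            norm_num
            rw [show 1 - 2 * s + s * 2 = 1 by ring, Real.rpow_one]
        _ ≤ _ := by gcongr
    rw [mul_pow, ← mul_assoc]
    gcongr
    calc 1 + B.lam i ≤ (1 + c⁻¹) * B.lam i := h1
      _ ≤ (1 + c⁻¹) * (c ^ (1 - 2 * s) * (B.lam i ^ s) ^ 2) := by gcongr
      _ = _ := by ring

/-- `E(u, φ_i) = λ_i (u, φ_i)` on the form domain. -/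
theorem form_basis {u : L2 m} (hu : u ∈ E.dom) (i : ι) (hi : B.φ i ∈ E.dom) :
    E.form ⟨u, hu⟩ ⟨B.φ i, hi⟩ = B.lam i * inner ℝ (B.φ i) u := by
  rw [E.symm]
  obtain ⟨hd, hf⟩ := B.isOp i
  rw [hf ⟨u, hu⟩, inner_smul_left]
  rfl

end EigenBasis

end FormDomainSpectral

/-! ### Weak derivatives and W^{1,q} functions of time. -/

section WeakDerivative

variable {H : Type*} [NormedAddCommGroup H] [NormedSpace ℝ H]

/-- A test function on `(0, T)` with vanishing integral is the derivative of a test function. -/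
theorem exists_deriv_eq_of_integral_eq_zero {T : ℝ} {ζ : ℝ → ℝ} (hζ : ContDiff ℝ ∞ ζ)
    (hc : HasCompactSupport ζ) (hs : tsupport ζ ⊆ Ioo 0 T) (h0 : ∫ t in (0 : ℝ)..T, ζ t = 0) :
    ∃ ψ : ℝ → ℝ, ContDiff ℝ ∞ ψ ∧ HasCompactSupport ψ ∧ tsupport ψ ⊆ Ioo 0 T ∧ deriv ψ = ζ := by
  rcases (tsupport ζ).eq_empty_or_nonempty with he | hne
  · have hz : ζ = 0 := tsupport_eq_empty_iff.1 he
    refine ⟨0, contDiff_const, HasCompactSupport.zero, ?_, ?_⟩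
    · rw [hz] at hs; exact hs
    · rw [hz]; ext t; simp
  have hcont := hζ.continuous
  obtain ⟨a, ha⟩ := hc.isCompact.exists_isLeast hne
  obtain ⟨b, hb⟩ := hc.isCompact.exists_isGreatest hne
  have ha0 := hs ha.1
  have hb0 := hs hb.1
  have hza : ∀ t < a, ζ t = 0 := fun t ht => by
    by_contra h
    exact absurd (ha.2 (subset_tsupport ζ h)) (not_le.2 ht)
  have hzb : ∀ t, b < t → ζ t = 0 := fun t ht => by
    by_contra h
    exact absurd (hb.2 (subset_tsupport ζ h)) (not_le.2 ht)
  have hd : deriv (fun t => ∫ s in (0 : ℝ)..t, ζ s) = ζ := by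
    ext t; exact hcont.deriv_integral _ _ _
  -- With a and b the extreme points of the support of ζ, the primitive vanishes before a trivially
  -- and after b because the total integral is zero.
  have hsup : Function.support (fun t => ∫ s in (0 : ℝ)..t, ζ s) ⊆ Icc a b := by
    intro t ht
    by_contra hmem
    refine ht ?_
    rw [mem_Icc, not_and_or, not_le, not_le] at hmem
    rcases hmem with h | h
    · refine intervalIntegral.integral_zero_ae (Eventually.of_forall fun s hs' => hza s ?_)
      exact hs'.2.trans_lt (max_lt ha0.1 h)
    · have h1 := intervalIntegral.integral_add_adjacent_intervals
        (hcont.intervalIntegrable 0 t) (hcont.intervalIntegrable (μ := volume) t T)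
      have h2 : ∫ s in t..T, ζ s = 0 :=
        intervalIntegral.integral_zero_ae (Eventually.of_forall fun s hs' => hzb s
          ((lt_min h hb0.2).trans hs'.1))
      simp only
      linarith
  have hts : tsupport (fun t => ∫ s in (0 : ℝ)..t, ζ s) ⊆ Icc a b :=
    closure_minimal hsup isClosed_Icc
  refine ⟨_, ?_, HasCompactSupport.of_support_subset_isCompact isCompact_Icc hsup,
    hts.trans (Icc_subset_Ioo ha0.1 hb0.2), hd⟩
  rw [contDiff_infty_iff_deriv, hd]
  exact ⟨fun t => (hcont.integral_hasStrictDerivAt 0 t).hasDerivAt.differentiableAt, hζ⟩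

theorem integral_deriv_eq_neg {T : ℝ} {ψ : ℝ → ℝ} (hψ : ContDiff ℝ ∞ ψ)
    (hs : tsupport ψ ⊆ Ioo 0 T) (s : ℝ) :
    ∫ t in s..T, deriv ψ t = - ψ s := by
  rw [intervalIntegral.integral_deriv_eq_sub
    (fun x _ => (hψ.differentiable (by simp)).differentiableAt)
    ((hψ.continuous_deriv (by simp)).intervalIntegrable _ _)]
  have : ψ T = 0 := by
    by_contra h
    exact lt_irrefl _ (hs (subset_tsupport ψ h)).2
  rw [this, zero_sub]

/-- Fubini on s < t: the inner integral of ψ' from s to T is -ψ(s), and the constant is killed by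
∫ψ' = 0. -/
theorem isWeakDeriv_const_add_integral [CompleteSpace H] {T : ℝ} {F g : ℝ → H} {c : H}
    (hg : IntegrableOn g (Ioo 0 T)) (hF : ∀ t ∈ Ioo 0 T, F t = c + ∫ s in (0 : ℝ)..t, g s) :
    IsWeakDeriv T F g := by
  intro ψ hψ hc hs
  rcases le_or_gt T 0 with hT | hT
  · simp [Ioo_eq_empty_of_le hT]
  have hdc : Continuous (deriv ψ) := hψ.continuous_deriv (by simp)
  have hdi : IntegrableOn (deriv ψ) (Ioo 0 T) :=
    (hdc.integrableOn_Icc (a := 0) (b := T)).mono_set Ioo_subset_Icc_self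
  have hgi : ∀ t ∈ Ioo 0 T, ∫ s in (0 : ℝ)..t, g s
      = ∫ s in Ioo 0 T, (Iio t).indicator g s := fun t ht => by
    rw [intervalIntegral.integral_of_le ht.1.le, integral_Ioc_eq_integral_Ioo,
      setIntegral_indicator measurableSet_Iio]
    congr 2
    ext s
    simp only [mem_Ioo, mem_inter_iff, mem_Iio]
    constructor
    · rintro ⟨h1, h2⟩; exact ⟨⟨h1, h2.trans ht.2⟩, h2⟩
    · rintro ⟨⟨h1, _⟩, h2⟩; exact ⟨h1, h2⟩
  have hprod : Integrable (Function.uncurry fun t s => deriv ψ t • (Iio t).indicator g s)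
      ((volume.restrict (Ioo 0 T)).prod (volume.restrict (Ioo 0 T))) := by
    have h1 := (hdi.smul_prod hg).indicator
      (measurableSet_lt measurable_snd (measurable_fst (α := ℝ) (β := ℝ)))
    refine h1.congr (Eventually.of_forall fun z => ?_)
    simp only [Function.uncurry, indicator, mem_ofPred_eq, mem_Iio]
    split_ifs <;> simp
  have hswap := integral_integral_swap hprod
  have hin : Integrable (fun t => ∫ s in Ioo 0 T, deriv ψ t • (Iio t).indicator g s)
      (volume.restrict (Ioo 0 T)) := hprod.integral_prod_left
  have hc0 : ∫ t in Ioo 0 T, deriv ψ t = 0 := by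
    rw [← integral_Ioc_eq_integral_Ioo, ← intervalIntegral.integral_of_le hT.le,
      integral_deriv_eq_neg hψ hs, neg_eq_zero]
    by_contra h
    exact lt_irrefl _ (hs (subset_tsupport ψ h)).1
  calc ∫ t in Ioo 0 T, deriv ψ t • F t
      = ∫ t in Ioo 0 T, (deriv ψ t • c
          + ∫ s in Ioo 0 T, deriv ψ t • (Iio t).indicator g s) := by
        refine setIntegral_congr_fun measurableSet_Ioo fun t ht => ?_
        rw [hF t ht, smul_add, hgi t ht, integral_smul]
    _ = ∫ t in Ioo 0 T, ∫ s in Ioo 0 T, deriv ψ t • (Iio t).indicator g s := by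
        rw [integral_add (hdi.smul_const c) hin, integral_smul_const, hc0,
          zero_smul, zero_add]
    _ = ∫ s in Ioo 0 T, ∫ t in Ioo 0 T, deriv ψ t • (Iio t).indicator g s := hswap
    _ = ∫ s in Ioo 0 T, - (ψ s • g s) := by
        refine setIntegral_congr_fun measurableSet_Ioo fun s hs' => ?_
        have h1 : ∀ t, deriv ψ t • (Iio t).indicator g s
            = (Ioi s).indicator (fun t => deriv ψ t • g s) t := fun t => by
          simp only [indicator, mem_Iio, mem_Ioi]
          split_ifs <;> simp
        simp only [h1]
        rw [setIntegral_indicator measurableSet_Ioi]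
        have h2 : Ioo 0 T ∩ Ioi s = Ioo s T := by
          ext t
          simp only [mem_Ioo, mem_inter_iff, mem_Ioi]
          constructor
          · rintro ⟨⟨_, h1⟩, h2⟩; exact ⟨h2, h1⟩
          · rintro ⟨h1, h2⟩; exact ⟨⟨hs'.1.trans h1, h2⟩, h1⟩
        rw [h2, integral_smul_const, ← integral_Ioc_eq_integral_Ioo,
          ← intervalIntegral.integral_of_le hs'.2.le,
          integral_deriv_eq_neg hψ hs, neg_smul]
    _ = _ := integral_neg _

/-- A continuous function with vanishing weak derivative is constant. -/
theorem eqOn_const_of_weakDeriv_zero [CompleteSpace H] {T : ℝ} (hT : 0 < T) {h : ℝ → H}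
    (hh : ContinuousOn h (Icc 0 T))
    (hw : ∀ ψ : ℝ → ℝ, ContDiff ℝ ∞ ψ → HasCompactSupport ψ → tsupport ψ ⊆ Ioo 0 T →
      ∫ t in Ioo 0 T, deriv ψ t • h t = 0) : EqOn h (fun _ => h 0) (Icc 0 T) := by
  have hmid : Ioo 0 T ∈ 𝓝 (T / 2) := Ioo_mem_nhds (by linarith) (by linarith)
  -- The constant is the average of h against the bump ρ. Subtracting a multiple of ρ gives any test
  -- function mean zero, hence makes it a derivative of a test function; so h minus the average
  -- annihilates all test functions.
  obtain ⟨ρ, hρs, hρc, hρ, hρr, hρ1⟩ := exists_contDiff_tsupport_subset (n := ⊤) hmid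
  have hρ0 : 0 < ∫ t in (0 : ℝ)..T, ρ t := by
    refine intervalIntegral.integral_pos hT hρ.continuous.continuousOn
      (fun t _ => (hρr ⟨t, rfl⟩).1) ⟨T / 2, ⟨by linarith, by linarith⟩, by rw [hρ1]; exact one_pos⟩
  have hhi : IntegrableOn h (Ioo 0 T) := (hh.integrableOn_Icc).mono_set Ioo_subset_Icc_self
  set c : H := (∫ t in (0 : ℝ)..T, ρ t)⁻¹ • ∫ t in Ioo 0 T, ρ t • h t with hcdef
  have hsm : ∀ η : ℝ → ℝ, Continuous η → IntegrableOn (fun t => η t • h t) (Ioo 0 T) :=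
    fun η hη => ((hη.continuousOn.smul hh).integrableOn_Icc).mono_set Ioo_subset_Icc_self
  have key : ∀ η : ℝ → ℝ, ContDiff ℝ ∞ η → HasCompactSupport η → tsupport η ⊆ Ioo 0 T →
      ∫ t in Ioo 0 T, η t • (h t - c) = 0 := by
    intro η hη hηc hηs
    set r : ℝ := (∫ t in (0 : ℝ)..T, η t) * (∫ t in (0 : ℝ)..T, ρ t)⁻¹ with hr
    have hζ : ContDiff ℝ ∞ fun t => η t - r * ρ t := hη.sub (contDiff_const.mul hρ)
    have hts : tsupport (fun t => η t - r * ρ t) ⊆ tsupport η ∪ tsupport ρ := by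
      refine closure_minimal (fun t ht => ?_) ((isClosed_tsupport _).union (isClosed_tsupport _))
      by_contra hn
      rw [mem_union, not_or] at hn
      refine ht ?_
      simp only [image_eq_zero_of_notMem_tsupport hn.1, image_eq_zero_of_notMem_tsupport hn.2]
      ring
    obtain ⟨ψ, h1, h2, h3, h4⟩ := exists_deriv_eq_of_integral_eq_zero hζ
      (hηc.isCompact.union hρc.isCompact |>.of_isClosed_subset (isClosed_tsupport _) hts)
      (hts.trans (union_subset hηs hρs)) (by
        rw [intervalIntegral.integral_sub (hη.continuous.intervalIntegrable _ _)
          ((hρ.continuous.intervalIntegrable _ _).const_mul r),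
          intervalIntegral.integral_const_mul, hr, mul_assoc, inv_mul_cancel₀ hρ0.ne', mul_one,
          sub_self])
    have h5 := hw ψ h1 h2 h3
    rw [h4] at h5
    simp only [sub_smul, mul_smul] at h5
    have h6 : IntegrableOn (fun t => r • ρ t • h t) (Ioo 0 T) := (hsm ρ hρ.continuous).smul r
    rw [integral_sub (hsm η hη.continuous) h6, integral_smul,
      sub_eq_zero] at h5
    simp only [smul_sub]
    rw [integral_sub (hsm η hη.continuous) (((hη.continuous.integrableOn_Icc (a := 0) (b := T)
      (μ := volume)).mono_set Ioo_subset_Icc_self).smul_const c), integral_smul_const, h5, hcdef, hr,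
      ← integral_Ioc_eq_integral_Ioo (f := η), ← intervalIntegral.integral_of_le hT.le, mul_smul,
      sub_self]
  have hae := IsOpen.ae_eq_zero_of_integral_contDiff_smul_eq_zero (μ := volume.restrict (Ioo 0 T))
    (f := fun t => h t - c) isOpen_Ioo
    ((hhi.sub (integrable_const c)).locallyIntegrable.locallyIntegrableOn _) key
  have hae' : h =ᵐ[volume.restrict (Icc 0 T)] fun _ => c := by
    rw [restrict_Ioo_eq_restrict_Icc] at hae
    have h6 : ∀ᵐ t ∂(volume.restrict (Icc 0 T)), t ∈ Ioo 0 T := by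
      rw [← restrict_Ioo_eq_restrict_Icc]
      exact ae_restrict_mem measurableSet_Ioo
    filter_upwards [hae, h6] with t ht ht'
    exact sub_eq_zero.1 (ht ht')
  have heq := Measure.eqOn_Icc_of_ae_eq volume hT.ne hae' hh continuousOn_const
  intro t ht
  rw [heq ht, heq (left_mem_Icc.2 hT.le)]

theorem IsW1.integrableOn_deriv {q : ℝ≥0∞} (hq : 1 ≤ q) {T : ℝ} {f f' : ℝ → H}
    (hf : IsW1 q T f f') : IntegrableOn f' (Ioo 0 T) := hf.memLp_deriv.integrable hq

theorem continuousOn_integral_of_integrableOn {T : ℝ} (hT : 0 ≤ T) {g : ℝ → H}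
    (hg : IntegrableOn g (Ioo 0 T)) :
    ContinuousOn (fun t => ∫ s in (0 : ℝ)..t, g s) (Icc 0 T) := by
  rw [← uIcc_of_le hT]
  refine intervalIntegral.continuousOn_primitive_interval ?_
  rw [uIcc_of_le hT]
  exact (integrableOn_Icc_iff_integrableOn_Ioo).2 hg

/-- The fundamental theorem of calculus in `W^{1,q}((0,T);H)`. -/
theorem IsW1.eq_add_integral [CompleteSpace H] {q : ℝ≥0∞} (hq : 1 ≤ q) {T : ℝ} (hT : 0 < T)
    {f f' : ℝ → H} (hf : IsW1 q T f f') (hc : ContinuousOn f (Icc 0 T)) {t : ℝ}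
    (ht : t ∈ Icc 0 T) : f t = f 0 + ∫ s in (0 : ℝ)..t, f' s := by
  have hi := hf.integrableOn_deriv hq
  have hFc := continuousOn_integral_of_integrableOn hT.le hi
  have hw : IsWeakDeriv T (fun t => ∫ s in (0 : ℝ)..t, f' s) f' :=
    isWeakDeriv_const_add_integral (c := 0) hi fun t _ => by rw [zero_add]
  have h1 := eqOn_const_of_weakDeriv_zero hT (h := fun t => f t - ∫ s in (0 : ℝ)..t, f' s)
    (hc.sub hFc) fun ψ h1 h2 h3 => by
    have h4 : ∀ F : ℝ → H, ContinuousOn F (Icc 0 T) →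
        IntegrableOn (fun t => deriv ψ t • F t) (Ioo 0 T) := fun F hF =>
      ((((h1.continuous_deriv (by simp)).continuousOn).smul hF).integrableOn_Icc).mono_set
        Ioo_subset_Icc_self
    simp only [smul_sub]
    rw [integral_sub (h4 _ hc) (h4 _ hFc), hf.weak ψ h1 h2 h3, hw ψ h1 h2 h3, sub_self]
  have h2 := h1 ht
  simp only [intervalIntegral.integral_same, sub_zero] at h2
  rw [← h2]
  abel

theorem one_le_of_inv_add_inv {p : ℝ} {q : ℝ≥0∞} (hpq : (ENNReal.ofReal p)⁻¹ + q⁻¹ = 1) :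
    1 ≤ q := by
  rw [← ENNReal.inv_le_one, ← hpq]
  exact le_add_self

/-- Hölder's inequality in time. -/
theorem IsW1.integral_norm_deriv_le {p : ℝ} (hp : 1 ≤ p) {q : ℝ≥0∞}
    (hpq : (ENNReal.ofReal p)⁻¹ + q⁻¹ = 1) {T : ℝ} {f f' : ℝ → H} (hf : IsW1 q T f f')
    {t : ℝ} (ht : t ∈ Icc 0 T) :
    ∫ s in (0 : ℝ)..t, ‖f' s‖ ≤ t ^ (1 / p) * lqNorm q T f' := by
  have hq := one_le_of_inv_add_inv hpq
  have hsub : Ioo 0 t ⊆ Ioo 0 T := Ioo_subset_Ioo_right ht.2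
  have hm : MemLp f' q (volume.restrict (Ioo 0 t)) := hf.memLp_deriv.mono_measure
    (Measure.restrict_mono hsub le_rfl)
  have h1 := eLpNorm_le_eLpNorm_mul_rpow_measure_univ (p := 1) hq hm.1
  -- When q = ∞ both q⁻¹ and 1 / `q.toReal` are 0, the latter by the convention for division by
  -- zero, so the exponent is right there too.
  have h2 : (1 : ℝ) / (1 : ℝ≥0∞).toReal - 1 / q.toReal = 1 / p := by
    have h3 := congrArg ENNReal.toReal hpq
    have hpne : (ENNReal.ofReal p)⁻¹ ≠ ⊤ := by
      rw [ne_eq, ENNReal.inv_eq_top, ENNReal.ofReal_eq_zero]; linarith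
    have hqne : q⁻¹ ≠ ⊤ := by
      rw [ne_eq, ENNReal.inv_eq_top]; rintro rfl; simp at hq
    rw [ENNReal.toReal_add hpne hqne, ENNReal.toReal_inv, ENNReal.toReal_inv,
      ENNReal.toReal_ofReal (by linarith)] at h3
    simp only [ENNReal.toReal_one, one_div] at h3 ⊢
    linarith
  rw [h2] at h1
  have h4 : eLpNorm f' q (volume.restrict (Ioo 0 t)) ≤ eLpNorm f' q (volume.restrict (Ioo 0 T)) :=
    eLpNorm_mono_measure _ (Measure.restrict_mono hsub le_rfl)
  rw [intervalIntegral.integral_of_le ht.1, integral_Ioc_eq_integral_Ioo,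
    integral_norm_eq_lintegral_enorm hm.1, ← eLpNorm_one_eq_lintegral_enorm]
  have h5 := ENNReal.toReal_mono (ENNReal.mul_ne_top hf.memLp_deriv.2.ne (by
    rw [Measure.restrict_apply_univ, Real.volume_Ioo]
    exact ENNReal.rpow_ne_top_of_nonneg (by positivity) ENNReal.ofReal_ne_top))
    (h1.trans (mul_le_mul_left h4 _))
  refine h5.trans (le_of_eq ?_)
  rw [ENNReal.toReal_mul, Measure.restrict_apply_univ, Real.volume_Ioo, sub_zero,
    ← ENNReal.toReal_rpow, ENNReal.toReal_ofReal ht.1, mul_comm]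
  rfl

end WeakDerivative

/-! ### Convolution with operator-valued kernels. -/

section OperatorConvolution

variable {H : Type*} [NormedAddCommGroup H] [NormedSpace ℝ H]

/-- The convolution `∫₀ᵗ K(t - τ) g(τ) dτ` with an operator-valued kernel. -/
def opConv (K : ℝ → H → H) (g : ℝ → H) (t : ℝ) : H := ∫ τ in (0 : ℝ)..t, K (t - τ) (g τ)

variable {K : ℝ → H → H} {g : ℝ → H} {T C t : ℝ}

theorem integrableOn_opConv {H : Type*} [NormedAddCommGroup H] {K : ℝ → H → H} {g : ℝ → H}
    (hK : Continuous fun p : ℝ × H => K p.1 p.2)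
    (hC : ∀ s ∈ Icc 0 T, ∀ h, ‖K s h‖ ≤ C * ‖h‖) (hg : IntegrableOn g (Ioc 0 T))
    (ht : t ∈ Icc 0 T) : IntegrableOn (fun τ => K (t - τ) (g τ)) (Ioc 0 t) := by
  have hg' : IntegrableOn g (Ioc 0 t) := hg.mono_set (Ioc_subset_Ioc_right ht.2)
  refine Integrable.mono' (hg'.norm.const_mul C) ?_ ?_
  · exact hK.comp_aestronglyMeasurable
      ((continuous_const.sub continuous_id).aestronglyMeasurable.prodMk hg'.aestronglyMeasurable)
  · refine (ae_restrict_mem measurableSet_Ioc).mono fun τ hτ => hC _ ⟨?_, ?_⟩ _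
    · linarith [hτ.2]
    · linarith [hτ.1, ht.2]

theorem norm_opConv_le (hC : ∀ s ∈ Icc 0 T, ∀ h, ‖K s h‖ ≤ C * ‖h‖)
    (hg : IntegrableOn g (Ioc 0 T)) (ht : t ∈ Icc 0 T) :
    ‖opConv K g t‖ ≤ C * ∫ τ in (0 : ℝ)..t, ‖g τ‖ := by
  have hg' : IntervalIntegrable g volume 0 t :=
    (intervalIntegrable_iff_integrableOn_Ioc_of_le ht.1).2
      (hg.mono_set (Ioc_subset_Ioc_right ht.2))
  rw [← intervalIntegral.integral_const_mul]
  refine intervalIntegral.norm_integral_le_of_norm_le ht.1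
    (Eventually.of_forall fun τ hτ => hC _ ⟨?_, ?_⟩ _) (hg'.norm.const_mul C)
  · linarith [hτ.2]
  · linarith [hτ.1, ht.2]

/-- Over the fixed interval (0, T] the upper limit becomes an indicator, and dominated convergence
applies: at a given t₀ the integrand is discontinuous in t only for τ = t₀, a null set. -/
theorem continuousOn_opConv (hK : Continuous fun p : ℝ × H => K p.1 p.2)
    (hC : ∀ s ∈ Icc 0 T, ∀ h, ‖K s h‖ ≤ C * ‖h‖) (hg : IntegrableOn g (Ioc 0 T)) :
    ContinuousOn (opConv K g) (Icc 0 T) := by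
  have h1 : ∀ t ∈ Icc 0 T, opConv K g t =
      ∫ τ in Ioc 0 T, (Iio t).indicator (fun τ => K (t - τ) (g τ)) τ := fun t ht => by
    rw [opConv, intervalIntegral.integral_of_le ht.1, setIntegral_indicator measurableSet_Iio,
      integral_Ioc_eq_integral_Ioo]
    congr 2
    ext τ
    simp only [mem_Ioo, mem_inter_iff, mem_Iio, mem_Ioc]
    constructor
    · rintro ⟨h1, h2⟩; exact ⟨⟨h1, h2.le.trans ht.2⟩, h2⟩
    · rintro ⟨⟨h1, _⟩, h2⟩; exact ⟨h1, h2⟩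
  refine ContinuousOn.congr (fun t₀ _ => ?_) h1
  refine continuousWithinAt_of_dominated (bound := fun τ => |C| * ‖g τ‖) ?_ ?_
    (hg.norm.const_mul _) ?_
  · refine Eventually.of_forall fun t => AEStronglyMeasurable.indicator ?_ measurableSet_Iio
    exact hK.comp_aestronglyMeasurable
      ((continuous_const.sub continuous_id).aestronglyMeasurable.prodMk hg.aestronglyMeasurable)
  · filter_upwards [self_mem_nhdsWithin] with t ht
    refine (ae_restrict_mem measurableSet_Ioc).mono fun τ hτ => ?_
    by_cases h : τ ∈ Iio t
    · rw [indicator_of_mem h]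
      have h' : τ < t := h
      refine (hC _ ⟨by linarith, by linarith [hτ.1, ht.2]⟩ _).trans ?_
      gcongr
      exact le_abs_self C
    · rw [indicator_of_notMem h, norm_zero]; positivity
  · have hne : ∀ᵐ τ ∂(volume.restrict (Ioc 0 T)), τ ≠ t₀ :=
      ae_restrict_of_ae (Measure.ae_ne volume t₀)
    refine hne.mono fun τ hτ => ContinuousAt.continuousWithinAt ?_
    have hcont : Continuous fun t => K (t - τ) (g τ) :=
      hK.comp ((continuous_id.sub continuous_const).prodMk continuous_const)
    rcases lt_or_gt_of_ne hτ with h | h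
    · refine hcont.continuousAt.congr ?_
      filter_upwards [Ioi_mem_nhds h] with t ht
      rw [indicator_of_mem (mem_Iio.2 ht)]
    · refine (continuousAt_const (y := (0 : H))).congr ?_
      filter_upwards [Iio_mem_nhds h] with t ht
      rw [indicator_of_notMem]
      rw [mem_Iio, not_lt]
      exact le_of_lt ht

/-- A function that is a primitive on `[0,T]` of a continuous function is differentiable. -/
theorem hasDerivWithinAt_of_eq_integral [CompleteSpace H] (hT : 0 ≤ T) {u v : ℝ → H} {c : H}
    (hv : ContinuousOn v (Icc 0 T)) (hu : ∀ t ∈ Icc 0 T, u t = c + ∫ s in (0 : ℝ)..t, v s)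
    (ht : t ∈ Icc 0 T) : HasDerivWithinAt u (v t) (Icc 0 T) t := by
  -- Extending v by its end values makes it continuous on the line, so the fundamental theorem also
  -- covers the end points.
  have hv' : Continuous (IccExtend hT ((Icc 0 T).domRestrict v)) :=
    (continuousOn_iff_continuous_domRestrict.1 hv).Icc_extend'
  have hev : ∀ s ∈ Icc 0 T, IccExtend hT ((Icc 0 T).domRestrict v) s = v s := fun s hs => by
    rw [IccExtend_of_mem hT _ hs]; rfl
  have h1 := ((hv'.integral_hasStrictDerivAt 0 t).hasDerivAt.const_add c).hasDerivWithinAt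
    (s := Icc 0 T)
  rw [hev t ht] at h1
  refine h1.congr_of_mem (fun r hr => ?_) ht
  rw [hu r hr]
  congr 1
  refine intervalIntegral.integral_congr fun s hs => (hev s ?_).symm
  rw [uIcc_of_le hr.1] at hs
  exact ⟨hs.1, hs.2.trans hr.2⟩

end OperatorConvolution

/-! ### The scalar fractional equation. -/

section ScalarEquation

variable {α l T t : ℝ} {k g h : ℝ → ℝ}

theorem conv_const_mul (k g : ℝ → ℝ) (c t : ℝ) : conv k (fun s => c * g s) t = c * conv k g t := by
  rw [conv, conv, ← intervalIntegral.integral_const_mul]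
  exact intervalIntegral.integral_congr fun s _ => by ring

theorem intervalIntegrable_conv (ht : 0 ≤ t) (hk : IntegrableOn k (Ioc 0 t))
    (hg : ContinuousOn g (Icc 0 t)) : IntervalIntegrable (fun s => k (t - s) * g s) volume 0 t := by
  have h1 : IntervalIntegrable (fun s => k (t - s)) volume 0 t :=
    (intervalIntegrable_iff_integrableOn_Ioc_of_le ht).2
      (integrableOn_comp_sub hk (right_mem_Icc.2 ht))
  exact h1.mul_continuousOn (by rwa [uIcc_of_le ht])

theorem conv_add (ht : 0 ≤ t) (hk : IntegrableOn k (Ioc 0 t)) (hg : ContinuousOn g (Icc 0 t))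
    (hh : ContinuousOn h (Icc 0 t)) :
    conv k (fun s => g s + h s) t = conv k g t + conv k h t := by
  rw [conv, conv, conv, ← intervalIntegral.integral_add (intervalIntegrable_conv ht hk hg)
    (intervalIntegrable_conv ht hk hh)]
  exact intervalIntegral.integral_congr fun s _ => by ring

theorem conv_sub (ht : 0 ≤ t) (hk : IntegrableOn k (Ioc 0 t)) (hg : ContinuousOn g (Icc 0 t))
    (hh : ContinuousOn h (Icc 0 t)) :
    conv k (fun s => g s - h s) t = conv k g t - conv k h t := by
  rw [conv, conv, conv, ← intervalIntegral.integral_sub (intervalIntegrable_conv ht hk hg)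
    (intervalIntegrable_conv ht hk hh)]
  exact intervalIntegral.integral_congr fun s _ => by ring

theorem continuousOn_conv (hk : Continuous k) (hg : IntegrableOn g (Ioc 0 T)) :
    ContinuousOn (conv k g) (Icc 0 T) := by
  obtain ⟨C, hC⟩ := isCompact_Icc.exists_bound_of_continuousOn (hk.continuousOn (s := Icc 0 T))
  refine continuousOn_opConv (K := fun t x => k t * x) (C := C)
    ((hk.comp continuous_fst).mul continuous_snd) (fun s hs x => ?_) hg
  rw [norm_mul]
  gcongr
  exact hC s hs

theorem exists_abs_le_of_continuousOn (hg : ContinuousOn g (Icc 0 t)) :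
    ∃ C, ∀ s ∈ Ioc 0 t, |g s| ≤ C := by
  obtain ⟨C, hC⟩ := isCompact_Icc.exists_bound_of_continuousOn hg
  exact ⟨C, fun s hs => hC s (Ioc_subset_Icc_self hs)⟩

theorem conv_rl_conv_mlk (hα : 1 < α) {a b : ℝ} (ha : 0 < a) (hb : 0 < b) (ht : 0 ≤ t)
    (hg : ContinuousOn g (Icc 0 t)) :
    conv (rl a) (conv (mlk α b l) g) t = conv (mlk α (a + b) l) g t := by
  obtain ⟨C, hC⟩ := exists_abs_le_of_continuousOn hg
  rw [conv_assoc_of_bounded ht (measurable_rl a) (measurable_mlk hα hb l)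
    ((hg.mono Ioc_subset_Icc_self).aestronglyMeasurable measurableSet_Ioc) (integrableOn_rl ha t)
    (integrableOn_mlk hα hb l t) hC]
  exact conv_congr_left ht fun s hs => conv_rl_mlk hα ha hb l hs.1

/-- The solution `a E_{α,1}(-l t^α) + b t E_{α,2}(-l t^α) + (t^{α-1} E_{α,α}(-l t^α)) * F` of the
scalar problem. -/
def scalarSol (α l a b : ℝ) (F : ℝ → ℝ) (t : ℝ) : ℝ :=
  a * mlk α 1 l t + b * mlk α 2 l t + conv (mlk α α l) F t

variable {a b : ℝ} {F : ℝ → ℝ}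

theorem continuousOn_scalarSol (hα : 1 < α) (hF : ContinuousOn F (Icc 0 T)) :
    ContinuousOn (scalarSol α l a b F) (Icc 0 T) := by
  refine ContinuousOn.add (Continuous.continuousOn ?_) (continuousOn_conv
    (continuous_mlk hα hα.le l) (hF.integrableOn_Icc.mono_set Ioc_subset_Icc_self))
  exact (continuous_const.mul (continuous_mlk hα le_rfl l)).add
    (continuous_const.mul (continuous_mlk hα one_le_two l))

theorem conv_rl_scalarSol (hα : 1 < α) {c : ℝ} (hc : 0 < c) (ht : 0 < t)
    (hF : ContinuousOn F (Icc 0 t)) :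
    conv (rl c) (scalarSol α l a b F) t
      = a * mlk α (c + 1) l t + b * mlk α (c + 2) l t + conv (mlk α (c + α) l) F t := by
  have hα0 : 0 < α := by linarith
  have hk := integrableOn_rl hc t
  have h1 : Continuous fun s => a * mlk α 1 l s := continuous_const.mul (continuous_mlk hα le_rfl l)
  have h2 : Continuous fun s => b * mlk α 2 l s :=
    continuous_const.mul (continuous_mlk hα one_le_two l)
  have h3 : ContinuousOn (conv (mlk α α l) F) (Icc 0 t) := continuousOn_conv
    (continuous_mlk hα hα.le l) (hF.integrableOn_Icc.mono_set Ioc_subset_Icc_self)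
  have h4 : Continuous fun s => a * mlk α 1 l s + b * mlk α 2 l s := h1.add h2
  change conv (rl c) (fun s => (a * mlk α 1 l s + b * mlk α 2 l s) + conv (mlk α α l) F s) t = _
  rw [conv_add ht.le hk h4.continuousOn h3, conv_add ht.le hk h1.continuousOn
    h2.continuousOn, conv_const_mul, conv_const_mul, conv_rl_mlk hα hc one_pos l ht,
    conv_rl_mlk hα hc two_pos l ht, conv_rl_conv_mlk hα hc hα0 ht.le hF]

theorem conv_mlk_eq (hα : 1 < α) {c : ℝ} (hc : 0 < c) (ht : 0 ≤ t) (hF : ContinuousOn F (Icc 0 t)) :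
    conv (mlk α c l) F t = conv (rl c) F t - l * conv (mlk α (c + α) l) F t := by
  have hI : ∀ k : ℝ → ℝ, IntegrableOn k (Ioc 0 t) →
      IntervalIntegrable (fun s => k (t - s) * F s) volume 0 t :=
    fun k hk => intervalIntegrable_conv ht hk hF
  rw [conv_congr_left ht fun s hs => mlk_recurrence hα hc l hs.1]
  rw [conv, conv, conv, ← intervalIntegral.integral_const_mul, ← intervalIntegral.integral_sub
    (hI _ (integrableOn_rl hc t)) ((hI _ (integrableOn_mlk hα (by linarith) l t)).const_mul l)]
  exact intervalIntegral.integral_congr fun s _ => by ring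

/-- The fractional differential equation in integrated form. -/
theorem conv_rl_scalarSol_eq (hα : 1 < α) (hα2 : α < 2) (ht : 0 < t)
    (hF : ContinuousOn F (Icc 0 t)) :
    conv (rl (2 - α)) (fun s => scalarSol α l a b F s - a - s * b) t
      = conv (rl 2) (fun s => F s - l * scalarSol α l a b F s) t := by
  have hs := continuousOn_scalarSol (l := l) (a := a) (b := b) hα hF
  have h2α : 0 < 2 - α := by linarith
  have hk := integrableOn_rl h2α t
  have e1 : conv (rl (2 - α)) (fun s => scalarSol α l a b F s - a - s * b) t
      = conv (rl (2 - α)) (scalarSol α l a b F) t - a * rl (3 - α) t - b * rl (4 - α) t := by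
    have hs' : ContinuousOn (fun s => scalarSol α l a b F s - a) (Icc 0 t) :=
      hs.sub continuousOn_const
    have hb : ContinuousOn (fun s : ℝ => s * b) (Icc 0 t) :=
      (continuous_id.mul continuous_const).continuousOn
    rw [conv_sub ht.le hk hs' hb,
      conv_sub ht.le hk hs continuousOn_const]
    have h1 : conv (rl (2 - α)) (fun _ => a) t = a * rl (3 - α) t := by
      have := conv_const_mul (rl (2 - α)) (rl 1) a t
      rw [conv_rl_rl h2α one_pos ht] at this
      simp only [rl_one, mul_one] at this
      rw [this]; congr 2; ring
    have h2 : conv (rl (2 - α)) (fun s => s * b) t = b * rl (4 - α) t := by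
      have := conv_const_mul (rl (2 - α)) (rl 2) b t
      rw [conv_rl_rl h2α two_pos ht] at this
      simp only [rl_two] at this
      simp only [mul_comm _ b]
      rw [this]; congr 2; ring
    rw [h1, h2]
  have hls : ContinuousOn (fun s => l * scalarSol α l a b F s) (Icc 0 t) :=
    continuousOn_const.mul hs
  rw [e1, conv_rl_scalarSol hα h2α ht hF, conv_sub ht.le (integrableOn_rl two_pos t) hF hls, conv_const_mul, conv_rl_scalarSol hα two_pos ht hF]
  -- The recurrence at orders 3-α, 4-α and 2 cancels the subtracted powers and leaves -l times the
  -- kernels of orders 3, 4 and 2+α, which appear on the right-hand side.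
  have r1 := mlk_recurrence hα (show (0 : ℝ) < 3 - α by linarith) l ht
  have r2 := mlk_recurrence hα (show (0 : ℝ) < 4 - α by linarith) l ht
  have r3 := conv_mlk_eq (l := l) hα two_pos ht.le hF
  rw [show 3 - α + α = 2 + 1 by ring] at r1
  rw [show 4 - α + α = 2 + 2 by ring] at r2
  rw [show 2 - α + 1 = 3 - α by ring, show 2 - α + 2 = 4 - α by ring,
    show 2 - α + α = 2 by ring, r1, r2, r3]
  ring

variable {F' : ℝ → ℝ}

/-- Unlike `conv_rl_conv_mlk`, this allows g merely integrable, as f' is: the bounded factor is now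
the constant 1 on the left. -/
theorem conv_rl_one_conv_mlk (hα : 1 < α) {c : ℝ} (hc : 0 < c) (ht : 0 ≤ t)
    (hg : IntegrableOn g (Ioc 0 t)) :
    conv (rl 1) (conv (mlk α c l) g) t = conv (mlk α (c + 1) l) g t := by
  rw [conv_assoc_of_bounded_left ht (measurable_rl 1) (measurable_mlk hα hc l) hg
    (integrableOn_mlk hα hc l t) (K := 1) (fun s _ => by rw [rl_one, abs_one])]
  refine conv_congr_left ht fun s hs => ?_
  rw [conv_rl_mlk hα one_pos hc l hs.1, add_comm]

/-- Integration by parts in the convolution. -/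
theorem conv_mlk_primitive (hα : 1 < α) (ht : 0 ≤ t) (hF' : IntegrableOn F' (Ioc 0 t))
    (hF : ∀ s ∈ Icc 0 t, F s = F 0 + ∫ r in (0 : ℝ)..s, F' r) :
    conv (mlk α α l) F t = F 0 * mlk α (α + 1) l t + conv (mlk α (α + 1) l) F' t := by
  have hα0 : 0 < α := by linarith
  have hk := integrableOn_mlk hα hα0 l t
  have hInt : ContinuousOn (conv (rl 1) F') (Icc 0 t) := by
    refine continuousOn_conv ?_ hF'
    have : rl 1 = fun _ => 1 := funext rl_one
    rw [this]; exact continuous_const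
  -- F is F(0) plus the convolution of 1 with F', and associativity moves that 1 onto the kernel.
  -- Its order becomes α + 1, where the multiplier absorbs a full power of l with no singularity in
  -- t.
  have h1 : conv (mlk α α l) F t = conv (mlk α α l) (fun s => F 0 * rl 1 s + conv (rl 1) F' s) t :=
    conv_congr_right ht fun s hs => by
      rw [hF s (Ioc_subset_Icc_self hs), conv_one, rl_one, mul_one]
  have hr1 : Continuous fun s => F 0 * rl 1 s := by
    simp only [rl_one]; exact continuous_const
  rw [h1, conv_add ht hk hr1.continuousOn hInt, conv_const_mul]
  obtain ⟨C, hC⟩ := isCompact_Icc.exists_bound_of_continuousOn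
    ((continuous_mlk hα hα.le l).continuousOn (s := Icc 0 t))
  rw [conv_assoc_of_bounded_left ht (measurable_mlk hα hα0 l) (measurable_rl 1) hF'
    (integrableOn_rl one_pos t) hC]
  congr 1
  · rcases ht.eq_or_lt with rfl | ht'
    · rw [conv_zero, mlk_at_zero (by linarith)]
    · rw [conv_mlk_rl hα one_pos hα0 l ht', add_comm]
  · refine conv_congr_left ht fun s hs => ?_
    rw [conv_mlk_rl hα one_pos hα0 l hs.1, add_comm]

/-- The derivative of `scalarSol`. -/
def scalarVel (α l a b : ℝ) (c : ℝ) (F' : ℝ → ℝ) (t : ℝ) : ℝ :=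
  -(l * a * mlk α α l t) + b * mlk α 1 l t + c * mlk α α l t + conv (mlk α α l) F' t

/-- The velocity is checked by integrating it, so no series has to be differentiated. Each kernel
rises by one order, and E_{α,1}(-l t^α) = 1 - l t^α E_{α,α+1}(-l t^α) matches the term in a. -/
theorem integral_scalarVel (hα : 1 < α) (ht : 0 ≤ t) (hF' : IntegrableOn F' (Ioc 0 t))
    (hF : ∀ s ∈ Icc 0 t, F s = F 0 + ∫ r in (0 : ℝ)..s, F' r) :
    a + ∫ s in (0 : ℝ)..t, scalarVel α l a b (F 0) F' s = scalarSol α l a b F t := by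
  have hα0 : 0 < α := by linarith
  have hkα := (continuous_mlk hα hα.le l).intervalIntegrable (μ := volume) 0 t
  have hk1 := (continuous_mlk hα le_rfl l).intervalIntegrable (μ := volume) 0 t
  have hcv : IntervalIntegrable (conv (mlk α α l) F') volume 0 t := by
    refine ContinuousOn.intervalIntegrable ?_
    rw [uIcc_of_le ht]
    exact continuousOn_conv (continuous_mlk hα hα.le l) hF'
  have hi1 : IntervalIntegrable (fun s => -(l * a * mlk α α l s)) volume 0 t :=
    (hkα.const_mul (l * a)).neg
  have hi2 := hk1.const_mul b
  have hi3 := hkα.const_mul (F 0)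
  have e : ∫ s in (0 : ℝ)..t, scalarVel α l a b (F 0) F' s =
      -(l * a * mlk α (α + 1) l t) + b * mlk α 2 l t + F 0 * mlk α (α + 1) l t
        + conv (mlk α (α + 1) l) F' t := by
    simp only [scalarVel]
    have hi4 : IntervalIntegrable (fun s => -(l * a * mlk α α l s) + b * mlk α 1 l s) volume 0 t :=
      hi1.add hi2
    have hi5 : IntervalIntegrable (fun s => -(l * a * mlk α α l s) + b * mlk α 1 l s
      + F 0 * mlk α α l s) volume 0 t := hi4.add hi3
    rw [intervalIntegral.integral_add hi5 hcv, intervalIntegral.integral_add hi4 hi3, intervalIntegral.integral_add hi1 hi2,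
      intervalIntegral.integral_neg, intervalIntegral.integral_const_mul,
      intervalIntegral.integral_const_mul, intervalIntegral.integral_const_mul,
      integral_mlk hα hα0 l ht, integral_mlk hα one_pos l ht, ← conv_one,
      conv_rl_one_conv_mlk hα hα0 ht hF']
    norm_num
  rw [e, scalarSol, conv_mlk_primitive hα ht hF' hF]
  have h1 : mlk α 1 l t = 1 - l * mlk α (α + 1) l t := by
    rcases ht.eq_or_lt with rfl | ht'
    · rw [mlk_one_at_zero hα, mlk_at_zero (by linarith)]; ring
    · rw [mlk_recurrence hα one_pos l ht', rl_one, add_comm 1 α]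
  rw [h1]
  ring

end ScalarEquation

/-! ### The solution, its velocity and A u as bounded operators applied to the data, with their
coordinates. -/

section SpectralSolution

variable {X : Type*} [MeasurableSpace X] {m : Measure X}

theorem inner_intervalIntegral {H : Type*} [NormedAddCommGroup H] [InnerProductSpace ℝ H]
    [CompleteSpace H] {g : ℝ → H} {a b : ℝ} (hg : IntervalIntegrable g volume a b) (c : H) :
    inner ℝ c (∫ s in a..b, g s) = ∫ s in a..b, inner ℝ c (g s) :=
  ((innerSL ℝ c).intervalIntegral_comp_comm hg).symm

/-- The data of the Cauchy problem: `A^{1/α} u₀`, `u₁`, `f(0)` and `∂_t f`. -/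
structure CauchyData (m : Measure X) where
  pow₀ : L2 m
  vel₀ : L2 m
  force₀ : L2 m
  force' : ℝ → L2 m

namespace EigenBasis

variable {E : DirichletForm m} {ι : Type*} (B : EigenBasis E ι)

/-- Under αθ = b - 1 the powers of t in the multiplier and in the kernel coincide, so no singular
factor remains at t = 0. -/
theorem mlMult_of_nonneg {α b θ s : ℝ} (hs : 0 ≤ s) (h : α * θ = b - 1) (i : ι) :
    B.mlMult α b θ s i = B.lam i ^ θ * mlk α b (B.lam i) s := by
  rw [mlMult, abs_of_nonneg hs, Real.mul_rpow (B.lam_pos i).le (Real.rpow_nonneg hs _),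
    ← Real.rpow_mul hs, mlk, h, neg_mul, mul_assoc]

theorem rpow_mul_mlMult_zero {α b s : ℝ} (hs : 0 ≤ s) (i : ι) :
    |s| ^ (b - 1) * B.mlMult α b 0 s i = mlk α b (B.lam i) s := by
  rw [mlMult, abs_of_nonneg hs, Real.rpow_zero, one_mul, mlk, neg_mul]

section Definitions

variable (α : ℝ) (D : CauchyData m)

/-- `A` applied to the contribution of the forcing. -/
def solForceA (t : ℝ) : L2 m :=
  B.mlOp α (α + 1) 1 t D.force₀ + opConv (fun s h => B.mlOp α (α + 1) 1 s h) D.force' t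

/-- `A^{1/α} u(t)`. -/
def solPow (t : ℝ) : L2 m :=
  B.mlOp α 1 0 t D.pow₀ + B.mlOp α 2 (1 / α) t D.vel₀ + B.negPow (1 - 1 / α) (B.solForceA α D t)

/-- The solution `u(t)`. -/
def sol (t : ℝ) : L2 m := B.negPow (1 / α) (B.solPow α D t)

/-- `A u(t)`. -/
def solA (t : ℝ) : L2 m :=
  t ^ (1 - α) • (B.mlOp α 1 (1 - 1 / α) t D.pow₀ + B.mlOp α 2 1 t D.vel₀) + B.solForceA α D t

/-- `∂_t u(t)`. -/
def solVel (t : ℝ) : L2 m :=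
  -B.mlOp α α (1 - 1 / α) t D.pow₀ + B.mlOp α 1 0 t D.vel₀
    + |t| ^ (α - 1) • B.mlOp α α 0 t D.force₀
    + opConv (fun s h => |s| ^ (α - 1) • B.mlOp α α 0 s h) D.force' t

/-- The coefficients of `u₀`. -/
def initCoef (i : ι) : ℝ := B.lam i ^ (-(1 / α)) * inner ℝ (B.φ i) D.pow₀

end Definitions

variable {α T t : ℝ} {D : CauchyData m}

theorem one_sub_inv_pos (hα : 1 < α) : 0 < 1 - 1 / α := by
  rw [sub_pos, div_lt_one (by linarith)]; exact hα

theorem inv_le_one_of_one_lt (hα : 1 < α) : 1 / α ≤ 1 := by linarith [one_sub_inv_pos hα]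

theorem mul_one_sub_inv (hα : 1 < α) : α * (1 - 1 / α) = α - 1 := by
  have : α ≠ 0 := by linarith
  field_simp

section Continuity

theorem continuous_mlOp_apply (hα : 1 < α) (hα2 : α < 2) {b θ : ℝ} (hb : 0 < b) (h0 : 0 ≤ θ)
    (h1 : θ ≤ 1) (h : L2 m) : Continuous fun t => B.mlOp α b θ t h := by
  have h2 : Continuous fun t : ℝ => (t, h) := Continuous.prodMk_left h
  have h3 := (B.continuous_mlOp hα hα2 hb h0 h1).comp h2
  exact h3

theorem continuous_rpow_smul_mlOp (hα : 1 < α) (hα2 : α < 2) :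
    Continuous fun p : ℝ × L2 m => |p.1| ^ (α - 1) • B.mlOp α α 0 p.1 p.2 := by
  have h1 : Continuous fun p : ℝ × L2 m => |p.1| ^ (α - 1) :=
    (continuous_abs.comp continuous_fst).rpow_const fun _ => Or.inr (by linarith)
  exact h1.smul (B.continuous_mlOp hα hα2 (by linarith) le_rfl zero_le_one)

theorem exists_norm_rpow_smul_mlOp_le (hα : 1 < α) (hα2 : α < 2) (T : ℝ) :
    ∃ C, ∀ s ∈ Icc 0 T, ∀ h, ‖|s| ^ (α - 1) • B.mlOp α α 0 s h‖ ≤ C * ‖h‖ := by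
  obtain ⟨C, hC, hb⟩ := B.exists_norm_mlOp_le hα hα2 (b := α) (by linarith) le_rfl zero_le_one
  refine ⟨T ^ (α - 1) * C, fun s hs h => ?_⟩
  rw [norm_smul, Real.norm_of_nonneg (by positivity), abs_of_nonneg hs.1, mul_assoc]
  exact mul_le_mul (Real.rpow_le_rpow hs.1 hs.2 (by linarith)) (hb s h) (norm_nonneg _)
    (Real.rpow_nonneg (hs.1.trans hs.2) _)

theorem continuousOn_solForceA (hα : 1 < α) (hα2 : α < 2)
    (hi : IntegrableOn D.force' (Ioc 0 T)) : ContinuousOn (B.solForceA α D) (Icc 0 T) := by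
  obtain ⟨C, hC, hb⟩ := B.exists_norm_mlOp_le hα hα2 (b := α + 1) (by linarith) zero_le_one le_rfl
  exact (B.continuous_mlOp_apply hα hα2 (by linarith) zero_le_one le_rfl _).continuousOn.add
    (continuousOn_opConv (B.continuous_mlOp hα hα2 (by linarith) zero_le_one le_rfl)
      (fun s _ h => hb s h) hi)

theorem exists_norm_solForceA_le (hα : 1 < α) (hα2 : α < 2) : ∃ C, 0 < C ∧
    ∀ (D : CauchyData m) (T : ℝ), IntegrableOn D.force' (Ioc 0 T) → ∀ t ∈ Icc 0 T,
      ‖B.solForceA α D t‖ ≤ C * (‖D.force₀‖ + ∫ τ in (0 : ℝ)..t, ‖D.force' τ‖) := by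
  obtain ⟨C, hC, hb⟩ := B.exists_norm_mlOp_le hα hα2 (b := α + 1) (by linarith) zero_le_one le_rfl
  refine ⟨C, hC, fun D T hi t ht => ?_⟩
  rw [mul_add]
  exact (norm_add_le _ _).trans (add_le_add (hb _ _)
    (norm_opConv_le (T := T) (fun s _ h => hb s h) hi ht))

/-- This is continuity of u in V_{1/α}. On u₁ the operator A^{1/α} t E_{α,2}(-t^α A) is the bounded
multiplier with θ = 1/α, and the forcing carries the negative power A^{1/α-1}. -/
theorem continuousOn_solPow (hα : 1 < α) (hα2 : α < 2)
    (hi : IntegrableOn D.force' (Ioc 0 T)) : ContinuousOn (B.solPow α D) (Icc 0 T) := by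
  refine ((B.continuous_mlOp_apply hα hα2 one_pos le_rfl zero_le_one _).add
    (B.continuous_mlOp_apply hα hα2 two_pos (gamma_nonneg hα)
      (inv_le_one_of_one_lt hα) _)).continuousOn.add ?_
  exact (B.negPow (1 - 1 / α)).continuous.comp_continuousOn (B.continuousOn_solForceA hα hα2 hi)

theorem continuousOn_solVel (hα : 1 < α) (hα2 : α < 2)
    (hi : IntegrableOn D.force' (Ioc 0 T)) : ContinuousOn (B.solVel α D) (Icc 0 T) := by
  have hα0 : 0 < α := by linarith
  have h1 := one_sub_inv_pos hα
  obtain ⟨C, hC⟩ := B.exists_norm_rpow_smul_mlOp_le hα hα2 T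
  have h2 : Continuous fun t : ℝ => (t, D.force₀) := Continuous.prodMk_left D.force₀
  have h3 := B.continuous_mlOp_apply hα hα2 hα0 h1.le (by linarith [gamma_nonneg hα]) D.pow₀
  have h4 := B.continuous_mlOp_apply hα hα2 one_pos le_rfl zero_le_one D.vel₀
  have h5 := (B.continuous_rpow_smul_mlOp hα hα2).comp h2
  have h6 := continuousOn_opConv (K := fun s h => |s| ^ (α - 1) • B.mlOp α α 0 s h)
    (B.continuous_rpow_smul_mlOp hα hα2) hC hi
  have h7 := ((h3.neg.add h4).add h5).continuousOn.add h6
  exact h7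

theorem continuousOn_sol (hα : 1 < α) (hα2 : α < 2)
    (hi : IntegrableOn D.force' (Ioc 0 T)) : ContinuousOn (B.sol α D) (Icc 0 T) :=
  (B.negPow (1 / α)).continuous.comp_continuousOn (B.continuousOn_solPow hα hα2 hi)

end Continuity

section Coefficients

theorem inner_opConv {K : ℝ → L2 m → L2 m} {g : ℝ → L2 m} {C : ℝ} {k : ℝ → ℝ} {i : ι}
    (hK : Continuous fun p : ℝ × L2 m => K p.1 p.2)
    (hC : ∀ s ∈ Icc 0 T, ∀ h, ‖K s h‖ ≤ C * ‖h‖) (hg : IntegrableOn g (Ioc 0 T))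
    (ht : t ∈ Icc 0 T) (hk : ∀ s, 0 ≤ s → ∀ h, inner ℝ (B.φ i) (K s h) = k s * inner ℝ (B.φ i) h) :
    inner ℝ (B.φ i) (opConv K g t) = conv k (fun τ => inner ℝ (B.φ i) (g τ)) t := by
  rw [opConv, inner_intervalIntegral ((intervalIntegrable_iff_integrableOn_Ioc_of_le ht.1).2
    (integrableOn_opConv hK hC hg ht)), conv]
  refine intervalIntegral.integral_congr fun τ hτ => hk _ ?_ _
  rw [uIcc_of_le ht.1] at hτ
  linarith [hτ.2]

theorem inner_solForceA (hα : 1 < α) (hα2 : α < 2) (hi : IntegrableOn D.force' (Ioc 0 T))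
    (ht : t ∈ Icc 0 T) (i : ι) :
    inner ℝ (B.φ i) (B.solForceA α D t) = B.lam i *
      (inner ℝ (B.φ i) D.force₀ * mlk α (α + 1) (B.lam i) t
        + conv (mlk α (α + 1) (B.lam i)) (fun τ => inner ℝ (B.φ i) (D.force' τ)) t) := by
  obtain ⟨C, hC, hb⟩ := B.exists_norm_mlOp_le hα hα2 (b := α + 1) (by linarith) zero_le_one le_rfl
  have hk : ∀ s, 0 ≤ s → ∀ h, inner ℝ (B.φ i) (B.mlOp α (α + 1) 1 s h)
      = B.lam i * mlk α (α + 1) (B.lam i) s * inner ℝ (B.φ i) h := fun s hs h => by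
    rw [B.inner_mlOp hα hα2 (by linarith) zero_le_one le_rfl, B.mlMult_of_nonneg hs (by ring),
      Real.rpow_one]
  rw [solForceA, inner_add_right, hk t ht.1, B.inner_opConv (K := fun s h => B.mlOp α (α + 1) 1 s h)
    (B.continuous_mlOp hα hα2 (by linarith) zero_le_one le_rfl) (fun s _ h => hb s h) hi ht hk,
    mul_add]
  congr 1
  · ring
  · rw [conv, conv, ← intervalIntegral.integral_const_mul]
    exact intervalIntegral.integral_congr fun s _ => by ring

variable {f : ℝ → L2 m}

/-- The coefficients of the forcing are primitives. -/
theorem inner_force (hi : IntegrableOn D.force' (Ioc 0 T))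
    (hf : ∀ s ∈ Icc 0 T, f s = D.force₀ + ∫ r in (0 : ℝ)..s, D.force' r) (i : ι) :
    ∀ s ∈ Icc 0 T, inner ℝ (B.φ i) (f s) = inner ℝ (B.φ i) D.force₀ +
      ∫ r in (0 : ℝ)..s, inner ℝ (B.φ i) (D.force' r) := fun s hs => by
  rw [hf s hs, inner_add_right, inner_intervalIntegral
    ((intervalIntegrable_iff_integrableOn_Ioc_of_le hs.1).2
      (hi.mono_set (Ioc_subset_Ioc_right hs.2)))]

/-- This undoes the integration by parts: the expression in f(0) and f' is λ_i times the convolution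
with f itself. -/
theorem inner_solForceA_eq_conv (hα : 1 < α) (hα2 : α < 2) (hi : IntegrableOn D.force' (Ioc 0 T))
    (hf : ∀ s ∈ Icc 0 T, f s = D.force₀ + ∫ r in (0 : ℝ)..s, D.force' r)
    (ht : t ∈ Icc 0 T) (i : ι) :
    inner ℝ (B.φ i) (B.solForceA α D t) =
      B.lam i * conv (mlk α α (B.lam i)) (fun τ => inner ℝ (B.φ i) (f τ)) t := by
  have h0 : f 0 = D.force₀ := by
    rw [hf 0 ⟨le_rfl, ht.1.trans ht.2⟩, intervalIntegral.integral_same, add_zero]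
  have hF := B.inner_force hi hf i
  rw [← h0] at hF
  rw [B.inner_solForceA hα hα2 hi ht, conv_mlk_primitive (F := fun τ => inner ℝ (B.φ i) (f τ))
    hα ht.1 (F' := fun τ => inner ℝ (B.φ i) (D.force' τ)) ?_ fun s hs => hF s
      ⟨hs.1, hs.2.trans ht.2⟩, h0]
  exact Integrable.const_inner _ (hi.mono_set (Ioc_subset_Ioc_right ht.2))

theorem inner_solPow (hα : 1 < α) (hα2 : α < 2) (hi : IntegrableOn D.force' (Ioc 0 T))
    (hf : ∀ s ∈ Icc 0 T, f s = D.force₀ + ∫ r in (0 : ℝ)..s, D.force' r)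
    (ht : t ∈ Icc 0 T) (i : ι) :
    inner ℝ (B.φ i) (B.solPow α D t) = B.lam i ^ (1 / α) * scalarSol α (B.lam i)
      (B.initCoef α D i) (inner ℝ (B.φ i) D.vel₀) (fun τ => inner ℝ (B.φ i) (f τ)) t := by
  have hl := B.lam_pos i
  have hα0 : α ≠ 0 := by linarith
  have h1 : B.lam i ^ (-(1 - 1 / α)) * B.lam i = B.lam i ^ (1 / α) := by
    nth_rewrite 2 [← Real.rpow_one (B.lam i)]
    rw [← Real.rpow_add hl]; congr 1; ring
  have h2 : B.lam i ^ (1 / α) * B.lam i ^ (-(1 / α)) = 1 := by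
    rw [← Real.rpow_add hl, add_neg_cancel, Real.rpow_zero]
  rw [solPow, inner_add_right, inner_add_right, B.inner_negPow (one_sub_inv_pos hα).le,
    B.inner_solForceA_eq_conv hα hα2 hi hf ht, B.inner_mlOp hα hα2 one_pos le_rfl zero_le_one,
    B.inner_mlOp hα hα2 two_pos (gamma_nonneg hα) (inv_le_one_of_one_lt hα),
    B.mlMult_of_nonneg ht.1 (by ring), B.mlMult_of_nonneg ht.1 (by field_simp; norm_num),
    scalarSol, initCoef, Real.rpow_zero]
  linear_combination (conv (mlk α α (B.lam i)) (fun τ => inner ℝ (B.φ i) (f τ)) t) * h1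
    - inner ℝ (B.φ i) D.pow₀ * mlk α 1 (B.lam i) t * h2

theorem inner_sol (hα : 1 < α) (hα2 : α < 2) (hi : IntegrableOn D.force' (Ioc 0 T))
    (hf : ∀ s ∈ Icc 0 T, f s = D.force₀ + ∫ r in (0 : ℝ)..s, D.force' r)
    (ht : t ∈ Icc 0 T) (i : ι) :
    inner ℝ (B.φ i) (B.sol α D t) = scalarSol α (B.lam i)
      (B.initCoef α D i) (inner ℝ (B.φ i) D.vel₀) (fun τ => inner ℝ (B.φ i) (f τ)) t := by
  rw [sol, B.inner_negPow (gamma_nonneg hα), B.inner_solPow hα hα2 hi hf ht, ← mul_assoc,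
    ← Real.rpow_add (B.lam_pos i), neg_add_cancel, Real.rpow_zero, one_mul]

theorem inner_solPow_eq (hα : 1 < α) (t : ℝ) (i : ι) :
    inner ℝ (B.φ i) (B.solPow α D t) = B.lam i ^ (1 / α) * inner ℝ (B.φ i) (B.sol α D t) := by
  rw [sol, B.inner_negPow (gamma_nonneg hα), ← mul_assoc, ← Real.rpow_add (B.lam_pos i),
    add_neg_cancel, Real.rpow_zero, one_mul]

/-- Both multipliers for the initial data carry an extra t^(α-1) relative to λ times the kernel; the
prefactor t^(1-α) removes it, which needs t > 0. -/
theorem inner_solA (hα : 1 < α) (hα2 : α < 2) (hi : IntegrableOn D.force' (Ioc 0 T))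
    (hf : ∀ s ∈ Icc 0 T, f s = D.force₀ + ∫ r in (0 : ℝ)..s, D.force' r)
    (ht : t ∈ Ioc 0 T) (i : ι) :
    inner ℝ (B.φ i) (B.solA α D t) = B.lam i * inner ℝ (B.φ i) (B.sol α D t) := by
  have hl := B.lam_pos i
  have hα0 : α ≠ 0 := by linarith
  have h1 : t ^ (1 - α) * t ^ (α - 1) = 1 := by
    rw [← Real.rpow_add ht.1, show 1 - α + (α - 1) = 0 by ring, Real.rpow_zero]
  have h2 : B.lam i ^ (1 - 1 / α) = B.lam i * B.lam i ^ (-(1 / α)) := by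
    nth_rewrite 2 [← Real.rpow_one (B.lam i)]
    rw [← Real.rpow_add hl]; congr 1
  rw [solA, inner_add_right, inner_smul_right, inner_add_right,
    B.inner_solForceA_eq_conv hα hα2 hi hf (Ioc_subset_Icc_self ht),
    B.inner_sol hα hα2 hi hf (Ioc_subset_Icc_self ht),
    B.inner_mlOp hα hα2 one_pos (one_sub_inv_pos hα).le (by linarith [gamma_nonneg hα]),
    B.inner_mlOp hα hα2 two_pos zero_le_one le_rfl, B.mlMult_eq ht.1, B.mlMult_eq ht.1,
    scalarSol, initCoef, Real.rpow_one, mul_one, sub_self, sub_zero, mul_one_sub_inv hα, h2,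
    show α - (2 - 1) = α - 1 by ring]
  linear_combination (B.lam i * B.lam i ^ (-(1 / α)) * mlk α 1 (B.lam i) t
    * inner ℝ (B.φ i) D.pow₀ + B.lam i * mlk α 2 (B.lam i) t * inner ℝ (B.φ i) D.vel₀) * h1

theorem inner_solVel (hα : 1 < α) (hα2 : α < 2) (hi : IntegrableOn D.force' (Ioc 0 T))
    (ht : t ∈ Icc 0 T) (i : ι) :
    inner ℝ (B.φ i) (B.solVel α D t) = scalarVel α (B.lam i)
      (B.initCoef α D i) (inner ℝ (B.φ i) D.vel₀) (inner ℝ (B.φ i) D.force₀)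
      (fun τ => inner ℝ (B.φ i) (D.force' τ)) t := by
  have hl := B.lam_pos i
  have h2 : B.lam i ^ (1 - 1 / α) = B.lam i * B.lam i ^ (-(1 / α)) := by
    nth_rewrite 2 [← Real.rpow_one (B.lam i)]
    rw [← Real.rpow_add hl]; congr 1
  obtain ⟨C, hC⟩ := B.exists_norm_rpow_smul_mlOp_le hα hα2 T
  have hk : ∀ s, 0 ≤ s → ∀ h, inner ℝ (B.φ i) (|s| ^ (α - 1) • B.mlOp α α 0 s h)
      = mlk α α (B.lam i) s * inner ℝ (B.φ i) h := fun s hs h => by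
    rw [inner_smul_right, B.inner_mlOp hα hα2 (by linarith) le_rfl zero_le_one, ← mul_assoc,
      B.rpow_mul_mlMult_zero hs]
  rw [solVel, inner_add_right, inner_add_right, inner_add_right, inner_neg_right, hk t ht.1,
    B.inner_opConv (K := fun s h => |s| ^ (α - 1) • B.mlOp α α 0 s h)
      (B.continuous_rpow_smul_mlOp hα hα2) hC hi ht hk,
    B.inner_mlOp hα hα2 one_pos le_rfl zero_le_one,
    B.inner_mlOp hα hα2 (by linarith) (one_sub_inv_pos hα).le (by linarith [gamma_nonneg hα]),
    B.mlMult_of_nonneg ht.1 (mul_one_sub_inv hα), B.mlMult_of_nonneg ht.1 (by ring),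
    scalarVel, initCoef, h2, Real.rpow_zero]
  ring

end Coefficients

end EigenBasis

end SpectralSolution

/-! ### Existence: the spectral formula defines a strong solution. -/

section StrongSolution

variable {X : Type*} [MeasurableSpace X] {m : Measure X}

theorem inner_caputoPrimitive {α T t : ℝ} (hα2 : α < 2) {u : ℝ → L2 m}
    (hu : ContinuousOn u (Icc 0 T)) (ht : t ∈ Icc 0 T) (c : L2 m) :
    inner ℝ c (caputoPrimitive α T u t) = conv (rl (2 - α))
      (fun s => inner ℝ c (u s) - inner ℝ c (u 0) - s * inner ℝ c (dt T u 0)) t := by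
  have hI : IntervalIntegrable (fun s => (t - s) ^ (1 - α) • (u s - u 0 - s • dt T u 0))
      volume 0 t := by
    have h1 : IntervalIntegrable (fun s => (t - s) ^ (1 - α)) volume 0 t := by
      refine (intervalIntegrable_iff_integrableOn_Ioc_of_le ht.1).2 ?_
      have := integrableOn_comp_sub (integrableOn_rpow_Ioc (b := 2 - α) (by linarith) t)
        (right_mem_Icc.2 ht.1)
      simpa only [show 2 - α - 1 = 1 - α by ring] using this
    refine h1.smul_continuousOn ?_
    rw [uIcc_of_le ht.1]
    have h2 : Continuous fun s : ℝ => s • dt T u 0 := continuous_id.smul continuous_const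
    exact ((hu.mono (Icc_subset_Icc_right ht.2)).sub continuousOn_const).sub h2.continuousOn
  rw [caputoPrimitive, inner_smul_right, inner_intervalIntegral hI, conv,
    ← intervalIntegral.integral_const_mul]
  refine intervalIntegral.integral_congr fun s _ => ?_
  simp only [inner_smul_right, inner_sub_right, rl]
  rw [show 2 - α - 1 = 1 - α by ring]
  ring

theorem contDiffOn_one_of_hasDerivWithinAt {H : Type*} [NormedAddCommGroup H] [NormedSpace ℝ H]
    {T : ℝ} (hT : 0 < T) {u v : ℝ → H} (hv : ContinuousOn v (Icc 0 T))
    (h : ∀ t ∈ Icc 0 T, HasDerivWithinAt u (v t) (Icc 0 T) t) :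
    ContDiffOn ℝ 1 u (Icc 0 T) ∧ ∀ t ∈ Icc 0 T, dt T u t = v t := by
  have hu := uniqueDiffOn_Icc hT
  have hd : ∀ t ∈ Icc 0 T, dt T u t = v t := fun t ht => (h t ht).derivWithin (hu t ht)
  refine ⟨?_, hd⟩
  rw [show (1 : WithTop ℕ∞) = 0 + 1 by norm_num, contDiffOn_succ_iff_derivWithin hu]
  refine ⟨fun t ht => (h t ht).differentiableWithinAt, by simp, ?_⟩
  rw [contDiffOn_zero]
  exact hv.congr hd

namespace EigenBasis

variable {E : DirichletForm m} {ι : Type*} (B : EigenBasis E ι) {α T t : ℝ} {D : CauchyData m}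
  {f : ℝ → L2 m}

theorem gelfand_basisV {s : ℝ} (hs : 0 ≤ s) (h : L2 m) (i : ι) :
    B.gelfand hs h (B.basisV hs i) = inner ℝ (B.φ i) h := by
  rw [gelfand_apply, coe_basisV, real_inner_comm]

theorem powEquiv_basisV {s : ℝ} (hs : 0 ≤ s) (i : ι) :
    B.powEquiv hs (B.basisV hs i) = B.lam i ^ s • B.φ i :=
  LinearIsometryEquiv.apply_symm_apply _ _

/-- The functional `ψ ↦ (A^{1-2s} h, A^s ψ)` on `V_s`, which represents `A^{1-s} h`. -/
def opDual {s : ℝ} (hs : 0 ≤ s) : L2 m →L[ℝ] B.VDual s :=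
  (ContinuousLinearMap.compL ℝ (B.V s) (L2 m) ℝ).flip
    ((B.powEquiv hs).toContinuousLinearEquiv : B.V s →L[ℝ] L2 m) ∘L innerSL ℝ ∘L
      B.negPow (2 * s - 1)

/-- For s = 1/α and h = A^s u the coordinates are λ_i (u, φ_i), so the functional is A u in V_{-s};
it is continuous up to t = 0, where A u may leave L². The condition s ≥ 1/2 keeps A^{1-2s} bounded.
-/
theorem opDual_basisV {s : ℝ} (hs : 1 / 2 ≤ s) (h : L2 m) (i : ι) :
    B.opDual (by linarith) h (B.basisV (by linarith) i) = B.lam i ^ (1 - s) * inner ℝ (B.φ i) h := by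
  have hs0 : 0 ≤ s := by linarith
  change inner ℝ (B.negPow (2 * s - 1) h) (B.powEquiv hs0 (B.basisV hs0 i)) = _
  rw [powEquiv_basisV, inner_smul_right, real_inner_comm, B.inner_negPow (by linarith), ← mul_assoc,
    ← Real.rpow_add (B.lam_pos i)]
  congr 2
  ring

theorem half_le_inv (hα : 1 < α) (hα2 : α < 2) : 1 / 2 ≤ 1 / α :=
  one_div_le_one_div_of_le (by linarith) hα2.le

theorem HasCaputoDeriv.eqOn {hα : 1 < α} {u : ℝ → L2 m} {w w' : ℝ → B.VDual (1 / α)}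
    (h : B.HasCaputoDeriv hα T u w) (h' : B.HasCaputoDeriv hα T u w') : EqOn w w' (Ioo 0 T) := by
  obtain ⟨G, hG⟩ := h
  obtain ⟨G', hG'⟩ := h'
  have h1 : EqOn G G' (Ioo 0 T) := fun t ht => (hG t ht).1.unique (hG' t ht).1
  intro t ht
  refine (hG t ht).2.unique ((hG' t ht).2.congr_of_eventuallyEq ?_)
  exact h1.eventuallyEq_of_mem (Ioo_mem_nhds ht.1 ht.2)

/-- If the integrated equation holds coordinatewise then `w` is the fractional derivative. -/
theorem hasCaputoDeriv_of_conv (hα : 1 < α) (hα2 : α < 2) (hT : 0 < T) {u : ℝ → L2 m}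
    (hu : ContinuousOn u (Icc 0 T)) {w : ℝ → B.VDual (1 / α)} (hw : ContinuousOn w (Icc 0 T))
    (h : ∀ t ∈ Ioo 0 T, ∀ i, conv (rl (2 - α)) (fun s => inner ℝ (B.φ i) (u s) -
      inner ℝ (B.φ i) (u 0) - s * inner ℝ (B.φ i) (dt T u 0)) t =
        conv (rl 2) (fun s => w s (B.basisV (gamma_nonneg hα) i)) t) :
    B.HasCaputoDeriv hα T u w := by
  have hwi : IntegrableOn w (Ioo 0 T) := hw.integrableOn_Icc.mono_set Ioo_subset_Icc_self
  have hW := continuousOn_integral_of_integrableOn hT.le hwi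
  have hmem : ∀ t ∈ Ioo 0 T, Icc 0 T ∈ 𝓝 t := fun t ht => Icc_mem_nhds ht.1 ht.2
  have hsub : ∀ t ∈ Ioo 0 T, uIcc 0 t ⊆ Icc 0 T := fun t ht => by
    rw [uIcc_of_le ht.1.le]; exact Icc_subset_Icc_right ht.2.le
  -- Convolution with k_2 is a double primitive, so on coordinates, hence in the dual space, the
  -- Caputo primitive is the double primitive of the continuous w.
  have heq : EqOn (fun r => B.gelfand (gamma_nonneg hα) (caputoPrimitive α T u r))
      (fun r => ∫ s in (0 : ℝ)..r, ∫ s' in (0 : ℝ)..s, w s') (Ioo 0 T) := by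
    intro t ht
    refine B.vdual_ext (gamma_nonneg hα) fun i => ?_
    simp only
    rw [gelfand_basisV, inner_caputoPrimitive hα2 hu (Ioo_subset_Icc_self ht), h t ht i,
      ContinuousLinearMap.intervalIntegral_apply (hW.mono (hsub t ht)).intervalIntegrable]
    have e1 : ∀ s ∈ Ioc 0 t, (∫ s' in (0 : ℝ)..s, w s') (B.basisV (gamma_nonneg hα) i)
        = conv (rl 1) (fun s => w s (B.basisV (gamma_nonneg hα) i)) s := fun s hs => by
      rw [ContinuousLinearMap.intervalIntegral_apply
        (hw.mono (hsub s ⟨hs.1, hs.2.trans_lt ht.2⟩)).intervalIntegrable, conv_one]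
    rw [← conv_one, conv_congr_right ht.1.le e1]
    have hwc : ContinuousOn (fun s => w s (B.basisV (gamma_nonneg hα) i)) (Icc 0 t) :=
      (hw.mono (Icc_subset_Icc_right ht.2.le)).clm_apply continuousOn_const
    obtain ⟨C, hC⟩ := exists_abs_le_of_continuousOn hwc
    rw [conv_assoc_of_bounded ht.1.le (measurable_rl 1) (measurable_rl 1)
      ((hwc.mono Ioc_subset_Icc_self).aestronglyMeasurable measurableSet_Ioc)
      (integrableOn_rl one_pos t) (integrableOn_rl one_pos t) hC]
    refine conv_congr_left ht.1.le fun s hs => ?_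
    rw [conv_rl_rl one_pos one_pos hs.1, one_add_one_eq_two]
  refine ⟨fun t => ∫ s in (0 : ℝ)..t, w s, fun t ht => ⟨?_, ?_⟩⟩
  · refine HasDerivAt.congr_of_eventuallyEq ?_
      (heq.eventuallyEq_of_mem (Ioo_mem_nhds ht.1 ht.2))
    exact (hasDerivWithinAt_of_eq_integral (c := 0) hT.le hW (fun r _ => (zero_add _).symm)
      (Ioo_subset_Icc_self ht)).hasDerivAt (hmem t ht)
  · exact (hasDerivWithinAt_of_eq_integral (c := 0) hT.le hw (fun r _ => (zero_add _).symm)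
      (Ioo_subset_Icc_self ht)).hasDerivAt (hmem t ht)

section Solution

theorem sol_eq_add_integral (hα : 1 < α) (hα2 : α < 2) (hi : IntegrableOn D.force' (Ioc 0 T))
    (hf : ∀ s ∈ Icc 0 T, f s = D.force₀ + ∫ r in (0 : ℝ)..s, D.force' r) :
    ∀ t ∈ Icc 0 T, B.sol α D t = B.negPow (1 / α) D.pow₀ + ∫ s in (0 : ℝ)..t, B.solVel α D s := by
  intro t ht
  have hsub : uIcc 0 t ⊆ Icc 0 T := by
    rw [uIcc_of_le ht.1]; exact Icc_subset_Icc_right ht.2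
  have h0 : f 0 = D.force₀ := by
    rw [hf 0 ⟨le_rfl, ht.1.trans ht.2⟩, intervalIntegral.integral_same, add_zero]
  refine ext_inner_basis B.φ fun i => ?_
  rw [B.inner_sol hα hα2 hi hf ht, inner_add_right, B.inner_negPow (gamma_nonneg hα),
    inner_intervalIntegral ((B.continuousOn_solVel hα hα2 hi).mono hsub).intervalIntegrable]
  have hF := B.inner_force hi hf i
  rw [← h0] at hF
  rw [← integral_scalarVel (F := fun τ => inner ℝ (B.φ i) (f τ)) hα ht.1
    (F' := fun τ => inner ℝ (B.φ i) (D.force' τ))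
    (Integrable.const_inner _ (hi.mono_set (Ioc_subset_Ioc_right ht.2)))
    fun s hs => hF s ⟨hs.1, hs.2.trans ht.2⟩]
  congr 1
  refine intervalIntegral.integral_congr fun s hs => ?_
  rw [B.inner_solVel hα hα2 hi (hsub hs), h0]

theorem solVel_zero (hα : 1 < α) (hα2 : α < 2) (hT : 0 ≤ T)
    (hi : IntegrableOn D.force' (Ioc 0 T)) : B.solVel α D 0 = D.vel₀ := by
  refine ext_inner_basis B.φ fun i => ?_
  rw [B.inner_solVel hα hα2 hi (left_mem_Icc.2 hT), scalarVel, mlk_at_zero hα, mlk_one_at_zero hα,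
    conv_zero]
  ring

theorem contDiffOn_sol (hα : 1 < α) (hα2 : α < 2) (hT : 0 < T)
    (hi : IntegrableOn D.force' (Ioc 0 T))
    (hf : ∀ s ∈ Icc 0 T, f s = D.force₀ + ∫ r in (0 : ℝ)..s, D.force' r) :
    ContDiffOn ℝ 1 (B.sol α D) (Icc 0 T) ∧ ∀ t ∈ Icc 0 T, dt T (B.sol α D) t = B.solVel α D t := by
  have hv := B.continuousOn_solVel hα hα2 hi
  exact contDiffOn_one_of_hasDerivWithinAt hT hv fun t ht => hasDerivWithinAt_of_eq_integral hT.le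
    hv (B.sol_eq_add_integral hα hα2 hi hf) ht

theorem sol_zero (hα : 1 < α) (hα2 : α < 2) (hT : 0 < T) (hi : IntegrableOn D.force' (Ioc 0 T))
    (hf : ∀ s ∈ Icc 0 T, f s = D.force₀ + ∫ r in (0 : ℝ)..s, D.force' r) :
    B.sol α D 0 = B.negPow (1 / α) D.pow₀ := by
  rw [B.sol_eq_add_integral hα hα2 hi hf 0 (left_mem_Icc.2 hT.le), intervalIntegral.integral_same,
    add_zero]

/-- The fractional derivative `f - A u` as a functional. -/
def solCaputo (hα : 1 < α) (D : CauchyData m) (f : ℝ → L2 m) (t : ℝ) : B.VDual (1 / α) :=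
  B.gelfand (gamma_nonneg hα) (f t) - B.opDual (gamma_nonneg hα) (B.solPow α D t)

theorem solCaputo_basisV (hα : 1 < α) (hα2 : α < 2) (t : ℝ) (i : ι) :
    B.solCaputo hα D f t (B.basisV (gamma_nonneg hα) i) =
      inner ℝ (B.φ i) (f t) - B.lam i * inner ℝ (B.φ i) (B.sol α D t) := by
  have hl := B.lam_pos i
  rw [solCaputo, sub_apply, gelfand_basisV, B.opDual_basisV
    (half_le_inv hα hα2), B.inner_solPow_eq hα, ← mul_assoc, ← Real.rpow_add hl, sub_add_cancel,
    Real.rpow_one]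

theorem continuousOn_solCaputo (hα : 1 < α) (hα2 : α < 2) (hi : IntegrableOn D.force' (Ioc 0 T))
    (hfc : ContinuousOn f (Icc 0 T)) : ContinuousOn (B.solCaputo hα D f) (Icc 0 T) :=
  ((B.gelfand (gamma_nonneg hα)).continuous.comp_continuousOn hfc).sub
    ((B.opDual (gamma_nonneg hα)).continuous.comp_continuousOn (B.continuousOn_solPow hα hα2 hi))

/-- For t > 0 the fractional derivative, a priori only a functional, is represented by an element of
L². -/
theorem gelfand_sub_solA (hα : 1 < α) (hα2 : α < 2) (hi : IntegrableOn D.force' (Ioc 0 T))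
    (hf : ∀ s ∈ Icc 0 T, f s = D.force₀ + ∫ r in (0 : ℝ)..s, D.force' r) (ht : t ∈ Ioc 0 T) :
    B.gelfand (gamma_nonneg hα) (f t - B.solA α D t) = B.solCaputo hα D f t := by
  refine B.vdual_ext (gamma_nonneg hα) fun i => ?_
  rw [gelfand_basisV, B.solCaputo_basisV hα hα2, inner_sub_right, B.inner_solA hα hα2 hi hf ht]

theorem hasCaputoDeriv_sol (hα : 1 < α) (hα2 : α < 2) (hT : 0 < T)
    (hi : IntegrableOn D.force' (Ioc 0 T)) (hfc : ContinuousOn f (Icc 0 T))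
    (hf : ∀ s ∈ Icc 0 T, f s = D.force₀ + ∫ r in (0 : ℝ)..s, D.force' r) :
    B.HasCaputoDeriv hα T (B.sol α D) (B.solCaputo hα D f) := by
  refine B.hasCaputoDeriv_of_conv hα hα2 hT (B.continuousOn_sol hα hα2 hi)
    (B.continuousOn_solCaputo hα hα2 hi hfc) fun t ht i => ?_
  have h0 := left_mem_Icc.2 hT.le
  have hIcc : ∀ s ∈ Ioc 0 t, s ∈ Icc 0 T := fun s hs => ⟨hs.1.le, hs.2.trans ht.2.le⟩
  have hFc : ContinuousOn (fun τ => inner ℝ (B.φ i) (f τ)) (Icc 0 t) :=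
    continuousOn_const.inner (hfc.mono (Icc_subset_Icc_right ht.2.le))
  have key := conv_rl_scalarSol_eq (l := B.lam i) (a := B.initCoef α D i)
    (b := inner ℝ (B.φ i) D.vel₀) hα hα2 ht.1 hFc
  rw [B.sol_zero hα hα2 hT hi hf, (B.contDiffOn_sol hα hα2 hT hi hf).2 0 h0,
    B.solVel_zero hα hα2 hT.le hi, B.inner_negPow (gamma_nonneg hα)]
  rw [conv_congr_right ht.1.le (fun s hs => by rw [B.inner_sol hα hα2 hi hf (hIcc s hs)]),
    conv_congr_right (k := rl 2) ht.1.le (fun s hs => by rw [B.solCaputo_basisV hα hα2,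
      B.inner_sol hα hα2 hi hf (hIcc s hs)])]
  exact key

theorem isOp_sol (hα : 1 < α) (hα2 : α < 2) (hi : IntegrableOn D.force' (Ioc 0 T))
    (hf : ∀ s ∈ Icc 0 T, f s = D.force₀ + ∫ r in (0 : ℝ)..s, D.force' r) (ht : t ∈ Ioc 0 T) :
    E.IsOp (B.sol α D t) (B.solA α D t) :=
  B.isOp_of_inner fun i => B.inner_solA hα hα2 hi hf ht i

/-- The constant is independent of T because the multiplier bounds behind it hold for all times. -/
theorem exists_norm_solA_le (hα : 1 < α) (hα2 : α < 2) : ∃ C, 0 < C ∧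
    ∀ (D : CauchyData m) (T : ℝ), IntegrableOn D.force' (Ioc 0 T) → ∀ t ∈ Ioc 0 T,
      ‖B.solA α D t‖ ≤ C * t ^ (1 - α) * (‖D.pow₀‖ + ‖D.vel₀‖)
        + C * (‖D.force₀‖ + ∫ τ in (0 : ℝ)..t, ‖D.force' τ‖) := by
  obtain ⟨C₁, hC₁, h₁⟩ := B.exists_norm_mlOp_le hα hα2 one_pos (one_sub_inv_pos hα).le
    (by linarith [gamma_nonneg hα])
  obtain ⟨C₂, hC₂, h₂⟩ := B.exists_norm_mlOp_le hα hα2 two_pos zero_le_one le_rfl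
  obtain ⟨C₃, hC₃, h₃⟩ := B.exists_norm_solForceA_le hα hα2
  refine ⟨C₁ + C₂ + C₃, by positivity, fun D T hi t ht => ?_⟩
  have ht0 : 0 ≤ t ^ (1 - α) := Real.rpow_nonneg ht.1.le _
  have h4 : 0 ≤ ∫ τ in (0 : ℝ)..t, ‖D.force' τ‖ :=
    intervalIntegral.integral_nonneg ht.1.le fun _ _ => norm_nonneg _
  refine (norm_add_le _ _).trans (add_le_add ?_ ?_)
  · rw [norm_smul, Real.norm_of_nonneg ht0, mul_comm (C₁ + C₂ + C₃), mul_assoc]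
    refine mul_le_mul_of_nonneg_left ?_ ht0
    refine (norm_add_le _ _).trans ((add_le_add (h₁ _ _) (h₂ _ _)).trans ?_)
    have := norm_nonneg D.pow₀
    have := norm_nonneg D.vel₀
    nlinarith
  · refine (h₃ D T hi t (Ioc_subset_Icc_self ht)).trans ?_
    have := norm_nonneg D.force₀
    gcongr
    linarith

/-- The singularity t^(1-α) at 0 is integrable because α < 2. -/
theorem integrableOn_solA (hα : 1 < α) (hα2 : α < 2) (hi : IntegrableOn D.force' (Ioc 0 T)) :
    IntegrableOn (B.solA α D) (Ioc 0 T) := by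
  have h1 : Continuous fun t => B.mlOp α 1 (1 - 1 / α) t D.pow₀ + B.mlOp α 2 1 t D.vel₀ :=
    (B.continuous_mlOp_apply hα hα2 one_pos (one_sub_inv_pos hα).le
      (by linarith [gamma_nonneg hα]) _).add
      (B.continuous_mlOp_apply hα hα2 two_pos zero_le_one le_rfl _)
  have h2 := integrableOn_rpow_Ioc (b := 2 - α) (by linarith) T
  rw [show 2 - α - 1 = 1 - α by ring] at h2
  have h3 := (B.continuousOn_solForceA hα hα2 hi).integrableOn_Icc.mono_set Ioc_subset_Icc_self
    (μ := volume)
  refine Integrable.add ?_ h3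
  obtain ⟨C, hC⟩ := isCompact_Icc.exists_bound_of_continuousOn (h1.continuousOn (s := Icc 0 T))
  refine Integrable.mono' (h2.mul_const C) (h2.aestronglyMeasurable.smul h1.aestronglyMeasurable)
    ((ae_restrict_mem measurableSet_Ioc).mono fun t ht => ?_)
  rw [norm_smul, Real.norm_of_nonneg (Real.rpow_nonneg ht.1.le _)]
  exact mul_le_mul_of_nonneg_left (hC t (Ioc_subset_Icc_self ht)) (Real.rpow_nonneg ht.1.le _)

theorem tendsto_nhdsGT_of_continuousOn {H : Type*} [TopologicalSpace H] (hT : 0 < T) {u : ℝ → H}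
    (hu : ContinuousOn u (Icc 0 T)) : Tendsto u (𝓝[>] 0) (𝓝 (u 0)) := by
  have h1 : Tendsto u (𝓝[Icc 0 T] 0) (𝓝 (u 0)) := hu 0 (left_mem_Icc.2 hT.le)
  refine h1.mono_left ?_
  rw [← nhdsWithin_Ioo_eq_nhdsGT hT]
  exact nhdsWithin_mono _ Ioo_subset_Icc_self

/-- A function that is continuous with values in `V_s` tends to its initial value in `V_s`. -/
theorem tendstoZeroIn_of_continuousOn {s : ℝ} (hs : 0 ≤ s) (hT : 0 < T) {u h : ℝ → L2 m}
    (hh : ContinuousOn h (Icc 0 T))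
    (hx : ∀ t i, inner ℝ (B.φ i) (h t) = B.lam i ^ s * inner ℝ (B.φ i) (u t)) :
    B.TendstoZeroIn s (fun t => u t - u 0) := by
  refine ⟨fun t => (B.powEquiv hs).symm (h t - h 0), Eventually.of_forall fun t => ?_, ?_⟩
  · refine B.powEquiv_symm_eq hs fun i => ?_
    rw [inner_sub_right, inner_sub_right, hx, hx, mul_sub]
  · simp only [LinearIsometryEquiv.norm_map]
    exact tendsto_iff_norm_sub_tendsto_zero.1 (tendsto_nhdsGT_of_continuousOn hT hh)

/-- `sol` is a weak solution. -/
theorem isWeakSolution_sol (hα : 1 < α) (hα2 : α < 2) (hT : 0 < T)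
    (hi : IntegrableOn D.force' (Ioc 0 T)) (hfc : ContinuousOn f (Icc 0 T))
    (hf : ∀ s ∈ Icc 0 T, f s = D.force₀ + ∫ r in (0 : ℝ)..s, D.force' r) :
    B.IsWeakSolution hα T f (B.negPow (1 / α) D.pow₀) D.vel₀ (B.sol α D) where
  continuous_V := by
    refine ⟨fun t => (B.powEquiv (gamma_nonneg hα)).symm (B.solPow α D t),
      (LinearIsometryEquiv.continuous _).comp_continuousOn (B.continuousOn_solPow hα hα2 hi),
      fun t _ => B.powEquiv_symm_eq (gamma_nonneg hα) fun i => B.inner_solPow_eq hα t i⟩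
  contDiff_L2 := (B.contDiffOn_sol hα hα2 hT hi hf).1
  init := B.sol_zero hα hα2 hT hi hf
  init_deriv := by
    rw [(B.contDiffOn_sol hα hα2 hT hi hf).2 0 (left_mem_Icc.2 hT.le),
      B.solVel_zero hα hα2 hT.le hi]
  init_lim := by
    -- The definition leaves σ free in [0, 1/α); σ = 0, convergence in L², suffices. For the
    -- velocity the largest admissible β, 1 - 1/α, is taken: L² convergence passes through the
    -- continuous embedding.
    refine ⟨0, le_rfl, by positivity, ?_⟩
    rw [← B.sol_zero hα hα2 hT hi hf]
    exact B.tendstoZeroIn_of_continuousOn le_rfl hT (B.continuousOn_sol hα hα2 hi) fun t i => by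
      rw [Real.rpow_zero, one_mul]
  init_deriv_lim := by
    refine ⟨1 - 1 / α, one_sub_inv_pos hα, le_rfl, ?_⟩
    have h1 := tendsto_nhdsGT_of_continuousOn hT
      ((B.continuousOn_solVel hα hα2 hi).congr (B.contDiffOn_sol hα hα2 hT hi hf).2)
    rw [(B.contDiffOn_sol hα hα2 hT hi hf).2 0 (left_mem_Icc.2 hT.le),
      B.solVel_zero hα hα2 hT.le hi] at h1
    have h2 := ((B.gelfand (one_sub_inv_pos hα).le).continuous.tendsto _).comp
      (h1.sub_const D.vel₀)
    rw [sub_self, map_zero] at h2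
    simpa using h2.norm
  equation := by
    refine ⟨B.solCaputo hα D f, B.hasCaputoDeriv_sol hα hα2 hT hi hfc hf,
      B.continuousOn_solCaputo hα hα2 hi hfc, fun ψ => ?_⟩
    refine (ae_restrict_mem measurableSet_Ioo).mono fun t ht => ?_
    have hψ := B.V_mem_dom (half_le_inv hα hα2) ψ
    obtain ⟨hu, hop⟩ := B.isOp_sol hα hα2 hi hf (Ioo_subset_Ioc_self ht)
    refine ⟨hu, hψ, ?_⟩
    rw [hop ⟨_, hψ⟩, ← B.gelfand_sub_solA hα hα2 hi hf (Ioo_subset_Ioc_self ht), gelfand_apply,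
      inner_sub_left, sub_add_cancel]

/-- `sol` is a strong solution. -/
theorem isStrongSolution_sol (hα : 1 < α) (hα2 : α < 2) (hT : 0 < T)
    (hi : IntegrableOn D.force' (Ioc 0 T)) (hfc : ContinuousOn f (Icc 0 T))
    (hf : ∀ s ∈ Icc 0 T, f s = D.force₀ + ∫ r in (0 : ℝ)..s, D.force' r) :
    B.IsStrongSolution hα T f (B.negPow (1 / α) D.pow₀) D.vel₀ (B.sol α D) where
  weak := B.isWeakSolution_sol hα hα2 hT hi hfc hf
  caputo_L1 := by
    refine ⟨B.solCaputo hα D f, B.hasCaputoDeriv_sol hα hα2 hT hi hfc hf,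
      fun t => f t - B.solA α D t, ?_, ?_⟩
    · exact (hfc.integrableOn_Icc.mono_set Ioo_subset_Icc_self).sub
        ((B.integrableOn_solA hα hα2 hi).mono_set Ioo_subset_Ioc_self)
    · exact (ae_restrict_mem measurableSet_Ioo).mono fun t ht =>
        B.gelfand_sub_solA hα hα2 hi hf (Ioo_subset_Ioc_self ht)
  dom_L1 := by
    refine ⟨fun t => (B.powEquiv zero_le_one).symm (B.solA α D t), ?_, ?_⟩
    · exact ((B.powEquiv zero_le_one).symm.toContinuousLinearEquiv : L2 m →L[ℝ] B.V 1)
        |>.integrable_comp ((B.integrableOn_solA hα hα2 hi).mono_set Ioo_subset_Ioc_self)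
    · refine (ae_restrict_mem measurableSet_Ioo).mono fun t ht => ?_
      refine B.powEquiv_symm_eq zero_le_one fun i => ?_
      rw [B.inner_solA hα hα2 hi hf (Ioo_subset_Ioc_self ht), Real.rpow_one]

/-- `sol` is given by the spectral formula. -/
theorem isSpectralValue_sol (hα : 1 < α) (hα2 : α < 2)
    (hi : IntegrableOn D.force' (Ioc 0 T))
    (hf : ∀ s ∈ Icc 0 T, f s = D.force₀ + ∫ r in (0 : ℝ)..s, D.force' r) (ht : t ∈ Icc 0 T) :
    B.IsSpectralValue α f (B.negPow (1 / α) D.pow₀) D.vel₀ t (B.sol α D t) := by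
  have h1 : ∀ i, inner ℝ (B.φ i) (B.mlOp α 1 0 t (B.negPow (1 / α) D.pow₀))
      = B.initCoef α D i * mlk α 1 (B.lam i) t := fun i => by
    rw [B.inner_mlOp hα hα2 one_pos le_rfl zero_le_one, B.mlMult_of_nonneg ht.1 (by ring),
      B.inner_negPow (gamma_nonneg hα), Real.rpow_zero, initCoef]
    ring
  have h2 : ∀ i, inner ℝ (B.φ i) (t • B.mlOp α 2 0 t D.vel₀)
      = inner ℝ (B.φ i) D.vel₀ * mlk α 2 (B.lam i) t := fun i => by
    have := B.rpow_mul_mlMult_zero (α := α) (b := 2) ht.1 i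
    rw [inner_smul_right, B.inner_mlOp hα hα2 two_pos le_rfl zero_le_one, ← this,
      abs_of_nonneg ht.1, show (2 : ℝ) - 1 = 1 by norm_num, Real.rpow_one]
    ring
  -- The third sum is taken to be what remains of u after the first two; its coordinates are the
  -- convolutions with f, so its convergence needs no separate proof.
  refine ⟨B.mlOp α 1 0 t (B.negPow (1 / α) D.pow₀), t • B.mlOp α 2 0 t D.vel₀,
    B.sol α D t - B.mlOp α 1 0 t (B.negPow (1 / α) D.pow₀) - t • B.mlOp α 2 0 t D.vel₀, by abel,
    hasSum_of_inner fun i => ?_, hasSum_of_inner fun i => ?_, hasSum_of_inner fun i => ?_⟩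
  · rw [h1, real_inner_comm, B.inner_negPow (gamma_nonneg hα), mlk, sub_self, Real.rpow_zero,
      one_mul, initCoef]
  · rw [h2, real_inner_comm, mlk, show (2 : ℝ) - 1 = 1 by norm_num, Real.rpow_one]
  · rw [inner_sub_right, inner_sub_right, h1, h2, B.inner_sol hα hα2 hi hf ht, scalarSol]
    have e : ∀ a b c : ℝ, a + b + c - a - b = c := fun a b c => by ring
    rw [e, conv]
    refine intervalIntegral.integral_congr fun τ _ => ?_
    simp only [mlk]
    rw [real_inner_comm, mul_comm]

end Solution

end EigenBasis

end StrongSolution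

/-! ### Uniqueness of weak solutions. -/

section Uniqueness

/-- Such an h is affine on (0, T), and h = o(t) kills both coefficients. -/
theorem eq_zero_of_second_deriv_eq_zero {h k : ℝ → ℝ} {T : ℝ} (hT : 0 < T)
    (hh : ∀ t ∈ Ioo 0 T, HasDerivAt h (k t) t) (hk : ∀ t ∈ Ioo 0 T, HasDerivAt k 0 t)
    (hlim : h =o[𝓝[>] 0] fun t : ℝ => t) : ∀ t ∈ Ioo 0 T, h t = 0 := by
  obtain ⟨b, hb⟩ := isOpen_Ioo.exists_is_const_of_deriv_eq_zero isPreconnected_Ioo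
    (fun t ht => (hk t ht).differentiableAt.differentiableWithinAt) fun t ht => (hk t ht).deriv
  have hh' : ∀ t ∈ Ioo 0 T, HasDerivAt (fun t => h t - b * t) 0 t := fun t ht => by
    have h1 := (hh t ht).sub ((hasDerivAt_id t).const_mul b)
    rw [hb t ht, mul_one, sub_self] at h1
    exact h1
  obtain ⟨a, ha⟩ := isOpen_Ioo.exists_is_const_of_deriv_eq_zero isPreconnected_Ioo
    (fun t ht => (hh' t ht).differentiableAt.differentiableWithinAt) fun t ht => (hh' t ht).deriv
  have hform : ∀ t ∈ Ioo 0 T, h t = a + b * t := fun t ht => by linarith [ha t ht]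
  have hmem : ∀ᶠ t in 𝓝[>] (0 : ℝ), t ∈ Ioo 0 T := Ioo_mem_nhdsGT hT
  have hid : Tendsto (fun t : ℝ => t) (𝓝[>] 0) (𝓝 0) := tendsto_nhdsWithin_of_tendsto_nhds tendsto_id
  have ha0 : a = 0 := by
    have h1 : Tendsto h (𝓝[>] 0) (𝓝 0) := hlim.trans_tendsto hid
    have h2 : Tendsto (fun t => a + b * t) (𝓝[>] 0) (𝓝 (a + b * 0)) :=
      tendsto_const_nhds.add (hid.const_mul b)
    have h3 := tendsto_nhds_unique h2 (h1.congr' (hmem.mono fun t ht => hform t ht))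
    simpa using h3
  have hb0 : b = 0 := by
    have h1 := hlim.tendsto_div_nhds_zero
    have h2 : Tendsto (fun _ : ℝ => b) (𝓝[>] 0) (𝓝 0) := h1.congr' (hmem.mono fun t ht => by
      rw [hform t ht, ha0, zero_add, mul_div_cancel_right₀ _ ht.1.ne'])
    exact tendsto_nhds_unique tendsto_const_nhds h2
  intro t ht
  rw [hform t ht, ha0, hb0]
  ring

theorem integral_integral_eq_conv {w : ℝ → ℝ} {t : ℝ} (ht : 0 ≤ t) (hw : ContinuousOn w (Icc 0 t)) :
    ∫ s in (0 : ℝ)..t, ∫ r in (0 : ℝ)..s, w r = conv (rl 2) w t := by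
  obtain ⟨C, hC⟩ := exists_abs_le_of_continuousOn hw
  rw [← conv_one, conv_congr_right ht fun s _ => (conv_one w s).symm,
    conv_assoc_of_bounded ht (measurable_rl 1) (measurable_rl 1)
      ((hw.mono Ioc_subset_Icc_self).aestronglyMeasurable measurableSet_Ioc)
      (integrableOn_rl one_pos t) (integrableOn_rl one_pos t) hC]
  refine conv_congr_left ht fun s hs => ?_
  rw [conv_rl_rl one_pos one_pos hs.1, one_add_one_eq_two]

/-- Near 0 one has |z(s)| ≤ s, so the convolution is at most k_{2-α} * k_2 = k_{4-α}, of order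
t^(3-α), and 3 - α > 1. -/
theorem conv_rl_isLittleO {α T : ℝ} (hα2 : α < 2) (hT : 0 < T) {z : ℝ → ℝ}
    (hz : z =o[𝓝[Icc 0 T] 0] fun t : ℝ => t) :
    conv (rl (2 - α)) z =o[𝓝[>] 0] fun t : ℝ => t := by
  have h2α : 0 < 2 - α := by linarith
  have h1 := (hz.bound one_pos)
  rw [← nhdsWithin_Ioo_eq_nhdsGT hT]
  obtain ⟨δ, hδ, hb⟩ := Metric.mem_nhdsWithin_iff.1 h1
  have h2 : conv (rl (2 - α)) z =O[𝓝[Ioo 0 T] 0] fun t => rl (4 - α) t := by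
    refine Asymptotics.IsBigO.of_bound 1 ?_
    filter_upwards [self_mem_nhdsWithin, mem_nhdsWithin_of_mem_nhds (Iio_mem_nhds hδ)] with t ht htδ
    have h4 : rl (4 - α) t = conv (rl (2 - α)) (rl 2) t := by
      rw [conv_rl_rl h2α two_pos ht.1]; congr 1; ring
    rw [Real.norm_of_nonneg (rl_nonneg (by linarith) ht.1.le), one_mul, h4]
    refine intervalIntegral.norm_integral_le_of_norm_le ht.1.le
      (Eventually.of_forall fun s hs => ?_) ?_
    · rw [norm_mul, Real.norm_of_nonneg (rl_nonneg h2α (by linarith [hs.2])), rl_two]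
      refine mul_le_mul_of_nonneg_left ?_ (rl_nonneg h2α (by linarith [hs.2]))
      have h5 : s ∈ Metric.ball (0 : ℝ) δ ∩ Icc 0 T := by
        refine ⟨?_, hs.1.le, hs.2.trans ht.2.le⟩
        rw [Metric.mem_ball, Real.dist_eq, sub_zero, abs_of_pos hs.1]
        exact hs.2.trans_lt htδ
      have h6 := hb h5
      simp only [mem_ofPred_eq, one_mul] at h6
      rwa [Real.norm_of_nonneg hs.1.le] at h6
    · refine intervalIntegrable_conv ht.1.le (integrableOn_rl h2α t) ?_
      have : rl 2 = id := funext rl_two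
      rw [this]
      exact continuousOn_id
  refine h2.trans_isLittleO ?_
  rw [nhdsWithin_Ioo_eq_nhdsGT hT]
  have h3 : Tendsto (fun t : ℝ => t ^ (2 - α) / Real.Gamma (4 - α)) (𝓝[>] 0) (𝓝 0) := by
    have : Continuous fun t : ℝ => t ^ (2 - α) / Real.Gamma (4 - α) :=
      (Real.continuous_rpow_const h2α.le).div_const _
    have h4 := this.tendsto 0
    simp only [Real.zero_rpow h2α.ne', zero_div] at h4
    exact h4.mono_left nhdsWithin_le_nhds
  refine (Asymptotics.isLittleO_iff_tendsto' ?_).2 (h3.congr' ?_)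
  · filter_upwards [self_mem_nhdsWithin] with t ht h0
    exact absurd h0 (ne_of_gt ht)
  · filter_upwards [self_mem_nhdsWithin] with t ht
    have ht' : (0 : ℝ) < t := ht
    rw [rl, show 4 - α - 1 = (2 - α) + 1 by ring, Real.rpow_add_one ht'.ne']
    field_simp

variable {X : Type*} [MeasurableSpace X] {m : Measure X}

namespace EigenBasis

variable {E : DirichletForm m} {ι : Type*} (B : EigenBasis E ι) {α T t : ℝ} {f u v : ℝ → L2 m}
  {u₀ u₁ : L2 m}

/-- A weak solution satisfies the integrated equation coordinatewise. -/
theorem IsWeakSolution.conv_eq {B : EigenBasis E ι} {hα : 1 < α} (hα2 : α < 2) (hT : 0 < T)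
    (hfc : ContinuousOn f (Icc 0 T)) (hu : B.IsWeakSolution hα T f u₀ u₁ u) (i : ι) :
    ∀ t ∈ Ioo 0 T, conv (rl (2 - α)) (fun s => inner ℝ (B.φ i) (u s) - inner ℝ (B.φ i) u₀
        - s * inner ℝ (B.φ i) u₁) t
      = conv (rl 2) (fun s => inner ℝ (B.φ i) (f s) - B.lam i * inner ℝ (B.φ i) (u s)) t := by
  have huc : ContinuousOn u (Icc 0 T) := hu.contDiff_L2.continuousOn
  obtain ⟨w, ⟨G', hG⟩, hwc, hweq⟩ := hu.equation
  set b := B.basisV (gamma_nonneg hα) i with hb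
  set z : ℝ → ℝ := fun s => inner ℝ (B.φ i) (u s) - inner ℝ (B.φ i) u₀
        - s * inner ℝ (B.φ i) u₁ with hz
  have hwb : ContinuousOn (fun s => w s b) (Icc 0 T) := hwc.clm_apply continuousOn_const
  have hwi : IntegrableOn (fun s => w s b) (Ioo 0 T) :=
    hwb.integrableOn_Icc.mono_set Ioo_subset_Icc_self
  have hW := continuousOn_integral_of_integrableOn hT.le hwi
  have hmem : ∀ t ∈ Ioo 0 T, Icc 0 T ∈ 𝓝 t := fun t ht => Icc_mem_nhds ht.1 ht.2
  have hcap : EqOn (fun t => B.gelfand (gamma_nonneg hα) (caputoPrimitive α T u t) b)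
      (conv (rl (2 - α)) z) (Icc 0 T) := fun t ht => by
    simp only
    rw [hb, gelfand_basisV, inner_caputoPrimitive hα2 huc ht, hu.init, hu.init_deriv]
  have hzo : z =o[𝓝[Icc 0 T] 0] fun t : ℝ => t := by
    have h1 : HasDerivWithinAt u u₁ (Icc 0 T) 0 := by
      rw [← hu.init_deriv]
      exact ((hu.contDiff_L2.differentiableOn one_ne_zero) 0
        (left_mem_Icc.2 hT.le)).hasDerivWithinAt
    have h2 := ((innerSL ℝ (B.φ i)).hasFDerivAt.comp_hasDerivWithinAt 0 h1).isLittleO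
    simp only [Function.comp_def, innerSL_apply_apply, hu.init, sub_zero, smul_eq_mul] at h2
    exact h2
  -- The coordinate of the Caputo primitive and the double primitive of w have the same second
  -- derivative. Their difference is o(t), because the initial conditions give u(t) - u₀ - t u₁ =
  -- o(t); so it vanishes.
  have hzero := eq_zero_of_second_deriv_eq_zero hT
    (h := fun t => conv (rl (2 - α)) z t - ∫ s in (0 : ℝ)..t, ∫ r in (0 : ℝ)..s, w r b)
    (k := fun t => G' t b - ∫ s in (0 : ℝ)..t, w s b) (fun t ht => ?_) (fun t ht => ?_) ?_
  · have hae : (fun s => w s b) =ᵐ[volume.restrict (Ioo 0 T)]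
        fun s => inner ℝ (B.φ i) (f s) - B.lam i * inner ℝ (B.φ i) (u s) := by
      refine (hweq b).mono fun s hs => ?_
      obtain ⟨hd, hψ, he⟩ := hs
      have hcoe : (b : L2 m) = B.φ i := B.coe_basisV (gamma_nonneg hα) i
      have hψ' : B.φ i ∈ E.dom := by rw [← hcoe]; exact hψ
      have h3 : (⟨(b : L2 m), hψ⟩ : E.dom) = ⟨B.φ i, hψ'⟩ := Subtype.ext hcoe
      rw [h3, B.form_basis, hcoe, real_inner_comm (B.φ i) (f s)] at he
      change w s b = _
      linarith
    have hrc : ContinuousOn (fun s => inner ℝ (B.φ i) (f s) - B.lam i * inner ℝ (B.φ i) (u s))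
        (Icc 0 T) :=
      (continuousOn_const.inner hfc).sub (continuousOn_const.mul (continuousOn_const.inner huc))
    -- The variational identity is given almost everywhere in time; continuity of both sides extends
    -- it to all of (0, T).
    have heq := Measure.eqOn_Ioo_of_ae_eq volume hae (hwb.mono Ioo_subset_Icc_self)
      (hrc.mono Ioo_subset_Icc_self)
    intro t ht
    have h4 := hzero t ht
    rw [integral_integral_eq_conv ht.1.le (hwb.mono (Icc_subset_Icc_right ht.2.le)),
      sub_eq_zero] at h4
    rw [h4]
    exact conv_congr_right ht.1.le fun s hs => heq ⟨hs.1, hs.2.trans_lt ht.2⟩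
  · have h1 := ((hG t ht).1.clm_apply (hasDerivAt_const t b))
    simp only [map_zero, add_zero] at h1
    have h2 := h1.congr_of_eventuallyEq (hcap.symm.eventuallyEq_of_mem (hmem t ht))
    exact h2.sub ((hasDerivWithinAt_of_eq_integral (c := 0) hT.le hW (fun r _ => (zero_add _).symm)
      (Ioo_subset_Icc_self ht)).hasDerivAt (hmem t ht))
  · have h1 := ((hG t ht).2.clm_apply (hasDerivAt_const t b))
    simp only [map_zero, add_zero] at h1
    have h2 := h1.sub ((hasDerivWithinAt_of_eq_integral (c := 0) hT.le hwb
      (fun r _ => (zero_add _).symm) (Ioo_subset_Icc_self ht)).hasDerivAt (hmem t ht))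
    rw [sub_self] at h2
    exact h2
  · refine (conv_rl_isLittleO hα2 hT hzo).sub ?_
    have h1 := (hasDerivWithinAt_of_eq_integral (c := 0) hT.le hW (fun r _ => (zero_add _).symm)
      (left_mem_Icc.2 hT.le)).isLittleO
    simp only [intervalIntegral.integral_same, sub_zero, smul_zero] at h1
    refine h1.mono ?_
    rw [← nhdsWithin_Ioo_eq_nhdsGT hT]
    exact nhdsWithin_mono _ Ioo_subset_Icc_self

/-- Weak solutions are unique. -/
theorem IsWeakSolution.eqOn {B : EigenBasis E ι} {hα : 1 < α} (hα2 : α < 2) (hT : 0 < T)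
    (hfc : ContinuousOn f (Icc 0 T)) (hu : B.IsWeakSolution hα T f u₀ u₁ u)
    (hv : B.IsWeakSolution hα T f u₀ u₁ v) : EqOn u v (Icc 0 T) := by
  have huc : ContinuousOn u (Icc 0 T) := hu.contDiff_L2.continuousOn
  have hvc : ContinuousOn v (Icc 0 T) := hv.contDiff_L2.continuousOn
  have h2α : 0 < 2 - α := by linarith
  have hIoo : EqOn u v (Ioo 0 T) := by
    intro t ht
    refine ext_inner_basis B.φ fun i => ?_
    have hui : ContinuousOn (fun s => inner ℝ (B.φ i) (u s)) (Icc 0 T) :=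
      continuousOn_const.inner huc
    have hvi : ContinuousOn (fun s => inner ℝ (B.φ i) (v s)) (Icc 0 T) :=
      continuousOn_const.inner hvc
    have hfi : ContinuousOn (fun s => inner ℝ (B.φ i) (f s)) (Icc 0 T) :=
      continuousOn_const.inner hfc
    have hz := eq_zero_of_conv_rl_add (l := B.lam i) hα hα2
      (z := fun s => inner ℝ (B.φ i) (u s) - inner ℝ (B.φ i) (v s)) (hui.sub hvi) ?_ t ht
    · exact sub_eq_zero.1 hz
    intro r hr
    have hsub : Icc 0 r ⊆ Icc 0 T := Icc_subset_Icc_right hr.2.le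
    have e1 := hu.conv_eq hα2 hT hfc i r hr
    have e2 := hv.conv_eq hα2 hT hfc i r hr
    have lin : ∀ {x : ℝ → ℝ}, ContinuousOn x (Icc 0 T) → ContinuousOn (fun s => x s
        - inner ℝ (B.φ i) u₀ - s * inner ℝ (B.φ i) u₁) (Icc 0 r) := fun hx =>
      ((hx.mono hsub).sub continuousOn_const).sub (continuousOn_id.mul continuousOn_const)
    have lin' : ∀ {x : ℝ → ℝ}, ContinuousOn x (Icc 0 T) → ContinuousOn (fun s =>
        inner ℝ (B.φ i) (f s) - B.lam i * x s) (Icc 0 r) := fun hx =>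
      (hfi.mono hsub).sub (continuousOn_const.mul (hx.mono hsub))
    have e3 := conv_sub hr.1.le (integrableOn_rl h2α r) (lin hui) (lin hvi)
    have e4 := conv_sub hr.1.le (integrableOn_rl two_pos r) (lin' hui) (lin' hvi)
    have e5 := conv_const_mul (rl 2) (fun s => inner ℝ (B.φ i) (u s) - inner ℝ (B.φ i) (v s))
      (-B.lam i) r
    rw [e1, e2, ← e4] at e3
    have e6 : ∀ s, inner ℝ (B.φ i) (u s) - inner ℝ (B.φ i) u₀ - s * inner ℝ (B.φ i) u₁
        - (inner ℝ (B.φ i) (v s) - inner ℝ (B.φ i) u₀ - s * inner ℝ (B.φ i) u₁)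
        = inner ℝ (B.φ i) (u s) - inner ℝ (B.φ i) (v s) := fun s => by ring
    have e7 : ∀ s, inner ℝ (B.φ i) (f s) - B.lam i * inner ℝ (B.φ i) (u s)
        - (inner ℝ (B.φ i) (f s) - B.lam i * inner ℝ (B.φ i) (v s))
        = -B.lam i * (inner ℝ (B.φ i) (u s) - inner ℝ (B.φ i) (v s)) := fun s => by ring
    simp only [e6, e7] at e3
    rw [e3, e5]
    ring
  refine hIoo.of_subset_closure huc hvc Ioo_subset_Icc_self ?_
  rw [closure_Ioo hT.ne]

end EigenBasis

end Uniqueness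

/-! ### The second time derivative. -/

section SecondDerivative

variable {X : Type*} [MeasurableSpace X] {m : Measure X}

namespace EigenBasis

variable {E : DirichletForm m} {ι : Type*} (B : EigenBasis E ι) {α T t b θ e : ℝ}

/-- The exponent e is the one for which t^e cancels the surplus t^(αθ-(b-1)) of the multiplier over
the kernel. -/
theorem inner_rpow_smul_mlOp (hα : 1 < α) (hα2 : α < 2) (hb : 0 < b) (h0 : 0 ≤ θ) (h1 : θ ≤ 1)
    (he : e = b - 1 - α * θ) (ht : 0 < t) (h : L2 m) (i : ι) :
    inner ℝ (B.φ i) (t ^ e • B.mlOp α b θ t h)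
      = B.lam i ^ θ * inner ℝ (B.φ i) h * mlk α b (B.lam i) t := by
  have h2 : t ^ e * t ^ (α * θ - (b - 1)) = 1 := by
    rw [← Real.rpow_add ht, he, show b - 1 - α * θ + (α * θ - (b - 1)) = 0 by ring, Real.rpow_zero]
  rw [inner_smul_right, B.inner_mlOp hα hα2 hb h0 h1, B.mlMult_eq ht]
  linear_combination (B.lam i ^ θ * inner ℝ (B.φ i) h * mlk α b (B.lam i) t) * h2

theorem integrableOn_rpow_smul_mlOp (hα : 1 < α) (hα2 : α < 2) (hb : 0 < b) (h0 : 0 ≤ θ)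
    (h1 : θ ≤ 1) (he : -1 < e) (h : L2 m) :
    IntegrableOn (fun t => t ^ e • B.mlOp α b θ t h) (Ioc 0 T) := by
  obtain ⟨C, hC, hbd⟩ := B.exists_norm_mlOp_le hα hα2 hb h0 h1
  have h2 := integrableOn_rpow_Ioc (b := e + 1) (by linarith) T
  rw [add_sub_cancel_right] at h2
  refine Integrable.mono' (h2.mul_const (C * ‖h‖)) (h2.aestronglyMeasurable.smul
    (B.continuous_mlOp_apply hα hα2 hb h0 h1 h).aestronglyMeasurable)
    ((ae_restrict_mem measurableSet_Ioc).mono fun t ht => ?_)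
  rw [norm_smul, Real.norm_of_nonneg (Real.rpow_nonneg ht.1.le _)]
  exact mul_le_mul_of_nonneg_left (hbd t h) (Real.rpow_nonneg ht.1.le _)

theorem setIntegral_norm_rpow_smul_mlOp_le (hα : 1 < α) (hα2 : α < 2) (hb : 0 < b) (h0 : 0 ≤ θ)
    (h1 : θ ≤ 1) (he : -1 < e) : ∃ C, 0 < C ∧ ∀ T, 0 < T → ∀ h : L2 m,
      ∫ t in Ioc 0 T, ‖t ^ e • B.mlOp α b θ t h‖ ≤ C * (T ^ (e + 1) * ‖h‖) := by
  obtain ⟨C, hC, hbd⟩ := B.exists_norm_mlOp_le hα hα2 hb h0 h1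
  have he1 : 0 < e + 1 := by linarith
  refine ⟨C / (e + 1), by positivity, fun T hT h => ?_⟩
  have h2 := integrableOn_rpow_Ioc (b := e + 1) he1 T
  rw [add_sub_cancel_right] at h2
  have h3 : ∫ t in Ioc 0 T, ‖t ^ e • B.mlOp α b θ t h‖ ≤ ∫ t in Ioc 0 T, t ^ e * (C * ‖h‖) := by
    refine setIntegral_mono_on (B.integrableOn_rpow_smul_mlOp hα hα2 hb h0 h1 he h).norm
      (h2.mul_const _) measurableSet_Ioc fun t ht => ?_
    rw [norm_smul, Real.norm_of_nonneg (Real.rpow_nonneg ht.1.le _)]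
    exact mul_le_mul_of_nonneg_left (hbd t h) (Real.rpow_nonneg ht.1.le _)
  refine h3.trans (le_of_eq ?_)
  rw [integral_mul_const, ← intervalIntegral.integral_of_le hT.le, integral_rpow (Or.inl he),
    Real.zero_rpow he1.ne']
  ring

theorem inner_integral_rpow_smul_mlOp (hα : 1 < α) (hα2 : α < 2) (hb : 0 < b) (h0 : 0 ≤ θ)
    (h1 : θ ≤ 1) (he' : -1 < e) (he : e = b - 1 - α * θ) (ht : 0 ≤ t) (h : L2 m) (i : ι) :
    inner ℝ (B.φ i) (∫ s in (0 : ℝ)..t, s ^ e • B.mlOp α b θ s h)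
      = B.lam i ^ θ * inner ℝ (B.φ i) h * mlk α (b + 1) (B.lam i) t := by
  rw [inner_intervalIntegral ((intervalIntegrable_iff_integrableOn_Ioc_of_le ht).2
    (B.integrableOn_rpow_smul_mlOp hα hα2 hb h0 h1 he' h)), ← integral_mlk hα hb _ ht,
    ← intervalIntegral.integral_const_mul, intervalIntegral.integral_of_le ht,
    intervalIntegral.integral_of_le ht]
  exact setIntegral_congr_fun measurableSet_Ioc fun s hs =>
    B.inner_rpow_smul_mlOp hα hα2 hb h0 h1 he hs.1 h i

/-- The convolution of an integrable function with the weakly singular kernel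
`t^{α-2} E_{α,α-1}(-t^α A)`. -/
theorem exists_singular_conv (hα : 1 < α) (hα2 : α < 2) : ∃ C, 0 < C ∧ ∀ T, 0 < T →
    ∀ g : ℝ → L2 m, IntegrableOn g (Ioc 0 T) → ∃ a : ℝ → L2 m, IntegrableOn a (Ioc 0 T) ∧
      (∀ t ∈ Icc 0 T, ∀ i, inner ℝ (B.φ i) (∫ s in (0 : ℝ)..t, a s)
        = conv (mlk α α (B.lam i)) (fun s => inner ℝ (B.φ i) (g s)) t) ∧
      ∫ t in Ioc 0 T, ‖a t‖ ≤ C * (T ^ (α - 1) * ∫ t in Ioc 0 T, ‖g t‖) := by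
  have hα1 : 0 < α - 1 := by linarith
  obtain ⟨C, hC, hbd⟩ := B.exists_norm_mlOp_le hα hα2 hα1 le_rfl zero_le_one
  refine ⟨C / (α - 1), by positivity, fun T hT g hg => ?_⟩
  -- Cutting kernel and g off outside (0, T] makes them integrable on the line, so Young's
  -- inequality in L¹ applies; the norm of k is T^(α-1)/(α-1).
  set k : ℝ → ℝ := (Ioc 0 T).indicator fun s => s ^ (α - 1 - 1) with hk
  set G : ℝ → L2 m := (Ioc 0 T).indicator g with hG
  have hk0 : ∀ s, 0 ≤ k s := indicator_nonneg fun s hs => Real.rpow_nonneg hs.1.le _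
  have hkm : Measurable k := (measurable_id.pow_const _).indicator measurableSet_Ioc
  have hki : Integrable k := (integrable_indicator_iff measurableSet_Ioc).2
    (integrableOn_rpow_Ioc hα1 T)
  have hGi : Integrable G := (integrable_indicator_iff measurableSet_Ioc).2 hg
  set Φ : ℝ × ℝ → L2 m := fun p => k (p.1 - p.2) • B.mlOp α (α - 1) 0 (p.1 - p.2) (G p.2) with hΦ
  have hconv : Integrable (fun p : ℝ × ℝ => ‖G p.2‖ * k (p.1 - p.2)) (volume.prod volume) :=
    hGi.norm.convolution_integrand (ContinuousLinearMap.mul ℝ ℝ) hki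
  have hΦle : ∀ p, ‖Φ p‖ ≤ C * (‖G p.2‖ * k (p.1 - p.2)) := fun p => by
    rw [hΦ, norm_smul, Real.norm_of_nonneg (hk0 _)]
    have h1 := mul_le_mul_of_nonneg_left (hbd (p.1 - p.2) (G p.2)) (hk0 (p.1 - p.2))
    linarith
  have hΦi : Integrable Φ (volume.prod volume) := by
    refine Integrable.mono' (hconv.const_mul C) ?_ (Eventually.of_forall hΦle)
    have h1 : AEStronglyMeasurable (fun p : ℝ × ℝ => (p.1 - p.2, G p.2)) (volume.prod volume) :=
      (continuous_fst.sub continuous_snd).aestronglyMeasurable.prodMk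
        hGi.aestronglyMeasurable.comp_snd
    have h2 := (B.continuous_mlOp hα hα2 hα1 le_rfl zero_le_one).comp_aestronglyMeasurable h1
    exact (hkm.comp (measurable_fst.sub measurable_snd)).aestronglyMeasurable.smul h2
  have hai : Integrable fun t => ∫ τ, Φ (t, τ) := hΦi.integral_prod_left
  refine ⟨fun t => ∫ τ, Φ (t, τ), hai.integrableOn, fun t ht i => ?_, ?_⟩
  · have hcoef : ∀ᵐ s ∂(volume.restrict (Ioc 0 t)), inner ℝ (B.φ i) (∫ τ, Φ (s, τ))
        = conv (mlk α (α - 1) (B.lam i)) (fun s => inner ℝ (B.φ i) (g s)) s := by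
      filter_upwards [ae_restrict_of_ae hΦi.prod_right_ae, ae_restrict_mem measurableSet_Ioc]
        with s hs hst
      rw [← integral_inner hs, conv, intervalIntegral.integral_of_le hst.1.le,
        integral_Ioc_eq_integral_Ioo, ← integral_indicator measurableSet_Ioo]
      refine integral_congr_ae (Eventually.of_forall fun τ => ?_)
      simp only [hΦ]
      by_cases hτ : τ ∈ Ioo 0 s
      · have h1 : s - τ ∈ Ioc 0 T := ⟨by linarith [hτ.2], by linarith [hτ.1, hst.2, ht.2]⟩
        have h2 : τ ∈ Ioc 0 T := ⟨hτ.1, by linarith [hτ.2, hst.2, ht.2]⟩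
        rw [indicator_of_mem hτ, hk, hG, indicator_of_mem h1, indicator_of_mem h2,
          B.inner_rpow_smul_mlOp hα hα2 hα1 le_rfl zero_le_one (by ring) h1.1, Real.rpow_zero]
        ring
      · rw [indicator_of_notMem hτ]
        by_cases h2 : τ ∈ Ioc 0 T
        · have h1 : s - τ ∉ Ioc 0 T := fun h => hτ ⟨h2.1, by linarith [h.1]⟩
          rw [hk, indicator_of_notMem h1, zero_smul, inner_zero_right]
        · rw [hG, indicator_of_notMem h2, map_zero, smul_zero, inner_zero_right]
    rw [inner_intervalIntegral hai.intervalIntegrable, intervalIntegral.integral_of_le ht.1,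
      integral_congr_ae hcoef, ← intervalIntegral.integral_of_le ht.1, ← conv_one,
      conv_rl_one_conv_mlk hα hα1 ht.1, sub_add_cancel]
    exact Integrable.const_inner _ (hg.mono_set (Ioc_subset_Ioc_right ht.2))
  · have h1 : ∫ t in Ioc 0 T, ‖∫ τ, Φ (t, τ)‖ ≤ ∫ t, ‖∫ τ, Φ (t, τ)‖ :=
      setIntegral_le_integral hai.norm (Eventually.of_forall fun _ => norm_nonneg _)
    have h2 : ∫ t, ‖∫ τ, Φ (t, τ)‖ ≤ ∫ t, ∫ τ, C * (‖G τ‖ * k (t - τ)) := by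
      refine integral_mono_ae hai.norm (hconv.const_mul C).integral_prod_left ?_
      filter_upwards [(hconv.const_mul C).prod_right_ae] with t ht
      exact norm_integral_le_of_norm_le ht (Eventually.of_forall fun τ => hΦle (t, τ))
    have h3 : ∫ t, ∫ τ, C * (‖G τ‖ * k (t - τ)) = C * ((∫ τ, ‖G τ‖) * ∫ s, k s) := by
      have h4 := integral_convolution (μ := volume) (ν := volume) (ContinuousLinearMap.mul ℝ ℝ)
        hGi.norm hki
      simp only [convolution_def, ContinuousLinearMap.mul_apply'] at h4
      rw [← h4, ← integral_const_mul]
      refine integral_congr_ae (Eventually.of_forall fun t => ?_)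
      simp only [integral_const_mul]
    have h5 : ∫ s, k s = T ^ (α - 1) / (α - 1) := by
      rw [hk, integral_indicator measurableSet_Ioc, ← intervalIntegral.integral_of_le hT.le,
        integral_rpow (Or.inl (by linarith)), sub_add_cancel, Real.zero_rpow hα1.ne', sub_zero]
    have h6 : ∫ τ, ‖G τ‖ = ∫ t in Ioc 0 T, ‖g t‖ := by
      rw [← integral_indicator measurableSet_Ioc]
      refine integral_congr_ae (Eventually.of_forall fun t => ?_)
      simp only [hG, norm_indicator_eq_indicator_norm]
    rw [h3, h5, h6] at h2
    refine (h1.trans h2).trans (le_of_eq ?_)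
    ring

variable {σ β : ℝ}

/-- The second time derivative of the solution. -/
theorem exists_solAcc (hα : 1 < α) (hα2 : α < 2) (hσ : 1 / α < σ) (hσ1 : σ ≤ 1)
    (hβ : 1 - 1 / α < β) (hβ1 : β ≤ 1) : ∃ C, 0 < C ∧ ∀ T, 0 < T → ∀ (D : CauchyData m)
      (P Q : L2 m), IntegrableOn D.force' (Ioc 0 T) →
      (∀ i, inner ℝ (B.φ i) P = B.lam i ^ σ * B.initCoef α D i) →
      (∀ i, inner ℝ (B.φ i) Q = B.lam i ^ β * inner ℝ (B.φ i) D.vel₀) →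
      ∃ a : ℝ → L2 m, IntegrableOn a (Ioc 0 T) ∧
        (∀ t ∈ Icc 0 T, B.solVel α D t = D.vel₀ + ∫ s in (0 : ℝ)..t, a s) ∧
        ∫ t in Ioc 0 T, ‖a t‖ ≤ C * (T ^ (α * σ - 1) * ‖P‖ + T ^ (1 - α * (1 - β)) * ‖Q‖
          + T ^ (α - 1) * (∫ t in Ioc 0 T, ‖D.force' t‖) + T ^ (α - 1) * ‖D.force₀‖) := by
  have hα0 : 0 < α := by linarith
  have hα1 : 0 < α - 1 := by linarith
  have hγ := gamma_nonneg hα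
  have hαγ : α * (1 / α) = 1 := by field_simp
  have hασ : 1 < α * σ := by rw [← hαγ]; exact mul_lt_mul_of_pos_left hσ hα0
  have hαβ : α - 1 < α * β := by
    rw [← mul_one_sub_inv hα]; exact mul_lt_mul_of_pos_left hβ hα0
  have hθ0 : 0 ≤ 2 - β - 1 / α := by linarith [inv_le_one_of_one_lt hα]
  have hθ1 : 2 - β - 1 / α ≤ 1 := by linarith
  have hσ0 : 0 ≤ 1 - σ := by linarith
  have hσ1' : 1 - σ ≤ 1 := by linarith
  obtain ⟨C₁, hC₁, h₁⟩ := B.setIntegral_norm_rpow_smul_mlOp_le hα hα2 hα1 hσ0 hσ1'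
    (e := α * σ - 2) (by linarith)
  obtain ⟨C₂, hC₂, h₂⟩ := B.setIntegral_norm_rpow_smul_mlOp_le hα hα2 hα0 hθ0 hθ1
    (e := α * β - α) (by linarith)
  obtain ⟨C₃, hC₃, h₃⟩ := B.setIntegral_norm_rpow_smul_mlOp_le hα hα2 hα1 le_rfl zero_le_one
    (e := α - 2) (by linarith)
  obtain ⟨C₄, hC₄, h₄⟩ := B.exists_singular_conv hα hα2
  refine ⟨C₁ + C₂ * ‖B.negPow (1 - 1 / α)‖ + C₃ + C₄, by positivity,
    fun T hT D P Q hi hP hQ => ?_⟩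
  obtain ⟨a₄, ha₄, hc₄, hn₄⟩ := h₄ T hT D.force' hi
  -- These are, up to sign, the derivatives of the terms of the velocity, with as much of A as
  -- possible moved onto the data. The exponents ασ-2, αβ-α and α-2 exceed -1 by the assumptions on
  -- σ, β and α.
  set a₁ : ℝ → L2 m := fun t => t ^ (α * σ - 2) • B.mlOp α (α - 1) (1 - σ) t P with ha₁
  -- The direct choice θ = 1 - β would lead to T^(αβ). Spending A^{-(1-1/α)} on Q and compensating
  -- in θ gives the exponent 1 - α(1-β) of the statement.
  set a₂ : ℝ → L2 m := fun t => t ^ (α * β - α) •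
    B.mlOp α α (2 - β - 1 / α) t (B.negPow (1 - 1 / α) Q) with ha₂
  set a₃ : ℝ → L2 m := fun t => t ^ (α - 2) • B.mlOp α (α - 1) 0 t D.force₀ with ha₃
  have i₁ : ∀ t, IntegrableOn a₁ (Ioc 0 t) := fun t =>
    B.integrableOn_rpow_smul_mlOp hα hα2 hα1 hσ0 hσ1' (by linarith) P
  have i₂ : ∀ t, IntegrableOn a₂ (Ioc 0 t) := fun t =>
    B.integrableOn_rpow_smul_mlOp hα hα2 hα0 hθ0 hθ1 (by linarith) _
  have i₃ : ∀ t, IntegrableOn a₃ (Ioc 0 t) := fun t =>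
    B.integrableOn_rpow_smul_mlOp hα hα2 hα1 le_rfl zero_le_one (by linarith) _
  refine ⟨fun t => a₃ t + a₄ t - (a₁ t + a₂ t), ((i₃ T).add ha₄).sub ((i₁ T).add (i₂ T)),
    fun t ht => ?_, ?_⟩
  · have ii : ∀ {a : ℝ → L2 m}, IntegrableOn a (Ioc 0 t) → IntervalIntegrable a volume 0 t :=
      fun h => (intervalIntegrable_iff_integrableOn_Ioc_of_le ht.1).2 h
    have j₁ := ii (i₁ t)
    have j₂ := ii (i₂ t)
    have j₃ := ii (i₃ t)
    have j₄ := ii (ha₄.mono_set (Ioc_subset_Ioc_right ht.2))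
    refine ext_inner_basis B.φ fun i => ?_
    have hl := B.lam_pos i
    rw [intervalIntegral.integral_sub (j₃.add j₄) (j₁.add j₂), intervalIntegral.integral_add j₃ j₄,
      intervalIntegral.integral_add j₁ j₂, inner_add_right, inner_sub_right, inner_add_right,
      inner_add_right, hc₄ t ht i, B.inner_solVel hα hα2 hi ht, ha₁, ha₂, ha₃,
      B.inner_integral_rpow_smul_mlOp hα hα2 hα1 hσ0 hσ1' (by linarith) (by ring) ht.1,
      B.inner_integral_rpow_smul_mlOp hα hα2 hα0 hθ0 hθ1 (by linarith)
        (by linear_combination -hαγ) ht.1,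
      B.inner_integral_rpow_smul_mlOp hα hα2 hα1 le_rfl zero_le_one (by linarith) (by ring) ht.1,
      B.inner_negPow (one_sub_inv_pos hα).le, hP, hQ, sub_add_cancel, scalarVel, Real.rpow_zero]
    have e1 : B.lam i ^ (1 - σ) * B.lam i ^ σ = B.lam i := by
      rw [← Real.rpow_add hl, sub_add_cancel, Real.rpow_one]
    have e2 : B.lam i ^ (2 - β - 1 / α) * B.lam i ^ (-(1 - 1 / α)) * B.lam i ^ β = B.lam i := by
      rw [← Real.rpow_add hl, ← Real.rpow_add hl]
      conv_rhs => rw [← Real.rpow_one (B.lam i)]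
      congr 1
      ring
    have e3 : mlk α 1 (B.lam i) t = 1 - B.lam i * mlk α (α + 1) (B.lam i) t := by
      rcases ht.1.eq_or_lt with h | h
      · rw [← h, mlk_one_at_zero hα, mlk_at_zero (by linarith)]; ring
      · rw [mlk_recurrence hα one_pos _ h, rl_one, add_comm 1 α]
    rw [e3]
    linear_combination (B.initCoef α D i * mlk α α (B.lam i) t) * e1
      + (inner ℝ (B.φ i) D.vel₀ * mlk α (α + 1) (B.lam i) t) * e2
  · have hle : ∫ t in Ioc 0 T, ‖a₃ t + a₄ t - (a₁ t + a₂ t)‖ ≤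
        ∫ t in Ioc 0 T, ((‖a₃ t‖ + ‖a₄ t‖) + (‖a₁ t‖ + ‖a₂ t‖)) := by
      refine integral_mono (((i₃ T).add ha₄).sub ((i₁ T).add (i₂ T))).norm
        (((i₃ T).norm.add ha₄.norm).add ((i₁ T).norm.add (i₂ T).norm)) fun t => ?_
      exact (norm_sub_le _ _).trans (add_le_add (norm_add_le _ _) (norm_add_le _ _))
    have n₁ := h₁ T hT P
    have n₂ := h₂ T hT (B.negPow (1 - 1 / α) Q)
    have n₃ := h₃ T hT D.force₀
    have hop := (B.negPow (1 - 1 / α)).le_opNorm Q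
    have s₁ : IntegrableOn (fun t => ‖a₁ t‖ + ‖a₂ t‖) (Ioc 0 T) := (i₁ T).norm.add (i₂ T).norm
    have s₂ : IntegrableOn (fun t => ‖a₃ t‖ + ‖a₄ t‖) (Ioc 0 T) := (i₃ T).norm.add ha₄.norm
    rw [integral_add s₂ s₁, integral_add (i₃ T).norm ha₄.norm,
      integral_add (i₁ T).norm (i₂ T).norm] at hle
    rw [show α * σ - 2 + 1 = α * σ - 1 by ring] at n₁
    rw [show α * β - α + 1 = 1 - α * (1 - β) by ring] at n₂
    rw [show α - 2 + 1 = α - 1 by ring] at n₃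
    set x₁ := T ^ (α * σ - 1) * ‖P‖ with hx₁
    set x₃ := T ^ (α - 1) * ‖D.force₀‖ with hx₃
    set x₄ := T ^ (α - 1) * ∫ t in Ioc 0 T, ‖D.force' t‖ with hx₄
    set N := ‖B.negPow (1 - 1 / α)‖ with hN
    have hN0 : 0 ≤ N := norm_nonneg _
    have hx₁0 : 0 ≤ x₁ := by positivity
    have hx₃0 : 0 ≤ x₃ := by positivity
    have hx₄0 : 0 ≤ x₄ := mul_nonneg (by positivity) (integral_nonneg fun _ => norm_nonneg _)
    set x₂ := T ^ (1 - α * (1 - β)) * ‖Q‖ with hx₂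
    have hx₂0 : 0 ≤ x₂ := by positivity
    have n₂' : ∫ t in Ioc 0 T, ‖a₂ t‖ ≤ C₂ * N * x₂ := by
      refine n₂.trans ?_
      calc _ ≤ C₂ * (T ^ (1 - α * (1 - β)) * (N * ‖Q‖)) := by gcongr
        _ = _ := by rw [hx₂]; ring
    have : C₁ * x₁ + C₂ * N * x₂ + C₃ * x₃ + C₄ * x₄ ≤
        (C₁ + C₂ * N + C₃ + C₄) * (x₁ + x₂ + x₄ + x₃) := by
      set S := x₁ + x₂ + x₄ + x₃ with hS
      have s₁ : x₁ ≤ S := by linarith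
      have s₂ : x₂ ≤ S := by linarith
      have s₃ : x₃ ≤ S := by linarith
      have s₄ : x₄ ≤ S := by linarith
      rw [add_mul, add_mul, add_mul]
      gcongr
    linarith

end EigenBasis

end SecondDerivative

/-! ### Assembly of parts (a) and (b). -/

section Main

/-- A totally bounded metric space is separable, hence second countable, and then so is the Borel
structure that L² is built on; the separability is used to index the eigenbasis by a subset of ℕ. -/
theorem separableSpace_L2 {X : Type*} [MetricSpace X] [MeasurableSpace X] [BorelSpace X]
    (hX : TotallyBounded (Set.univ : Set X)) (m : Measure X) [IsFiniteMeasure m] :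
    TopologicalSpace.SeparableSpace (L2 m) := by
  have h1 : TopologicalSpace.SeparableSpace X :=
    TopologicalSpace.isSeparable_univ_iff.1 hX.isSeparable
  have h2 : SecondCountableTopology X := UniformSpace.secondCountable_of_separable X
  have h3 : Fact ((2 : ℝ≥0∞) ≠ ⊤) := ⟨by norm_num⟩
  infer_instance

theorem IsW1.integrableOn_deriv_Ioc {H : Type*} [NormedAddCommGroup H] [NormedSpace ℝ H]
    {q : ℝ≥0∞} (hq : 1 ≤ q) {T : ℝ} {f f' : ℝ → H} (hf : IsW1 q T f f') :
    IntegrableOn f' (Ioc 0 T) := by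
  rw [integrableOn_Ioc_iff_integrableOn_Ioo]
  exact hf.integrableOn_deriv hq

theorem lqNorm_one {H : Type*} [NormedAddCommGroup H] [NormedSpace ℝ H] {T : ℝ} {g : ℝ → H}
    (hg : IntegrableOn g (Ioc 0 T)) : lqNorm 1 T g = ∫ t in Ioc 0 T, ‖g t‖ := by
  rw [lqNorm, restrict_Ioo_eq_restrict_Ioc, integral_norm_eq_lintegral_enorm hg.1,
    eLpNorm_one_eq_lintegral_enorm]

namespace EigenBasis

variable {X : Type*} [MeasurableSpace X] {m : Measure X} {E : DirichletForm m} {ι : Type*}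
  (B : EigenBasis E ι) {α : ℝ}

theorem negPow_of_inner {s : ℝ} (hs : 0 ≤ s) {x h : L2 m}
    (hx : ∀ i, inner ℝ (B.φ i) h = B.lam i ^ s * inner ℝ (B.φ i) x) : B.negPow s h = x := by
  refine ext_inner_basis B.φ fun i => ?_
  rw [B.inner_negPow hs, hx i, ← mul_assoc, ← Real.rpow_add (B.lam_pos i), neg_add_cancel,
    Real.rpow_zero, one_mul]

/-- Existence, uniqueness and the spectral formula, with the pointwise estimate. -/
theorem exists_strongSolution (hα : 1 < α) (hα2 : α < 2) {p : ℝ} (hp1 : 1 ≤ p) {q : ℝ≥0∞}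
    (hpq : (ENNReal.ofReal p)⁻¹ + q⁻¹ = 1) :
    ∃ C : ℝ, 0 < C ∧ ∀ (T : ℝ), 0 < T → ∀ (f f' : ℝ → L2 m),
      IsW1 q T f f' → ContinuousOn f (Icc 0 T) →
      ∀ (u₀ : B.V (1 / α)) (u₁ : L2 m),
      ∃ u : ℝ → L2 m, B.IsStrongSolution hα T f u₀ u₁ u ∧
        (∀ v : ℝ → L2 m, B.IsStrongSolution hα T f u₀ u₁ v → EqOn v u (Icc 0 T)) ∧
        (∀ t ∈ Icc 0 T, B.IsSpectralValue α f u₀ u₁ t (u t)) ∧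
        ∀ w, B.HasCaputoDeriv hα T u w → ∀ t ∈ Ioo 0 T,
          ∃ d a : L2 m, B.gelfand (EigenBasis.gamma_nonneg hα) d = w t ∧ E.IsOp (u t) a ∧
            d + a = f t ∧
            ‖d‖ + ‖a‖ ≤ C * t ^ (1 - α) * (‖u₀‖ + ‖u₁‖)
              + C * (‖f t‖ + ‖f 0‖ + t ^ (1 / p) * lqNorm q T f') := by
  obtain ⟨C, hC, hbd⟩ := B.exists_norm_solA_le hα hα2
  have hq := one_le_of_inv_add_inv hpq
  -- One C bounds A u and another bounds it again inside D_t^α u = f - A u; the extra 1 pays for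
  -- ‖f(t)‖.
  refine ⟨2 * C + 1, by positivity, fun T hT f f' hff' hfc u₀ u₁ => ?_⟩
  have hi : IntegrableOn f' (Ioc 0 T) := hff'.integrableOn_deriv_Ioc hq
  have hf : ∀ s ∈ Icc 0 T, f s = f 0 + ∫ r in (0 : ℝ)..s, f' r :=
    fun s hs => hff'.eq_add_integral hq hT hfc hs
  let D : CauchyData m := ⟨B.powLI (1 / α) u₀, u₁, f 0, f'⟩
  have hu₀ : B.negPow (1 / α) D.pow₀ = u₀ :=
    B.negPow_of_inner (gamma_nonneg hα) fun i => B.inner_powLI _ u₀ i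
  have hsol := B.isStrongSolution_sol (D := D) hα hα2 hT hi hfc hf
  rw [hu₀] at hsol
  refine ⟨B.sol α D, hsol, fun v hv => hv.weak.eqOn hα2 hT hfc hsol.weak, fun t ht => ?_,
    fun w hw t ht => ?_⟩
  · have h1 := B.isSpectralValue_sol (D := D) hα hα2 hi hf ht
    rwa [hu₀] at h1
  · have ht' := Ioo_subset_Ioc_self ht
    refine ⟨f t - B.solA α D t, B.solA α D t, ?_, B.isOp_sol (D := D) hα hα2 hi hf ht',
      sub_add_cancel _ _, ?_⟩
    · rw [B.gelfand_sub_solA (D := D) hα hα2 hi hf ht']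
      exact (B.hasCaputoDeriv_sol (D := D) hα hα2 hT hi hfc hf).eqOn B hw ht
    · have h1 := hbd D T hi t ht'
      have h2 := norm_sub_le (f t) (B.solA α D t)
      have h3 : ‖D.pow₀‖ = ‖u₀‖ := (B.powLI (1 / α)).norm_map u₀
      have h4 := hff'.integral_norm_deriv_le hp1 hpq (Ioo_subset_Icc_self ht)
      have h5 : C * (‖D.force₀‖ + ∫ τ in (0 : ℝ)..t, ‖D.force' τ‖) ≤
          C * (‖f 0‖ + t ^ (1 / p) * lqNorm q T f') :=
        mul_le_mul_of_nonneg_left (add_le_add le_rfl h4) hC.le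
      have h6 : 0 ≤ t ^ (1 - α) * (‖u₀‖ + ‖u₁‖) :=
        mul_nonneg (Real.rpow_nonneg ht.1.le _) (by positivity)
      have h7 : 0 ≤ t ^ (1 / p) * lqNorm q T f' :=
        mul_nonneg (Real.rpow_nonneg ht.1.le _) ENNReal.toReal_nonneg
      rw [h3, mul_assoc] at h1
      change _ ≤ C * (t ^ (1 - α) * (‖u₀‖ + ‖u₁‖)) + _ at h1
      have h8 := norm_nonneg (f t)
      have h9 := norm_nonneg (f 0)
      have h10 : 0 ≤ C * ‖f t‖ := mul_nonneg hC.le h8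
      rw [mul_assoc]
      nlinarith

theorem dt_congr {H : Type*} [NormedAddCommGroup H] [NormedSpace ℝ H] {T t : ℝ} {u v : ℝ → H}
    (h : EqOn u v (Icc 0 T)) (ht : t ∈ Icc 0 T) : dt T u t = dt T v t :=
  derivWithin_congr h (h ht)

/-- Regularity of the second time derivative for smoother initial data. -/
theorem exists_second_deriv_bound (hα : 1 < α) (hα2 : α < 2) {p : ℝ} (hp1 : 1 ≤ p) {q : ℝ≥0∞}
    (hpq : (ENNReal.ofReal p)⁻¹ + q⁻¹ = 1) {σ β : ℝ} (hσ : 1 / α < σ) (hβ : (α - 1) / α < β) :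
    ∃ K : ℝ → ℝ, (∀ T, 0 < K T) ∧ (σ ≤ 1 → β ≤ 1 → ∀ T T', K T = K T') ∧
      ∀ (T : ℝ), 0 < T → ∀ (f f' : ℝ → L2 m),
      IsW1 q T f f' → ContinuousOn f (Icc 0 T) →
      ∀ (u₀ : B.V σ) (u₁ : B.V β) (u : ℝ → L2 m),
      B.IsStrongSolution hα T f u₀ u₁ u →
        (∃ u'' : ℝ → L2 m, IsW1 1 T u (dt T u) ∧ IsW1 1 T (dt T u) u'' ∧
          lqNorm 1 T u'' ≤ K T * (T ^ (α * σ - 1) * ‖u₀‖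
            + T ^ (1 - α * (1 - β)) * ‖u₁‖
            + T ^ (1 / p + α - 1) * lqNorm q T f' + T ^ (α - 1) * ‖f 0‖)) ∧
        B.TendstoZeroIn (1 / α) (fun t => u t - (u₀ : L2 m)) ∧
        Tendsto (fun t => ‖dt T u t - (u₁ : L2 m)‖) (𝓝[>] 0) (𝓝 0) := by
  have hq := one_le_of_inv_add_inv hpq
  have hγ := gamma_nonneg hα
  have hγ1 := one_sub_inv_pos hα
  have hα0 : α ≠ 0 := by linarith
  have hβ' : 1 - 1 / α < β := by
    have : (α - 1) / α = 1 - 1 / α := by field_simp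
    rwa [← this]
  have hγlt : 1 / α < 1 := by linarith
  have hγpos : 0 < 1 / α := by positivity
  -- The multipliers are bounded only up to θ = 1, so regularity beyond D(A) is not used: σ and β
  -- are cut at 1 and the surplus enters as a bounded negative power of A applied to the data.
  set σ' := min σ 1 with hσ'
  set β' := min β 1 with hβ''
  have hσσ : 0 ≤ σ - σ' := sub_nonneg.2 (min_le_left _ _)
  have hββ : 0 ≤ β - β' := sub_nonneg.2 (min_le_left _ _)
  obtain ⟨C, hC, hacc⟩ := B.exists_solAcc hα hα2 (σ := σ') (β := β') (lt_min hσ hγlt)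
    (min_le_right _ _) (lt_min hβ' (by linarith)) (min_le_right _ _)
  set N₁ := ‖B.negPow (σ - σ')‖ with hN₁
  set N₂ := ‖B.negPow (β - β')‖ with hN₂
  -- The powers of |T| convert the exponents belonging to the cut values σ', β' into those for σ, β.
  -- For σ, β ≤ 1 they are |T|^0 = 1, and the bound no longer depends on T.
  refine ⟨fun T => C * (N₁ + N₂ + 1) * (|T| ^ (α * (σ' - σ)) + |T| ^ (α * (β' - β)) + 1),
    fun T => ?_, fun h1 h2 T T' => ?_, fun T hT f f' hff' hfc u₀ u₁ u hu => ?_⟩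
  · positivity
  · have h3 : σ' = σ := min_eq_left h1
    have h4 : β' = β := min_eq_left h2
    simp only [h3, h4, sub_self, mul_zero, Real.rpow_zero]
  have hi : IntegrableOn f' (Ioc 0 T) := hff'.integrableOn_deriv_Ioc hq
  have hf : ∀ s ∈ Icc 0 T, f s = f 0 + ∫ r in (0 : ℝ)..s, f' r :=
    fun s hs => hff'.eq_add_integral hq hT hfc hs
  let D : CauchyData m := ⟨B.negPow (σ - 1 / α) (B.powLI σ u₀), u₁, f 0, f'⟩
  have hpow : ∀ s ≤ σ, ∀ i, inner ℝ (B.φ i) (B.negPow (σ - s) (B.powLI σ u₀))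
      = B.lam i ^ s * inner ℝ (B.φ i) (u₀ : L2 m) := fun s hs i => by
    rw [B.inner_negPow (sub_nonneg.2 hs), B.inner_powLI, ← mul_assoc,
      ← Real.rpow_add (B.lam_pos i)]
    congr 2; ring
  have hu₀ : B.negPow (1 / α) D.pow₀ = u₀ := B.negPow_of_inner hγ (hpow _ hσ.le)
  have hinit : ∀ i, B.initCoef α D i = inner ℝ (B.φ i) (u₀ : L2 m) := fun i => by
    rw [← hu₀, B.inner_negPow hγ, initCoef]
  have hsol := B.isStrongSolution_sol (D := D) hα hα2 hT hi hfc hf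
  rw [hu₀] at hsol
  have heq : EqOn u (B.sol α D) (Icc 0 T) := hu.weak.eqOn hα2 hT hfc hsol.weak
  have hdt : ∀ t ∈ Icc 0 T, dt T u t = B.solVel α D t := fun t ht => by
    rw [dt_congr heq ht, (B.contDiffOn_sol (D := D) hα hα2 hT hi hf).2 t ht]
  have hvc : ContinuousOn (B.solVel α D) (Icc 0 T) := B.continuousOn_solVel hα hα2 hi
  have huc : ContinuousOn u (Icc 0 T) := (B.continuousOn_sol hα hα2 hi).congr heq
  have hdc : ContinuousOn (dt T u) (Icc 0 T) := hvc.congr hdt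
  have hz : (B.sol α D) 0 = u₀ := by rw [B.sol_zero (D := D) hα hα2 hT hi hf, hu₀]
  have hv0 : B.solVel α D 0 = u₁ := B.solVel_zero hα hα2 hT.le hi
  have hmem : ∀ᶠ t in 𝓝[>] (0 : ℝ), t ∈ Icc 0 T := Icc_mem_nhdsGT hT
  obtain ⟨a, hai, hav, han⟩ := hacc T hT D (B.negPow (σ - σ') (B.powLI σ u₀))
    (B.negPow (β - β') (B.powLI β u₁)) hi
    (fun i => by rw [hinit]; exact hpow _ (min_le_left _ _) i)
    (fun i => by
      rw [B.inner_negPow hββ, B.inner_powLI, ← mul_assoc, ← Real.rpow_add (B.lam_pos i)]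
      congr 2; ring)
  refine ⟨⟨a, ⟨?_, ?_, ?_⟩, ⟨?_, ?_, ?_⟩, ?_⟩, ?_, ?_⟩
  · rw [memLp_one_iff_integrable]
    exact huc.integrableOn_Icc.mono_set Ioo_subset_Icc_self
  · rw [memLp_one_iff_integrable]
    exact hdc.integrableOn_Icc.mono_set Ioo_subset_Icc_self
  · refine isWeakDeriv_const_add_integral (c := u₀)
      (hdc.integrableOn_Icc.mono_set Ioo_subset_Icc_self) fun t ht => ?_
    rw [heq (Ioo_subset_Icc_self ht), B.sol_eq_add_integral (D := D) hα hα2 hi hf t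
      (Ioo_subset_Icc_self ht), hu₀]
    congr 1
    refine intervalIntegral.integral_congr fun s hs => (hdt s ?_).symm
    rw [uIcc_of_le ht.1.le] at hs
    exact ⟨hs.1, hs.2.trans ht.2.le⟩
  · rw [memLp_one_iff_integrable]
    exact hdc.integrableOn_Icc.mono_set Ioo_subset_Icc_self
  · rw [memLp_one_iff_integrable]
    exact hai.mono_set Ioo_subset_Ioc_self
  · refine isWeakDeriv_const_add_integral (c := u₁) (hai.mono_set Ioo_subset_Ioc_self)
      fun t ht => ?_
    rw [hdt t (Ioo_subset_Icc_self ht)]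
    exact hav t (Ioo_subset_Icc_self ht)
  · rw [lqNorm_one hai]
    refine han.trans ?_
    have g1 : ‖B.negPow (σ - σ') (B.powLI σ u₀)‖ ≤ N₁ * ‖u₀‖ := by
      refine ((B.negPow (σ - σ')).le_opNorm _).trans (le_of_eq ?_)
      rw [LinearIsometry.norm_map]
    have g2 : ‖B.negPow (β - β') (B.powLI β u₁)‖ ≤ N₂ * ‖u₁‖ := by
      refine ((B.negPow (β - β')).le_opNorm _).trans (le_of_eq ?_)
      rw [LinearIsometry.norm_map]
    have g3 : ∫ t in Ioc 0 T, ‖f' t‖ ≤ T ^ (1 / p) * lqNorm q T f' := by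
      rw [← intervalIntegral.integral_of_le hT.le]
      exact hff'.integral_norm_deriv_le hp1 hpq (right_mem_Icc.2 hT.le)
    have e1 : T ^ (α * σ' - 1) = T ^ (α * (σ' - σ)) * T ^ (α * σ - 1) := by
      rw [← Real.rpow_add hT]; congr 1; ring
    have e2 : T ^ (1 - α * (1 - β')) = T ^ (α * (β' - β)) * T ^ (1 - α * (1 - β)) := by
      rw [← Real.rpow_add hT]; congr 1; ring
    have e3 : T ^ (1 / p + α - 1) = T ^ (α - 1) * T ^ (1 / p) := by
      rw [← Real.rpow_add hT]; congr 1; ring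
    beta_reduce
    rw [abs_of_pos hT, e1, e2, e3]
    have hL : 0 ≤ lqNorm q T f' := ENNReal.toReal_nonneg
    set r₁ := T ^ (α * (σ' - σ)) with hr₁
    set r₂ := T ^ (α * (β' - β)) with hr₂
    have hr₁0 : 0 ≤ r₁ := by positivity
    have hr₂0 : 0 ≤ r₂ := by positivity
    have hN₁0 : 0 ≤ N₁ := norm_nonneg _
    have hN₂0 : 0 ≤ N₂ := norm_nonneg _
    have hM : 1 ≤ (N₁ + N₂ + 1) * (r₁ + r₂ + 1) := by nlinarith
    have hM1 : N₁ * r₁ ≤ (N₁ + N₂ + 1) * (r₁ + r₂ + 1) := by gcongr <;> linarith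
    have hM2 : N₂ * r₂ ≤ (N₁ + N₂ + 1) * (r₁ + r₂ + 1) := by gcongr <;> linarith
    set M := (N₁ + N₂ + 1) * (r₁ + r₂ + 1) with hMdef
    rw [mul_assoc C, ← hMdef, mul_assoc C]
    refine mul_le_mul_of_nonneg_left ?_ hC.le
    rw [mul_add, mul_add, mul_add]
    refine add_le_add (add_le_add (add_le_add ?_ ?_) ?_) ?_
    · calc _ ≤ r₁ * T ^ (α * σ - 1) * (N₁ * ‖u₀‖) := by gcongr
        _ = (N₁ * r₁) * (T ^ (α * σ - 1) * ‖u₀‖) := by ring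
        _ ≤ _ := by gcongr
    · calc _ ≤ r₂ * T ^ (1 - α * (1 - β)) * (N₂ * ‖u₁‖) := by gcongr
        _ = (N₂ * r₂) * (T ^ (1 - α * (1 - β)) * ‖u₁‖) := by ring
        _ ≤ _ := by gcongr
    · calc _ ≤ T ^ (α - 1) * (T ^ (1 / p) * lqNorm q T f') :=
            mul_le_mul_of_nonneg_left g3 (by positivity)
        _ = 1 * (T ^ (α - 1) * T ^ (1 / p) * lqNorm q T f') := by ring
        _ ≤ _ := by gcongr
    · calc _ = 1 * (T ^ (α - 1) * ‖f 0‖) := (one_mul _).symm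
        _ ≤ _ := by gcongr
  · obtain ⟨U, hU, hlim⟩ := B.tendstoZeroIn_of_continuousOn hγ hT
      (B.continuousOn_solPow (D := D) hα hα2 hi) fun t i => B.inner_solPow_eq hα t i
    refine ⟨U, ?_, hlim⟩
    filter_upwards [hU, hmem] with t h1 h2
    rw [h1, heq h2, hz]
  · have h1 := tendsto_nhdsGT_of_continuousOn hT hdc
    rw [hdt 0 (left_mem_Icc.2 hT.le), hv0] at h1
    exact tendsto_iff_norm_sub_tendsto_zero.1 h1

end EigenBasis

end Main

end FracWave

end

theorem mainTheorem6 {X : Type*} [MetricSpace X] [MeasurableSpace X] [BorelSpace X]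
    (hX : TotallyBounded (Set.univ : Set X))
    (m : Measure X) [IsFiniteMeasure m] [m.Regular] [m.IsOpenPosMeasure]
    (E : DirichletForm m) (hcompact : E.CompactEmbedding)
    (qA : ℝ) (hqA : 1 < qA) (hsobolev : E.SobolevEmbedding qA) (hpos : E.PosEigenvalues)
    (α : ℝ) (hα : 1 < α) (hα2 : α < 2)
    (p : ℝ) (hp1 : 1 ≤ p) (hp2 : p < 1 / (2 - α))
    (q : ℝ≥0∞) (hpq : (ENNReal.ofReal p)⁻¹ + q⁻¹ = 1) :
    (∃ N : Set ℕ, Nonempty (EigenBasis E N)) ∧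
    ∀ (ι : Type*) (B : EigenBasis E ι),
      (∃ C : ℝ, 0 < C ∧ ∀ (T : ℝ), 0 < T → ∀ (f f' : ℝ → L2 m),
        IsW1 q T f f' → ContinuousOn f (Icc 0 T) →
        ∀ (u₀ : B.V (1 / α)) (u₁ : L2 m),
        ∃ u : ℝ → L2 m, B.IsStrongSolution hα T f u₀ u₁ u ∧
          (∀ v : ℝ → L2 m, B.IsStrongSolution hα T f u₀ u₁ v → EqOn v u (Icc 0 T)) ∧
          (∀ t ∈ Icc 0 T, B.IsSpectralValue α f u₀ u₁ t (u t)) ∧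
          ∀ w, B.HasCaputoDeriv hα T u w → ∀ t ∈ Ioo 0 T,
            ∃ d a : L2 m, B.gelfand (EigenBasis.gamma_nonneg hα) d = w t ∧ E.IsOp (u t) a ∧
              d + a = f t ∧
              ‖d‖ + ‖a‖ ≤ C * t ^ (1 - α) * (‖u₀‖ + ‖u₁‖)
                + C * (‖f t‖ + ‖f 0‖ + t ^ (1 / p) * lqNorm q T f')) ∧
      ∀ σ β : ℝ, 1 / α < σ → (α - 1) / α < β →
        ∃ K : ℝ → ℝ, (∀ T, 0 < K T) ∧ (σ ≤ 1 → β ≤ 1 → ∀ T T', K T = K T') ∧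
          ∀ (T : ℝ), 0 < T → ∀ (f f' : ℝ → L2 m),
          IsW1 q T f f' → ContinuousOn f (Icc 0 T) →
          ∀ (u₀ : B.V σ) (u₁ : B.V β) (u : ℝ → L2 m),
          B.IsStrongSolution hα T f u₀ u₁ u →
            (∃ u'' : ℝ → L2 m, IsW1 1 T u (dt T u) ∧ IsW1 1 T (dt T u) u'' ∧
              lqNorm 1 T u'' ≤ K T * (T ^ (α * σ - 1) * ‖u₀‖
                + T ^ (1 - α * (1 - β)) * ‖u₁‖
                + T ^ (1 / p + α - 1) * lqNorm q T f' + T ^ (α - 1) * ‖f 0‖)) ∧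
            B.TendstoZeroIn (1 / α) (fun t => u t - (u₀ : L2 m)) ∧
            Tendsto (fun t => ‖dt T u t - (u₁ : L2 m)‖) (𝓝[>] 0) (𝓝 0) := by
  have hsep := separableSpace_L2 hX m
  refine ⟨E.exists_eigenBasis hcompact hpos, fun ι B =>
    ⟨B.exists_strongSolution hα hα2 hp1 hpq, fun σ β hσ hβ => ?_⟩⟩
  exact B.exists_second_deriv_bound hα hα2 hp1 hpq hσ hβ
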